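/- **Conventions.** Let $R$ be a commutative ring. A DG $R$-algebra is a non-negatively graded $R$-algebra $A=\bigoplus_{n\ge 0}A_n$ with $ab=(-1)^{|a||b|}ba$ for homogeneous $a,b$ and $a^2=0$ for $|a|$ odd, with an $R$-linear differential $d^A$ of degree $-1$, $d^Ad^A=0$, satisfying the Leibniz rule. DG modules are right DG modules, graded by $\mathbb Z$, with differential of degree $-1$; $\mathsf\Sigma^iM$ is the DG module with $(\mathsf\Sigma^iM)_j=M_{j-i}$, differential $(-1)^i\partial^M$ and unchanged right action. $\mathcal C(A)$ is the category of DG $A$-modules and $\mathcal K(A)$ its homotopy category. A DG module $P$ is semifree if it has a semifree basis: a well-ordered set of homogeneous elements which is a basis of the underlying graded module and such that $\partial^P(f)\in\sum_{e<f}eA$ for every basis element $f$. A DG module is perfect if it is quasiisomorphic to a semifree DG module with a finite semifree basis. **Setting.** Let $\varphi\colon A\to B$ be a homomorphism of DG $R$-algebras such that $B$ is semifree as a DG $A$-module and $\overline B=B/\varphi(A)$ satisfies $\overline B_n=0$ for all $n\le 0$. Let $J$ be the kernel of the multiplication map $B\otimes_AB\to B$, a DG $(B,B)$-bimodule, and let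 $\delta\colon B\to J$, $\delta(b)=b\otimes 1-1\otimes b$. Let $\mathsf\Sigma J$ be its shift, whose left $B$-action is $b\cdot\mathsf\Sigma x=(-1)^{|b|}\mathsf\Sigma(bx)$, and let $T=\bigoplus_{n\ge0}T^n$, $T^n=(\mathsf\Sigma J)^{\otimes_Bn}$, $T^0=B$, be its tensor algebra over $B$. A tensor graded DG $T$-module is a family $M=(M^i)_{i\in\mathbb Z}$ of DG $B$-modules together with homomorphisms $M^i\otimes_B\mathsf\Sigma J\to M^{i+1}$ in $\mathcal C(B)$. Homomorphisms in $\mathcal C^{gr}(T)$ are families of homomorphisms $M^i\to N^i$ in $\mathcal C(B)$ that commute with these actions, and $\mathcal K^{gr}(T)$ has the same objects and $\operatorname{Hom}_{\mathcal K^{gr}(T)}(M,N)=\operatorname{Hom}_{\mathcal C^{gr}(T)}(M,N)/\sim$, where $f\sim g$ iff $f-g=\partial^Nh+h\partial^M$ for a tensor graded $T$-linear map $h\colon M\to\mathsf\Sigma^{-1}N$. There are two kinds of shift: $\mathsf\Sigma^m$ is applied componentwise, and $M[n]^i=M^{i+n}$. For a DG $B$-module $N$, the tensor graded DG $T$-module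 $N\otimes_BT$ has components $N\otimes_BT^i$ for $i\ge0$ and $0$ for $i<0$. Let $N$ be a semifree DG $B$-module with semifree basis $\{e_\lambda\}$, and write $\partial^N(e_\lambda)=\sum_{\mu<\lambda}e_\mu b_{\mu\lambda}$ with $b_{\mu\lambda}\in B$. Let $\omega_N\in\operatorname{Hom}_{\mathcal K^{gr}(T)}(N\otimes_BT,N\otimes_BT[1])$ be the class of the homomorphism given by $$e_\lambda\otimes t\longmapsto\sum_{\mu<\lambda}(-1)^{|e_\mu|}\,e_\mu\otimes\mathsf\Sigma\delta(b_{\mu\lambda})\otimes t .$$ A DG $B$-module $N$ satisfies $(\mathtt{AR1})$ if 1. $N$ is semifree over $B$, and $N_i=0$ for all $i<0$; 2. $B$ and $N$ are perfect as DG $A$-modules via $\varphi$; and 3. $\operatorname{Hom}_{\mathcal K(B)}(N,\mathsf\Sigma^nB)=0$ for all $n\ge1$. **Theorem.** Suppose that $(\mathtt{AR1})$ holds for the DG $B$-module $N$, and let $\omega_N$ be formed with any semifree basis of $N$. Then left composition with $\mathsf\Sigma^m(\omega_N[n])$, $$\operatorname{Hom}_{\mathcal K^{gr}(T)}\bigl(N\otimes_BT,\mathsf\Sigma^m(N\otimes_BT[n])\bigr)\longrightarrow\operatorname{Hom}_{\mathcal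 K^{gr}(T)}\bigl(N\otimes_BT,\mathsf\Sigma^m(N\otimes_BT[n+1])\bigr),$$ is surjective for all integers $m,n\ge0$, and is bijective if $m\ge1$ and $n\ge0$, or if $m=0$ and $n\ge1$. In particular, for every $m\ge0$, every element of $\bigoplus_{n\in\mathbb Z}\operatorname{Hom}_{\mathcal K^{gr}(T)}(N\otimes_BT,\mathsf\Sigma^m(N\otimes_BT[n]))$ whose component at $n=0$ is zero lies in the image of the left action of $\mathsf\Sigma^m\omega_N$ on this graded group, which is given on the component at $n\in\mathbb Z$ by left composition with $\mathsf\Sigma^m(\omega_N[n])$. -/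

import Mathlib

open scoped DirectSum RightActions
open MulOpposite

noncomputable section

namespace DG

universe u v v' v'' w w' w''

/-! ### Internal `ℤ`-gradings of abelian groups -/

section Gradings

variable {M : Type*} [AddCommGroup M] {P : Type*} [AddCommGroup P] {G : ℤ → AddSubgroup M}

/-- The additive map `x ↦ ∑ i, f i (x_i)`, where `x = ∑ i, x_i` is the decomposition of `x` into
homogeneous components. -/
def glue (h : DirectSum.IsInternal G) (f : ℤ → M →+ P) : M →+ P :=
  (DirectSum.toAddMonoid fun i => (f i).comp (G i).subtype).comp
    (AddEquiv.ofBijective (DirectSum.coeAddMonoidHom G) h).symm.toAddMonoidHom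

theorem glue_of_mem (h : DirectSum.IsInternal G) (f : ℤ → M →+ P) {i : ℤ} {x : M}
    (hx : x ∈ G i) : glue h f x = f i x := by
  have : (AddEquiv.ofBijective (DirectSum.coeAddMonoidHom G) h).symm x
      = DirectSum.of (fun i => G i) i ⟨x, hx⟩ := by
    rw [AddEquiv.symm_apply_eq]
    exact (DirectSum.coeAddMonoidHom_of G i ⟨x, hx⟩).symm
  change DirectSum.toAddMonoid _ ((AddEquiv.ofBijective (DirectSum.coeAddMonoidHom G) h).symm x) = _
  rw [this, DirectSum.toAddMonoid_of]
  rfl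

@[elab_as_elim]
theorem hom_induction (h : DirectSum.IsInternal G) {p : M → Prop} (x : M) (h0 : p 0)
    (hadd : ∀ x y, p x → p y → p (x + y)) (hG : ∀ i, ∀ x ∈ G i, p x) : p x := by
  obtain ⟨y, rfl⟩ := h.2 x
  induction y using DirectSum.induction_on with
  | zero => simpa using h0
  | of i y => simpa using hG i y y.2
  | add a b ha hb => simpa using hadd _ _ ha hb

theorem isInternal_of_proj (p : ℤ → M →+ M) (h1 : ∀ i, ∀ x ∈ G i, p i x = x)
    (h2 : ∀ i j, i ≠ j → ∀ x ∈ G i, p j x = 0) (h3 : ∀ x, x ∈ ⨆ i, G i) :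
    DirectSum.IsInternal G := by
  constructor
  · rw [injective_iff_map_eq_zero]
    intro a ha
    have key : ∀ (j : ℤ) (a : ⨁ i, G i), p j (DirectSum.coeAddMonoidHom G a) = a j := by
      intro j a
      induction a using DirectSum.induction_on with
      | zero => simp
      | of i y =>
        by_cases hij : i = j
        · subst hij
          simp [h1 i y y.2]
        · rw [DirectSum.coeAddMonoidHom_of, h2 i j hij _ y.2, DirectSum.of_eq_of_ne _ _ _ (Ne.symm hij)]
          rfl
      | add a b ha hb => simp [ha, hb]
    ext j
    rw [← key j a]
    rw [show DirectSum.coeAddMonoidHom G a = 0 from ha]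
    simp
  · intro x
    refine AddSubgroup.iSup_induction G
      (C := fun x => ∃ a, DirectSum.coeAddMonoidHom G a = x) (h3 x) ?_ ?_ ?_
    · intro i x hx
      exact ⟨DirectSum.of (fun i => G i) i ⟨x, hx⟩, by simp⟩
    · exact ⟨0, map_zero _⟩
    · rintro x y ⟨a, rfl⟩ ⟨b, rfl⟩
      exact ⟨a + b, by simp⟩

end Gradings

/-! ### DG algebras and DG modules -/

/-- A (graded-commutative, non-negatively graded) DG `R`-algebra. -/
structure DGAlg (R : Type u) [CommRing R] where
  /-- the underlying `R`-algebra -/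
  carrier : Type v
  [ring : Ring carrier]
  [algebra : Algebra R carrier]
  /-- the homogeneous components -/
  gr : ℤ → Submodule R carrier
  isInternal : DirectSum.IsInternal gr
  gr_neg : ∀ i < 0, gr i = ⊥
  one_mem : 1 ∈ gr 0
  mul_mem : ∀ {i j : ℤ} {a b : carrier}, a ∈ gr i → b ∈ gr j → a * b ∈ gr (i + j)
  mul_comm : ∀ {i j : ℤ} {a b : carrier}, a ∈ gr i → b ∈ gr j →
    a * b = (i * j).negOnePow • (b * a)
  mul_self : ∀ {i : ℤ} {a : carrier}, Odd i → a ∈ gr i → a * a = 0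
  /-- the differential -/
  d : carrier →ₗ[R] carrier
  d_mem : ∀ {i : ℤ} {a : carrier}, a ∈ gr i → d a ∈ gr (i - 1)
  d_d : ∀ a, d (d a) = 0
  leibniz : ∀ {i : ℤ} {a : carrier} (b : carrier), a ∈ gr i →
    d (a * b) = d a * b + i.negOnePow • (a * d b)

variable {R : Type u} [CommRing R]

instance : CoeSort (DGAlg.{u, v} R) (Type v) := ⟨DGAlg.carrier⟩
instance (B : DGAlg.{u, v} R) : Ring B := B.ring
instance (B : DGAlg.{u, v} R) : Algebra R B := B.algebra

/-- A homomorphism of DG `R`-algebras. -/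
structure DGAlgHom (A : DGAlg.{u, v} R) (B : DGAlg.{u, v'} R) where
  /-- the underlying homomorphism of `R`-algebras -/
  toAlgHom : A →ₐ[R] B
  map_mem : ∀ {i : ℤ} {a : A}, a ∈ A.gr i → toAlgHom a ∈ B.gr i
  map_d : ∀ a, toAlgHom (A.d a) = B.d (toAlgHom a)

instance (A : DGAlg.{u, v} R) (B : DGAlg.{u, v'} R) : CoeFun (DGAlgHom A B) (fun _ => A → B) :=
  ⟨fun f => f.toAlgHom⟩

/-- A (right) DG module over a DG algebra `B`; the right action of `b` on `m` is written
`m <• b`. -/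
structure DGMod (B : DGAlg.{u, v} R) where
  /-- the underlying right module -/
  carrier : Type w
  [addCommGroup : AddCommGroup carrier]
  [module : Module Bᵐᵒᵖ carrier]
  /-- the homogeneous components -/
  gr : ℤ → AddSubgroup carrier
  isInternal : DirectSum.IsInternal gr
  smul_mem : ∀ {i j : ℤ} {m : carrier} {b : B}, m ∈ gr i → b ∈ B.gr j → m <• b ∈ gr (i + j)
  /-- the differential -/
  d : carrier →+ carrier
  d_mem : ∀ {i : ℤ} {m : carrier}, m ∈ gr i → d m ∈ gr (i - 1)
  d_d : ∀ m, d (d m) = 0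
  leibniz : ∀ {i : ℤ} {m : carrier} (b : B), m ∈ gr i →
    d (m <• b) = d m <• b + i.negOnePow • (m <• B.d b)

instance (B : DGAlg.{u, v} R) : CoeSort (DGMod.{u, v, w} B) (Type w) := ⟨DGMod.carrier⟩
instance {B : DGAlg.{u, v} R} (M : DGMod.{u, v, w} B) : AddCommGroup M := M.addCommGroup
instance {B : DGAlg.{u, v} R} (M : DGMod.{u, v, w} B) : Module Bᵐᵒᵖ M := M.module

/-- A DG `(A, B)`-bimodule: a right DG `B`-module with a compatible left DG `A`-module
structure. -/
structure DGBimod (A : DGAlg.{u, v} R) (B : DGAlg.{u, v'} R) extends DGMod.{u, v', w} B where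
  [leftModule : Module A carrier]
  smul_op_smul : ∀ (a : A) (m : carrier) (b : B), a • (m <• b) = (a • m) <• b
  lsmul_mem : ∀ {i j : ℤ} {a : A} {m : carrier}, a ∈ A.gr i → m ∈ gr j → a • m ∈ gr (i + j)
  lleibniz : ∀ {i : ℤ} {a : A} (m : carrier), a ∈ A.gr i →
    d (a • m) = A.d a • m + i.negOnePow • (a • d m)

instance {A : DGAlg.{u, v} R} {B : DGAlg.{u, v'} R} (M : DGBimod.{u, v, v', w} A B) :
    Module A M.toDGMod := M.leftModule
instance {A : DGAlg.{u, v} R} {B : DGAlg.{u, v'} R} (M : DGBimod.{u, v, v', w} A B) :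
    SMulCommClass A Bᵐᵒᵖ M.toDGMod :=
  ⟨fun a b m => M.smul_op_smul a m b.unop⟩

namespace DGAlg

variable (B : DGAlg.{u, v} R)

theorem isInternal' : DirectSum.IsInternal fun i => (B.gr i).toAddSubgroup := B.isInternal

theorem d_one : B.d 1 = 0 := by
  have h := B.leibniz (1 : B) B.one_mem
  simpa using h

/-- The sign automorphism of `B`, multiplication by `(-1) ^ i` in degree `i`. -/
def sgn : B →+* B where
  __ := glue B.isInternal' fun i => i.negOnePow • AddMonoidHom.id B
  map_one' := by
    change glue _ _ _ = _
    rw [glue_of_mem (i := 0) _ _ B.one_mem]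
    simp
  map_mul' x y := by
    change glue _ _ _ = glue _ _ _ * glue _ _ _
    refine hom_induction B.isInternal' x ?_ ?_ ?_
    · simp
    · intro x x' h h'
      simp only [map_add, add_mul, h, h']
    intro i x hx
    refine hom_induction B.isInternal' y ?_ ?_ ?_
    · simp
    · intro x x' h h'
      simp only [map_add, mul_add, h, h']
    intro j y hy
    rw [glue_of_mem (i := i + j) _ _ (B.mul_mem hx hy), glue_of_mem _ _ hx, glue_of_mem _ _ hy]
    simp [Int.negOnePow_add, mul_smul, smul_mul_assoc, mul_smul_comm]
    rw [smul_comm]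

theorem sgn_of_mem {i : ℤ} {b : B} (hb : b ∈ B.gr i) : B.sgn b = i.negOnePow • b :=
  glue_of_mem B.isInternal' (fun i => i.negOnePow • AddMonoidHom.id B) (i := i) hb

/-- `B` as a right DG module over itself. -/
def reg : DGMod.{u, v, v} B where
  carrier := B
  gr i := (B.gr i).toAddSubgroup
  isInternal := B.isInternal'
  smul_mem h h' := B.mul_mem h h'
  d := B.d.toAddMonoidHom
  d_mem h := B.d_mem h
  d_d := B.d_d
  leibniz b h := B.leibniz b h

/-- `B` as a DG bimodule over itself. -/
def regBimod : DGBimod.{u, v, v, v} B B where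
  toDGMod := B.reg
  leftModule := inferInstanceAs (Module B B)
  smul_op_smul a m b := (mul_assoc (a : B) m b).symm
  lsmul_mem h h' := B.mul_mem h h'
  lleibniz m h := B.leibniz m h

end DGAlg

namespace DGMod

variable {A : DGAlg.{u, v} R} {B : DGAlg.{u, v'} R}

/-- The sign automorphism of `M`, multiplication by `(-1) ^ i` in degree `i`. -/
def sgn (M : DGMod.{u, v, w} A) : M →+ M :=
  glue M.isInternal fun i => i.negOnePow • AddMonoidHom.id M

theorem sgn_of_mem (M : DGMod.{u, v, w} A) {i : ℤ} {m : M} (hm : m ∈ M.gr i) :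
    M.sgn m = i.negOnePow • m :=
  glue_of_mem M.isInternal (fun i => i.negOnePow • AddMonoidHom.id M) (i := i) hm

/-- The projection of `M` to its component of degree `i`. -/
def proj (M : DGMod.{u, v, w} A) (i : ℤ) : M →+ M :=
  glue M.isInternal fun j => if j = i then AddMonoidHom.id M else 0

theorem proj_same (M : DGMod.{u, v, w} A) {i : ℤ} {m : M} (hm : m ∈ M.gr i) :
    M.proj i m = m := by
  unfold proj
  rw [glue_of_mem _ _ hm, if_pos rfl, AddMonoidHom.id_apply]

theorem proj_ne (M : DGMod.{u, v, w} A) {i j : ℤ} (h : i ≠ j) {m : M} (hm : m ∈ M.gr i) :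
    M.proj j m = 0 := by
  unfold proj
  rw [glue_of_mem _ _ hm, if_neg h, AddMonoidHom.zero_apply]

theorem leibniz_sgn (M : DGMod.{u, v, w} A) (m : M) (a : A) :
    M.d (m <• a) = M.d m <• a + M.sgn m <• A.d a := by
  refine hom_induction M.isInternal m (by simp) ?_ ?_
  · intro x y hx hy
    simp only [smul_add, map_add, hx, hy]
    abel
  · intro i x hx
    rw [M.leibniz a hx, M.sgn_of_mem hx, smul_comm]

theorem sgn_smul (M : DGMod.{u, v, w} A) (m : M) (a : A) :
    M.sgn (m <• a) = M.sgn m <• A.sgn a := by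
  refine hom_induction M.isInternal m (by simp) ?_ ?_
  · intro x y hx hy
    simp only [smul_add, map_add, hx, hy]
  · intro i x hx
    refine hom_induction A.isInternal' a (by simp) ?_ ?_
    · intro a b ha hb
      simp only [op_add, add_smul, map_add, ha, hb]
    · intro j a ha
      rw [M.sgn_of_mem (M.smul_mem hx ha), M.sgn_of_mem hx, A.sgn_of_mem ha, Int.negOnePow_add,
        mul_smul]
      simp only [Units.smul_def, op_smul, smul_assoc]
      rw [smul_comm (op a), smul_comm]

theorem d_sgn (M : DGMod.{u, v, w} A) (m : M) : M.d (M.sgn m) = - M.sgn (M.d m) := by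
  refine hom_induction M.isInternal m (by simp) ?_ ?_
  · intro x y hx hy
    simp only [map_add, hx, hy]
    abel
  · intro i x hx
    rw [M.sgn_of_mem hx, M.sgn_of_mem (M.d_mem hx), Int.negOnePow_sub]
    simp [Units.smul_def]

theorem sgn_sgn (M : DGMod.{u, v, w} A) (m : M) : M.sgn (M.sgn m) = m := by
  refine hom_induction M.isInternal m (by simp) ?_ ?_
  · intro x y hx hy
    simp only [map_add, hx, hy]
  · intro i x hx
    rw [M.sgn_of_mem hx, M.sgn_of_mem]
    · rw [smul_smul, Int.units_mul_self, one_smul]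
    · rw [Units.smul_def]; exact zsmul_mem hx _

theorem proj_mem (M : DGMod.{u, v, w} A) (i : ℤ) (m : M) : M.proj i m ∈ M.gr i := by
  refine hom_induction M.isInternal m (by simp) ?_ ?_
  · intro x y hx hy
    simpa using add_mem hx hy
  · intro j x hx
    by_cases h : j = i
    · subst h; rwa [M.proj_same hx]
    · rw [M.proj_ne h hx]; exact zero_mem _

theorem exists_eq_sum_proj (M : DGMod.{u, v, w} A) (m : M) :
    ∃ s : Finset ℤ, m = ∑ i ∈ s, M.proj i m := by
  classical
  obtain ⟨y, rfl⟩ := M.isInternal.2 m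
  have key : ∀ (j : ℤ) (a : ⨁ i, M.gr i), M.proj j (DirectSum.coeAddMonoidHom M.gr a) = a j := by
    intro j a
    induction a using DirectSum.induction_on with
    | zero => simp
    | of i y =>
      by_cases hij : i = j
      · subst hij
        simp [M.proj_same y.2]
      · rw [DirectSum.coeAddMonoidHom_of, M.proj_ne hij y.2,
          DirectSum.of_eq_of_ne _ _ _ (Ne.symm hij)]
        rfl
    | add a b ha hb => simp [ha, hb]
  refine ⟨DFinsupp.support y, ?_⟩
  simp only [key]
  conv_lhs => rw [← DirectSum.sum_support_of y]
  simp

end DGMod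

/-! ### Homomorphisms, homotopies, shifts, homology -/

section Homs

variable {B : DGAlg.{u, v} R}

/-- The group `Hom_{C(B)}(M, N)` of homomorphisms of DG modules: `B`-linear maps that preserve
degrees and commute with the differentials. -/
def DGHom (M : DGMod.{u, v, w} B) (N : DGMod.{u, v, w'} B) : AddSubgroup (M →ₗ[Bᵐᵒᵖ] N) where
  carrier := {f | (∀ i, ∀ m ∈ M.gr i, f m ∈ N.gr i) ∧ ∀ m, f (M.d m) = N.d (f m)}
  zero_mem' := ⟨fun i m _ => zero_mem _, fun m => by simp⟩
  add_mem' := fun {f g} hf hg => ⟨fun i m hm => add_mem (hf.1 i m hm) (hg.1 i m hm),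
    fun m => by simp [hf.2 m, hg.2 m]⟩
  neg_mem' := fun {f} hf => ⟨fun i m hm => neg_mem (hf.1 i m hm), fun m => by simp [hf.2 m]⟩

/-- `h` is a homogeneous `B`-linear map `M → Σ⁻¹ N` of underlying graded modules with
`f = ∂ h + h ∂`. -/
structure IsNullHomotopy {M : DGMod.{u, v, w} B} {N : DGMod.{u, v, w'} B}
    (f h : M →ₗ[Bᵐᵒᵖ] N) : Prop where
  map_mem : ∀ i, ∀ m ∈ M.gr i, h m ∈ N.gr (i + 1)
  eq : ∀ m, f m = N.d (h m) + h (M.d m)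

theorem IsNullHomotopy.add {M : DGMod.{u, v, w} B} {N : DGMod.{u, v, w'} B}
    {f h f' h' : M →ₗ[Bᵐᵒᵖ] N} (H : IsNullHomotopy f h) (H' : IsNullHomotopy f' h') :
    IsNullHomotopy (f + f') (h + h') :=
  ⟨fun i m hm => add_mem (H.map_mem i m hm) (H'.map_mem i m hm), fun m => by
    simp only [LinearMap.add_apply, H.eq, H'.eq, map_add]; abel⟩

theorem IsNullHomotopy.neg {M : DGMod.{u, v, w} B} {N : DGMod.{u, v, w'} B}
    {f h : M →ₗ[Bᵐᵒᵖ] N} (H : IsNullHomotopy f h) : IsNullHomotopy (-f) (-h) :=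
  ⟨fun i m hm => neg_mem (H.map_mem i m hm), fun m => by
    simp only [LinearMap.neg_apply, H.eq, map_neg]; abel⟩

theorem IsNullHomotopy.zero {M : DGMod.{u, v, w} B} {N : DGMod.{u, v, w'} B} :
    IsNullHomotopy (0 : M →ₗ[Bᵐᵒᵖ] N) 0 :=
  ⟨fun i m _ => zero_mem _, fun m => by simp⟩

/-- The null-homotopic homomorphisms of DG modules. Thus `f ~ g` iff `f - g` lies in this
subgroup. -/
def nullHtp (M : DGMod.{u, v, w} B) (N : DGMod.{u, v, w'} B) : AddSubgroup (DGHom M N) where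
  carrier := {f | ∃ h : M →ₗ[Bᵐᵒᵖ] N, IsNullHomotopy f.1 h}
  zero_mem' := ⟨0, .zero⟩
  add_mem' := fun ⟨_, h⟩ ⟨_, h'⟩ => ⟨_, h.add h'⟩
  neg_mem' := fun ⟨_, h⟩ => ⟨_, h.neg⟩

/-- `Hom_{K(B)}(M, N)`: homotopy classes of homomorphisms of DG modules. -/
def HomK (M : DGMod.{u, v, w} B) (N : DGMod.{u, v, w'} B) : Type _ :=
  DGHom M N ⧸ nullHtp M N

instance (M : DGMod.{u, v, w} B) (N : DGMod.{u, v, w'} B) : AddCommGroup (HomK M N) :=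
  inferInstanceAs (AddCommGroup (DGHom M N ⧸ nullHtp M N))

namespace DGHom

variable {M : DGMod.{u, v, w} B} {N : DGMod.{u, v, w'} B} {P : DGMod.{u, v, w''} B}

/-- Composition of homomorphisms of DG modules. -/
def comp (g : DGHom N P) (f : DGHom M N) : DGHom M P :=
  ⟨g.1.comp f.1, fun i m hm => g.2.1 i _ (f.2.1 i m hm), fun m => by simp [f.2.2, g.2.2]⟩

/-- The identity homomorphism. -/
def id (M : DGMod.{u, v, w} B) : DGHom M M :=
  ⟨LinearMap.id, fun _ _ hm => hm, fun _ => rfl⟩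

end DGHom

namespace DGMod

theorem units_smul_mem {G : Type*} [AddCommGroup G] (H : AddSubgroup G) (e : ℤˣ) {x : G}
    (hx : x ∈ H) : e • x ∈ H := by
  rw [Units.smul_def]; exact zsmul_mem hx _

/-- The shift `Σⁿ M`, with `(Σⁿ M)_j = M_{j - n}` and differential `(-1)ⁿ ∂`. -/
def shift (n : ℤ) (M : DGMod.{u, v, w} B) : DGMod.{u, v, w} B where
  carrier := M
  gr j := M.gr (j - n)
  isInternal := by
    refine isInternal_of_proj (fun j => M.proj (j - n)) (fun i x hx => M.proj_same hx)
      (fun i j hij x hx => M.proj_ne (by omega) hx) fun x => ?_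
    obtain ⟨s, hs⟩ := M.exists_eq_sum_proj x
    refine hs ▸ sum_mem fun i _ => AddSubgroup.mem_iSup_of_mem (i + n) ?_
    rw [add_sub_cancel_right]
    exact M.proj_mem i x
  smul_mem {i j m b} h h' := by
    have := M.smul_mem h h'
    rwa [show i - n + j = i + j - n by ring] at this
  d := n.negOnePow • M.d
  d_mem {i m} h := by
    have := M.d_mem h
    rw [show i - n - 1 = i - 1 - n by ring] at this
    exact units_smul_mem _ _ this
  d_d m := by
    simp [Units.smul_def, M.d_d]
  leibniz {i m} b h := by
    have := M.leibniz b h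
    change n.negOnePow • M.d (m <• b) = (n.negOnePow • M.d m) <• b + _
    rw [this, smul_add, smul_smul, ← Int.negOnePow_add, add_sub_cancel]
    simp only [Units.smul_def, smul_comm (op b)]

/-- The zero DG module. -/
def zero : DGMod.{u, v, w} B where
  carrier := PUnit
  gr _ := ⊤
  isInternal := isInternal_of_proj (fun _ => 0) (fun _ _ _ => rfl) (fun _ _ _ _ _ => rfl)
    fun _ => zero_mem _
  smul_mem _ _ := trivial
  d := 0
  d_mem _ := trivial
  d_d _ := rfl
  leibniz _ _ := rfl

/-- The cycles of degree `n`. -/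
def cycles (M : DGMod.{u, v, w} B) (n : ℤ) : AddSubgroup M := M.gr n ⊓ M.d.ker

/-- The boundaries of degree `n`, as a subgroup of the cycles. -/
def boundaries (M : DGMod.{u, v, w} B) (n : ℤ) : AddSubgroup (M.cycles n) :=
  ((M.gr (n + 1)).map M.d).addSubgroupOf (M.cycles n)

/-- The homology group `H_n(M)`. -/
abbrev homology (M : DGMod.{u, v, w} B) (n : ℤ) : Type w := M.cycles n ⧸ M.boundaries n

end DGMod

namespace DGHom

variable {M : DGMod.{u, v, w} B} {N : DGMod.{u, v, w'} B}

/-- The action of a homomorphism of DG modules on cycles. -/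
def cyclesMap (f : DGHom M N) (n : ℤ) : M.cycles n →+ N.cycles n :=
  (f.1.toAddMonoidHom.comp (M.cycles n).subtype).codRestrict (N.cycles n) fun m =>
    ⟨f.2.1 n _ m.2.1, by
      have h : M.d m.1 = 0 := m.2.2
      change N.d (f.1 m.1) = 0
      rw [← f.2.2, h, map_zero]⟩

/-- The action of a homomorphism of DG modules on homology. -/
def homologyMap (f : DGHom M N) (n : ℤ) : M.homology n →+ N.homology n :=
  QuotientAddGroup.map _ _ (cyclesMap f n) (by
    rintro ⟨m, hm⟩ ⟨x, hx, hxm⟩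
    exact ⟨f.1 x, f.2.1 _ x hx, by
      change N.d (f.1 x) = f.1 m
      rw [← f.2.2, hxm]; rfl⟩)

/-- Quasiisomorphisms: homomorphisms inducing bijections on all homology modules. -/
def IsQuasiIso (f : DGHom M N) : Prop := ∀ n, Function.Bijective (homologyMap f n)

end DGHom

/-- A semifree basis of `P`: a well-ordered homogeneous basis `e` of the underlying graded module
with `∂ e_i ∈ ∑_{j < i} e_j B`. -/
structure SemifreeBasis (P : DGMod.{u, v, w} B) where
  /-- the index set -/
  ι : Type w
  [linearOrder : LinearOrder ι]
  [wellFounded : WellFoundedLT ι]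
  /-- the basis of the underlying right module -/
  basis : Module.Basis ι Bᵐᵒᵖ P
  /-- the degrees of the basis elements -/
  deg : ι → ℤ
  mem_gr : ∀ i, basis i ∈ P.gr (deg i)
  d_mem : ∀ i, P.d (basis i) ∈ Submodule.span Bᵐᵒᵖ (basis '' Set.Iio i)

/-- A DG module is semifree if it has a semifree basis. -/
def IsSemifree (P : DGMod.{u, v, w} B) : Prop := Nonempty (SemifreeBasis P)

/-- A DG module is perfect if it is quasiisomorphic to a semifree DG module `F` with a finite
semifree basis. (As `F` is semifree, one may take a quasiisomorphism `F → M`; being finitely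
generated, `F` may be taken in the universe of the DG algebra.) -/
def IsPerfect (M : DGMod.{u, v, w} B) : Prop :=
  ∃ (F : DGMod.{u, v, v} B) (E : SemifreeBasis F) (f : DGHom F M), Finite E.ι ∧ DGHom.IsQuasiIso f

end Homs

/-! ### Restriction of scalars -/

section Res

variable {A : DGAlg.{u, v} R} {B : DGAlg.{u, v'} R} {C : DGAlg.{u, v''} R}

/-- Restriction of scalars of a right DG module. -/
def DGMod.res (φ : DGAlgHom A B) (M : DGMod.{u, v', w} B) : DGMod.{u, v, w} A where
  carrier := M
  module := Module.compHom M φ.toAlgHom.toRingHom.op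
  gr := M.gr
  isInternal := M.isInternal
  smul_mem h h' := M.smul_mem h (φ.map_mem h')
  d := M.d
  d_mem := M.d_mem
  d_d := M.d_d
  leibniz {i m} b h := by
    have := M.leibniz (φ b) h
    rw [← φ.map_d] at this
    exact this

/-- Restriction of scalars on the right of a DG bimodule. -/
def DGBimod.resR (φ : DGAlgHom A B) (M : DGBimod.{u, v'', v', w} C B) :
    DGBimod.{u, v'', v, w} C A where
  toDGMod := M.toDGMod.res φ
  leftModule := M.leftModule
  smul_op_smul c (m : M.toDGMod) a := smul_comm c (op (φ a)) m
  lsmul_mem := M.lsmul_mem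
  lleibniz := M.lleibniz

/-- Restriction of scalars on the left of a DG bimodule. -/
def DGBimod.resL (φ : DGAlgHom A B) (M : DGBimod.{u, v', v'', w} B C) :
    DGBimod.{u, v, v'', w} A C where
  toDGMod := M.toDGMod
  leftModule := Module.compHom M.toDGMod φ.toAlgHom.toRingHom
  smul_op_smul a (m : M.toDGMod) c := smul_comm (φ a) (op c) m
  lsmul_mem h h' := M.lsmul_mem (φ.map_mem h) h'
  lleibniz {i a} (m : M.toDGMod) h := by
    have := M.lleibniz m (φ.map_mem h)
    rw [← φ.map_d] at this
    exact this

/-- The shift `Σ M` of a DG bimodule. The right action is that of `M`, the left action is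
`b · Σm = (-1)^{|b|} Σ(b m)`. -/
def DGBimod.susp (M : DGBimod.{u, v, v', w} A B) : DGBimod.{u, v, v', w} A B where
  toDGMod := M.toDGMod.shift 1
  leftModule := Module.compHom M.toDGMod A.sgn
  smul_op_smul a (m : M.toDGMod) c := smul_comm (A.sgn a) (op c) m
  lsmul_mem {i j a} {m : M.toDGMod} h h' := by
    have := M.lsmul_mem h h'
    change A.sgn a • m ∈ M.gr _
    rw [A.sgn_of_mem h, show i + j - 1 = i + (j - 1) by ring, Units.smul_def, smul_assoc]
    exact zsmul_mem this _
  lleibniz {i a} (m : M.toDGMod) h := by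
    have := M.lleibniz m h
    change (1 : ℤ).negOnePow • M.d (A.sgn a • m) = A.sgn (A.d a) • m +
      i.negOnePow • (A.sgn a • ((1 : ℤ).negOnePow • M.d m))
    rw [A.sgn_of_mem h, A.sgn_of_mem (A.d_mem h), Int.negOnePow_sub]
    simp only [Units.smul_def, smul_assoc, map_zsmul, this]
    simp [smul_comm (i.negOnePow : ℤ) a]

end Res


/-! ### Balanced tensor products over a noncommutative ring -/

section BalTensor

open TensorProduct

/-- The subgroup of `M ⊗_ℤ X` spanned by the elements `m a ⊗ x - m ⊗ a x`. -/
def balRel (A : Type*) [Ring A] (M : Type*) [AddCommGroup M] [Module Aᵐᵒᵖ M]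
    (X : Type*) [AddCommGroup X] [Module A X] : AddSubgroup (M ⊗[ℤ] X) :=
  AddSubgroup.closure {t | ∃ (m : M) (a : A) (x : X), t = (m <• a) ⊗ₜ x - m ⊗ₜ (a • x)}

/-- The tensor product `M ⊗_A X` of a right module and a left module over a (not necessarily
commutative) ring `A`. -/
def BalTensor (A : Type*) [Ring A] (M : Type*) [AddCommGroup M] [Module Aᵐᵒᵖ M]
    (X : Type*) [AddCommGroup X] [Module A X] : Type _ :=
  (M ⊗[ℤ] X) ⧸ balRel A M X

namespace BalTensor

variable {A : Type*} [Ring A] {M : Type*} [AddCommGroup M] [Module Aᵐᵒᵖ M]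
  {X : Type*} [AddCommGroup X] [Module A X] {P : Type*} [AddCommGroup P]

instance : AddCommGroup (BalTensor A M X) :=
  inferInstanceAs (AddCommGroup ((M ⊗[ℤ] X) ⧸ balRel A M X))

variable (A) in
/-- The pure tensor `m ⊗ x`. -/
def tmul (m : M) (x : X) : BalTensor A M X := QuotientAddGroup.mk (m ⊗ₜ x)

theorem add_tmul (m m' : M) (x : X) : tmul A (m + m') x = tmul A m x + tmul A m' x := by
  unfold tmul; rw [TensorProduct.add_tmul]; rfl

theorem tmul_add (m : M) (x x' : X) : tmul A m (x + x') = tmul A m x + tmul A m x' := by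
  unfold tmul; rw [TensorProduct.tmul_add]; rfl

theorem smul_tmul (m : M) (a : A) (x : X) : tmul A (m <• a) x = tmul A m (a • x) := by
  refine (QuotientAddGroup.eq_iff_sub_mem).2 (AddSubgroup.subset_closure ⟨m, a, x, rfl⟩)

variable (A M X) in
/-- `tmul` as a biadditive map. -/
def mk : M →+ X →+ BalTensor A M X :=
  AddMonoidHom.mk' (fun m => AddMonoidHom.mk' (tmul A m) (tmul_add m))
    fun m m' => by ext x; exact add_tmul m m' x

@[simp] theorem mk_apply (m : M) (x : X) : mk A M X m x = tmul A m x := rfl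

@[simp] theorem zero_tmul (x : X) : tmul A (0 : M) x = 0 := by
  rw [← mk_apply, map_zero, AddMonoidHom.zero_apply]

@[simp] theorem tmul_zero (m : M) : tmul A m (0 : X) = 0 := by
  rw [← mk_apply, map_zero]

theorem neg_tmul (m : M) (x : X) : tmul A (-m) x = -tmul A m x := by
  rw [← mk_apply, map_neg]; rfl

theorem tmul_neg (m : M) (x : X) : tmul A m (-x) = -tmul A m x := by
  rw [← mk_apply, map_neg]; rfl

theorem zsmul_tmul (n : ℤ) (m : M) (x : X) : tmul A (n • m) x = n • tmul A m x := by
  rw [← mk_apply, map_zsmul]; rfl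

theorem tmul_zsmul (n : ℤ) (m : M) (x : X) : tmul A m (n • x) = n • tmul A m x := by
  rw [← mk_apply, map_zsmul]; rfl

theorem units_smul_tmul (n : ℤˣ) (m : M) (x : X) : tmul A (n • m) x = n • tmul A m x :=
  zsmul_tmul _ m x

theorem tmul_units_smul (n : ℤˣ) (m : M) (x : X) : tmul A m (n • x) = n • tmul A m x :=
  tmul_zsmul _ m x

@[elab_as_elim]
theorem induction {p : BalTensor A M X → Prop} (t : BalTensor A M X) (h0 : p 0)
    (htmul : ∀ m x, p (tmul A m x)) (hadd : ∀ s t, p s → p t → p (s + t)) : p t := by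
  obtain ⟨t, rfl⟩ := QuotientAddGroup.mk_surjective t
  induction t using TensorProduct.induction_on with
  | zero => exact h0
  | tmul m x => exact htmul m x
  | add s t hs ht => exact hadd _ _ hs ht

/-- The universal property: a balanced biadditive map induces a map out of the tensor product. -/
def lift (f : M →+ X →+ P) (hf : ∀ m (a : A) x, f (m <• a) x = f m (a • x)) :
    BalTensor A M X →+ P :=
  QuotientAddGroup.lift (balRel A M X)
    (TensorProduct.liftAddHom f fun n m x => by
      rw [map_zsmul, map_zsmul]; rfl) (by
    unfold balRel
    rw [AddSubgroup.closure_le]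
    rintro _ ⟨m, a, x, rfl⟩
    simp [AddMonoidHom.mem_ker, hf])

@[simp] theorem lift_tmul (f : M →+ X →+ P) (hf : ∀ m (a : A) x, f (m <• a) x = f m (a • x))
    (m : M) (x : X) : lift f hf (tmul A m x) = f m x := rfl

variable {B : Type*} [Ring B] [Module Bᵐᵒᵖ X] [SMulCommClass A Bᵐᵒᵖ X]
  {C : Type*} [Ring C] [Module C M] [SMulCommClass C Aᵐᵒᵖ M]

/-- The right action on the second factor. -/
def rsmul (b : Bᵐᵒᵖ) : BalTensor A M X →+ BalTensor A M X :=
  lift ((AddMonoidHom.compHom.flip (DistribSMul.toAddMonoidHom X b)).comp (mk A M X))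
    fun m a x => by
      change tmul A (m <• a) (b • x) = tmul A m (b • a • x)
      rw [smul_tmul, smul_comm]

/-- The left action on the first factor. -/
def lsmul (c : C) : BalTensor A M X →+ BalTensor A M X :=
  lift ((mk A M X).comp (DistribSMul.toAddMonoidHom M c)) fun m a x => by
    change tmul A (c • (m <• a)) x = tmul A (c • m) (a • x)
    rw [smul_comm, smul_tmul]

instance : Module Bᵐᵒᵖ (BalTensor A M X) where
  smul b := rsmul b
  one_smul t := by
    change rsmul 1 t = t
    induction t using induction with
    | h0 => simp
    | htmul m x => change tmul A m ((1 : Bᵐᵒᵖ) • x) = _; rw [one_smul]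
    | hadd s t hs ht => rw [map_add, hs, ht]
  mul_smul b c t := by
    change rsmul (b * c) t = rsmul b (rsmul c t)
    induction t using induction with
    | h0 => simp
    | htmul m x => change tmul A m ((b * c) • x) = tmul A m (b • c • x); rw [mul_smul]
    | hadd s t hs ht => simp only [map_add, hs, ht]
  smul_zero b := map_zero (rsmul b)
  smul_add b := map_add (rsmul b)
  add_smul b c t := by
    change rsmul (b + c) t = rsmul b t + rsmul c t
    induction t using induction with
    | h0 => simp
    | htmul m x =>
      change tmul A m ((b + c) • x) = tmul A m (b • x) + tmul A m (c • x)
      rw [add_smul, tmul_add]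
    | hadd s t hs ht => simp only [map_add, hs, ht]; abel
  zero_smul t := by
    change rsmul 0 t = 0
    induction t using induction with
    | h0 => simp
    | htmul m x => change tmul A m ((0 : Bᵐᵒᵖ) • x) = 0; rw [zero_smul, tmul_zero]
    | hadd s t hs ht => rw [map_add, hs, ht, add_zero]

theorem tmul_op_smul (m : M) (x : X) (b : Bᵐᵒᵖ) : b • tmul A m x = tmul A m (b • x) := rfl

/-- The left module structure on the tensor product. -/
instance leftModule : Module C (BalTensor A M X) where
  smul b := lsmul b
  one_smul t := by
    change lsmul (1 : C) t = t
    induction t using induction with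
    | h0 => simp
    | htmul m x => change tmul A ((1 : C) • m) x = _; rw [one_smul]
    | hadd s t hs ht => rw [map_add, hs, ht]
  mul_smul b c t := by
    change lsmul (b * c) t = lsmul b (lsmul c t)
    induction t using induction with
    | h0 => simp
    | htmul m x => change tmul A ((b * c) • m) x = tmul A (b • c • m) x; rw [mul_smul]
    | hadd s t hs ht => simp only [map_add, hs, ht]
  smul_zero b := map_zero (lsmul b)
  smul_add b := map_add (lsmul b)
  add_smul b c t := by
    change lsmul (b + c) t = lsmul b t + lsmul c t
    induction t using induction with
    | h0 => simp
    | htmul m x =>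
      change tmul A ((b + c) • m) x = tmul A (b • m) x + tmul A (c • m) x
      rw [add_smul, add_tmul]
    | hadd s t hs ht => simp only [map_add, hs, ht]; abel
  zero_smul t := by
    change lsmul (0 : C) t = 0
    induction t using induction with
    | h0 => simp
    | htmul m x => change tmul A ((0 : C) • m) x = 0; rw [zero_smul, zero_tmul]
    | hadd s t hs ht => rw [map_add, hs, ht, add_zero]

theorem smul_tmul' (c : C) (m : M) (x : X) : c • tmul A m x = tmul A (c • m) x := rfl

end BalTensor

end BalTensor

/-! ### Tensor products of DG modules -/

section Tensor

variable {A : DGAlg.{u, v} R} {B : DGAlg.{u, v'} R} {C : DGAlg.{u, v''} R}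

open BalTensor

/-- The degree `k` component of `M ⊗_A X`, spanned by the `m ⊗ x` with `|m| + |x| = k`. -/
def tensorGr (M : DGMod.{u, v, w} A) (X : DGBimod.{u, v, v', w'} A B) (k : ℤ) :
    AddSubgroup (BalTensor A M X.toDGMod) :=
  AddSubgroup.closure {t | ∃ i j, i + j = k ∧ ∃ m ∈ M.gr i, ∃ x ∈ X.gr j, t = tmul A m x}

theorem tmul_mem_tensorGr {M : DGMod.{u, v, w} A} {X : DGBimod.{u, v, v', w'} A B} {i j k : ℤ}
    (h : i + j = k) {m : M} (hm : m ∈ M.gr i) {x : X.toDGMod} (hx : x ∈ X.gr j) :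
    tmul A m x ∈ tensorGr M X k :=
  AddSubgroup.subset_closure ⟨i, j, h, m, hm, x, hx, rfl⟩

/-- The differential `m ⊗ x ↦ ∂ m ⊗ x + (-1)^{|m|} m ⊗ ∂ x` of `M ⊗_A X`. -/
def tensorD (M : DGMod.{u, v, w} A) (X : DGBimod.{u, v, v', w'} A B) :
    BalTensor A M X.toDGMod →+ BalTensor A M X.toDGMod :=
  lift ((mk A M X.toDGMod).comp M.d +
      ((AddMonoidHom.compHom.flip X.d).comp (mk A M X.toDGMod)).comp M.sgn) fun m a x => by
    change tmul A (M.d (m <• a)) x + tmul A (M.sgn (m <• a)) (X.d x) =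
      tmul A (M.d m) (a • x) + tmul A (M.sgn m) (X.d (a • x))
    have hX : X.d (a • x) = A.d a • x + A.sgn a • X.d x := by
      refine hom_induction A.isInternal' a (by simp) ?_ ?_
      · intro a b ha hb
        simp only [add_smul, map_add, ha, hb]
        abel
      · intro i a ha
        rw [X.lleibniz x ha, A.sgn_of_mem ha]
        simp only [Units.smul_def, smul_assoc]
    rw [M.leibniz_sgn, M.sgn_smul, hX, add_tmul, tmul_add, smul_tmul, smul_tmul, smul_tmul]
    abel

theorem tensorD_tmul (M : DGMod.{u, v, w} A) (X : DGBimod.{u, v, v', w'} A B) (m : M)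
    (x : X.toDGMod) :
    tensorD M X (tmul A m x) = tmul A (M.d m) x + tmul A (M.sgn m) (X.d x) := rfl

/-- The projection of `M ⊗_A X` to its component of degree `k`. -/
def tensorProj (M : DGMod.{u, v, w} A) (X : DGBimod.{u, v, v', w'} A B) (k : ℤ) :
    BalTensor A M X.toDGMod →+ BalTensor A M X.toDGMod :=
  lift (glue M.isInternal fun i =>
      (AddMonoidHom.compHom.flip (X.toDGMod.proj (k - i))).comp (mk A M X.toDGMod)) fun m a x => by
    refine hom_induction M.isInternal m (by simp) ?_ ?_
    · intro m m' h h'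
      simp only [smul_add, map_add, AddMonoidHom.add_apply, h, h']
    intro i m hm
    refine hom_induction A.isInternal' a (by simp) ?_ ?_
    · intro a a' h h'
      simp only [op_add, add_smul, map_add, AddMonoidHom.add_apply, h, h']
    intro j a ha
    rw [glue_of_mem _ _ hm, glue_of_mem _ _ (M.smul_mem hm ha)]
    change tmul A (m <• a) (X.toDGMod.proj (k - (i + j)) x) =
      tmul A m (X.toDGMod.proj (k - i) (a • x))
    rw [smul_tmul]
    congr 1
    refine hom_induction X.isInternal x (by simp) ?_ ?_
    · intro x x' h h'
      simp only [map_add, smul_add, h, h']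
    intro l x hx
    have hax := X.lsmul_mem ha hx
    by_cases h : l = k - (i + j)
    · rw [X.toDGMod.proj_same (h ▸ hx), X.toDGMod.proj_same]
      rwa [h, show j + (k - (i + j)) = k - i by ring] at hax
    · rw [X.toDGMod.proj_ne h hx, X.toDGMod.proj_ne (by omega) hax, smul_zero]

theorem tensorProj_tmul (M : DGMod.{u, v, w} A) (X : DGBimod.{u, v, v', w'} A B) (k : ℤ) {i : ℤ}
    {m : M} (hm : m ∈ M.gr i) (x : X.toDGMod) :
    tensorProj M X k (tmul A m x) = tmul A m (X.toDGMod.proj (k - i) x) := by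
  exact DFunLike.congr_fun (glue_of_mem M.isInternal (fun i =>
      (AddMonoidHom.compHom.flip (X.toDGMod.proj (k - i))).comp (mk A M X.toDGMod)) hm) x

theorem tensor_isInternal (M : DGMod.{u, v, w} A) (X : DGBimod.{u, v, v', w'} A B) :
    DirectSum.IsInternal (tensorGr M X) := by
  refine isInternal_of_proj (tensorProj M X) ?_ ?_ ?_
  · intro k t ht
    induction ht using AddSubgroup.closure_induction with
    | mem t ht =>
      obtain ⟨i, j, hij, m, hm, x, hx, rfl⟩ := ht
      rw [tensorProj_tmul M X k hm, X.toDGMod.proj_same]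
      rwa [← hij, add_sub_cancel_left]
    | zero => simp
    | add s t _ _ hs ht => rw [map_add, hs, ht]
    | neg t _ ht => rw [map_neg, ht]
  · intro k l hkl t ht
    induction ht using AddSubgroup.closure_induction with
    | mem t ht =>
      obtain ⟨i, j, hij, m, hm, x, hx, rfl⟩ := ht
      rw [tensorProj_tmul M X l hm, X.toDGMod.proj_ne (by omega) hx, tmul_zero]
    | zero => simp
    | add s t _ _ hs ht => rw [map_add, hs, ht, add_zero]
    | neg t _ ht => rw [map_neg, ht, neg_zero]
  · intro t
    induction t using BalTensor.induction with
    | h0 => exact zero_mem _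
    | htmul m x =>
      refine hom_induction M.isInternal m ?_ ?_ ?_
      · rw [zero_tmul]; exact zero_mem _
      · intro m m' h h'
        rw [add_tmul]; exact add_mem h h'
      intro i m hm
      refine hom_induction X.isInternal x ?_ ?_ ?_
      · rw [tmul_zero]; exact zero_mem _
      · intro x x' h h'
        rw [tmul_add]; exact add_mem h h'
      intro j x hx
      exact AddSubgroup.mem_iSup_of_mem (i + j) (tmul_mem_tensorGr rfl hm hx)
    | hadd s t hs ht => exact add_mem hs ht

/-- The tensor product `M ⊗_A X` of a right DG `A`-module and a DG `(A, B)`-bimodule. -/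
def DGMod.tensor (M : DGMod.{u, v, w} A) (X : DGBimod.{u, v, v', w'} A B) :
    DGMod.{u, v', max w w'} B where
  carrier := BalTensor A M X.toDGMod
  gr := tensorGr M X
  isInternal := tensor_isInternal M X
  smul_mem {k l t b} ht hb := by
    induction ht using AddSubgroup.closure_induction with
    | mem t ht =>
      obtain ⟨i, j, hij, m, hm, x, hx, rfl⟩ := ht
      rw [tmul_op_smul]
      exact tmul_mem_tensorGr (by omega) hm (X.smul_mem hx hb)
    | zero => rw [smul_zero]; exact zero_mem _
    | add s t _ _ hs ht => rw [smul_add]; exact add_mem hs ht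
    | neg t _ ht => rw [smul_neg]; exact neg_mem ht
  d := tensorD M X
  d_mem {k t} ht := by
    induction ht using AddSubgroup.closure_induction with
    | mem t ht =>
      obtain ⟨i, j, hij, m, hm, x, hx, rfl⟩ := ht
      rw [tensorD_tmul, M.sgn_of_mem hm, units_smul_tmul]
      exact add_mem (tmul_mem_tensorGr (by omega) (M.d_mem hm) hx)
        (DGMod.units_smul_mem _ _ (tmul_mem_tensorGr (by omega) hm (X.d_mem hx)))
    | zero => rw [map_zero]; exact zero_mem _
    | add s t _ _ hs ht => rw [map_add]; exact add_mem hs ht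
    | neg t _ ht => rw [map_neg]; exact neg_mem ht
  d_d t := by
    induction t using BalTensor.induction with
    | h0 => simp
    | htmul m x =>
      rw [tensorD_tmul, map_add, tensorD_tmul, tensorD_tmul, M.d_d, X.d_d, M.d_sgn, neg_tmul]
      simp
    | hadd s t hs ht => simp only [map_add, hs, ht, add_zero]
  leibniz {k t} b ht := by
    induction ht using AddSubgroup.closure_induction with
    | mem t ht =>
      obtain ⟨i, j, hij, m, hm, x, hx, rfl⟩ := ht
      rw [tmul_op_smul, tensorD_tmul, tensorD_tmul, X.leibniz b hx, smul_add, tmul_op_smul,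
        tmul_op_smul, tmul_op_smul, M.sgn_of_mem hm, tmul_add, tmul_units_smul, units_smul_tmul,
        units_smul_tmul, ← hij, Int.negOnePow_add, smul_smul, add_assoc, mul_comm]
    | zero => simp
    | add s t _ _ hs ht => simp only [smul_add, map_add, hs, ht]; abel
    | neg t _ ht => simp only [smul_neg, map_neg, ht]; abel

/-- The tensor product `W ⊗_A X` of a DG `(C, A)`-bimodule and a DG `(A, B)`-bimodule. -/
def DGBimod.tensor (W : DGBimod.{u, v'', v, w} C A) (X : DGBimod.{u, v, v', w'} A B) :
    DGBimod.{u, v'', v', max w w'} C B where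
  toDGMod := W.toDGMod.tensor X
  leftModule := inferInstanceAs (Module C (BalTensor A W.toDGMod X.toDGMod))
  smul_op_smul c (t : BalTensor A W.toDGMod X.toDGMod) b := by
    change c • op b • t = op b • c • t
    induction t using BalTensor.induction with
    | h0 => simp
    | htmul m x => rfl
    | hadd s t hs ht => simp only [smul_add, hs, ht]
  lsmul_mem {k l c} {t : BalTensor A W.toDGMod X.toDGMod} hc ht := by
    induction ht using AddSubgroup.closure_induction with
    | mem t ht =>
      obtain ⟨i, j, hij, m, hm, x, hx, rfl⟩ := ht
      exact tmul_mem_tensorGr (by omega) (W.lsmul_mem hc hm) hx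
    | zero =>
      change c • (0 : BalTensor A W.toDGMod X.toDGMod) ∈ _
      rw [smul_zero]; exact zero_mem _
    | add s t _ _ hs ht =>
      change c • (s + t) ∈ _
      rw [smul_add]; exact add_mem hs ht
    | neg t _ ht =>
      change c • (-t) ∈ _
      rw [smul_neg]; exact neg_mem ht
  lleibniz {i c} (t : BalTensor A W.toDGMod X.toDGMod) hc := by
    change tensorD W.toDGMod X (c • t) =
      C.d c • t + i.negOnePow • (c • tensorD W.toDGMod X t)
    induction t using BalTensor.induction with
    | h0 => simp
    | htmul m x =>
      have hsgn : W.sgn (c • m) = i.negOnePow • (c • W.sgn m) := by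
        refine hom_induction W.isInternal m (by simp) ?_ ?_
        · intro m m' h h'
          simp only [smul_add, map_add, h, h']
        · intro j m hm
          rw [W.toDGMod.sgn_of_mem hm, W.toDGMod.sgn_of_mem (W.lsmul_mem hc hm),
            Int.negOnePow_add, mul_smul]
          simp only [Units.smul_def, smul_comm c]
      rw [smul_tmul', tensorD_tmul, tensorD_tmul, W.lleibniz m hc, hsgn, smul_add, smul_tmul',
        smul_tmul', smul_tmul', add_tmul, units_smul_tmul, units_smul_tmul, smul_add, add_assoc]
    | hadd s t hs ht => simp only [smul_add, map_add, hs, ht]; abel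

/-! Pure tensors in `M ⊗_A X`, for DG modules. -/

section Pure

variable {M : DGMod.{u, v, w} A} (X : DGBimod.{u, v, v', w'} A B)

/-- The pure tensor `m ⊗ x` in the DG module `M ⊗_A X`. -/
def DGMod.tmul (m : M) (x : X.toDGMod) : M.tensor X := BalTensor.tmul A m x

/-- The universal property of `M ⊗_A X`. -/
def DGMod.lift {X : DGBimod.{u, v, v', w'} A B} {P : Type*} [AddCommGroup P]
    (f : M →+ X.toDGMod →+ P) (hf : ∀ m (a : A) x, f (m <• a) x = f m (a • x)) :
    M.tensor X →+ P :=
  BalTensor.lift f hf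

namespace DGMod

theorem lift_tmul {P : Type*} [AddCommGroup P]
    (f : M →+ X.toDGMod →+ P) (hf : ∀ m (a : A) x, f (m <• a) x = f m (a • x)) (m : M)
    (x : X.toDGMod) : lift f hf (tmul X m x) = f m x := rfl

@[elab_as_elim]
theorem tensor_induction {X : DGBimod.{u, v, v', w'} A B} {p : M.tensor X → Prop}
    (t : M.tensor X) (h0 : p 0)
    (htmul : ∀ m x, p (tmul X m x)) (hadd : ∀ s t, p s → p t → p (s + t)) : p t :=
  BalTensor.induction t h0 htmul hadd

theorem add_tmul (m m' : M) (x : X.toDGMod) : tmul X (m + m') x = tmul X m x + tmul X m' x :=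
  BalTensor.add_tmul m m' x

theorem tmul_add (m : M) (x x' : X.toDGMod) : tmul X m (x + x') = tmul X m x + tmul X m x' :=
  BalTensor.tmul_add m x x'

theorem smul_tmul (m : M) (a : A) (x : X.toDGMod) : tmul X (m <• a) x = tmul X m (a • x) :=
  BalTensor.smul_tmul m a x

variable (M) in
/-- Pure tensors, as a biadditive map. -/
def tmulHom : M →+ X.toDGMod →+ M.tensor X :=
  AddMonoidHom.mk' (fun m => AddMonoidHom.mk' (tmul X m) (tmul_add X m))
    fun m m' => by ext x; exact add_tmul X m m' x

theorem tmulHom_apply (m : M) (x : X.toDGMod) : tmulHom M X m x = tmul X m x := rfl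

theorem zero_tmul (x : X.toDGMod) : tmul X (0 : M) x = 0 := BalTensor.zero_tmul x

theorem tmul_zero (m : M) : tmul X m (0 : X.toDGMod) = 0 := BalTensor.tmul_zero m

theorem units_smul_tmul (e : ℤˣ) (m : M) (x : X.toDGMod) :
    tmul X (e • m) x = e • tmul X m x := BalTensor.units_smul_tmul e m x

theorem tmul_units_smul (e : ℤˣ) (m : M) (x : X.toDGMod) :
    tmul X m (e • x) = e • tmul X m x := BalTensor.tmul_units_smul e m x

theorem op_smul_tmul (m : M) (x : X.toDGMod) (b : Bᵐᵒᵖ) : b • tmul X m x = tmul X m (b • x) :=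
  rfl

theorem d_tmul (m : M) (x : X.toDGMod) :
    (M.tensor X).d (tmul X m x) = tmul X (M.d m) x + tmul X (M.sgn m) (X.d x) := rfl

theorem tmul_mem {i j k : ℤ} (h : i + j = k) {m : M} (hm : m ∈ M.gr i) {x : X.toDGMod}
    (hx : x ∈ X.gr j) : tmul X m x ∈ (M.tensor X).gr k :=
  tmul_mem_tensorGr h hm hx

theorem sgn_tmul (m : M) (x : X.toDGMod) :
    (M.tensor X).sgn (tmul X m x) = tmul X (M.sgn m) (X.sgn x) := by
  refine hom_induction M.isInternal m ?_ ?_ ?_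
  · rw [map_zero, zero_tmul, zero_tmul, map_zero]
  · intro m m' h h'
    rw [map_add, add_tmul, add_tmul, ← h, ← h', map_add]
  intro i m hm
  refine hom_induction X.isInternal x ?_ ?_ ?_
  · rw [map_zero, tmul_zero, tmul_zero, map_zero]
  · intro x x' h h'
    rw [map_add, tmul_add, tmul_add, ← h, ← h', map_add]
  intro j x hx
  rw [(M.tensor X).sgn_of_mem (tmul_mem X rfl hm hx), M.sgn_of_mem hm,
    X.toDGMod.sgn_of_mem hx, units_smul_tmul, tmul_units_smul, smul_smul, Int.negOnePow_add]

theorem gr_induction {X : DGBimod.{u, v, v', w'} A B} {P : Type*} [AddCommGroup P]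
    (F : M.tensor X →+ P) (H : ℤ → AddSubgroup P)
    (hF : ∀ i j, ∀ m ∈ M.gr i, ∀ x ∈ X.gr j, F (tmul X m x) ∈ H (i + j)) (k : ℤ)
    (t : M.tensor X) (ht : t ∈ (M.tensor X).gr k) : F t ∈ H k := by
  have : (M.tensor X).gr k ≤ (H k).comap F := by
    refine (AddSubgroup.closure_le _).2 ?_
    rintro _ ⟨i, j, rfl, m, hm, x, hx, rfl⟩
    exact hF i j m hm x hx
  exact this ht

end DGMod

/-- The pure tensor `y ⊗ x` in the DG bimodule `Y ⊗_A X`. -/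
def DGBimod.tmul {Y : DGBimod.{u, v'', v, w} C A} (y : Y.toDGMod) (x : X.toDGMod) :
    (Y.tensor X).toDGMod := DGMod.tmul X y x

end Pure

namespace DGBimod

variable {Y : DGBimod.{u, v'', v, w} C A} (X : DGBimod.{u, v, v', w'} A B)

@[elab_as_elim]
theorem tensor_induction {X : DGBimod.{u, v, v', w'} A B} {p : (Y.tensor X).toDGMod → Prop}
    (t : (Y.tensor X).toDGMod) (h0 : p 0)
    (htmul : ∀ m x, p (tmul X m x)) (hadd : ∀ s t, p s → p t → p (s + t)) : p t :=
  BalTensor.induction t h0 htmul hadd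

theorem add_tmul (m m' : Y.toDGMod) (x : X.toDGMod) :
    tmul X (m + m') x = tmul X m x + tmul X m' x :=
  BalTensor.add_tmul m m' x

theorem tmul_add (m : Y.toDGMod) (x x' : X.toDGMod) :
    tmul X m (x + x') = tmul X m x + tmul X m x' :=
  BalTensor.tmul_add m x x'

theorem smul_tmul (m : Y.toDGMod) (a : A) (x : X.toDGMod) :
    tmul X (m <• a) x = tmul X m (a • x) :=
  BalTensor.smul_tmul m a x

variable (Y) in
/-- Pure tensors, as a biadditive map. -/
def tmulHom : Y.toDGMod →+ X.toDGMod →+ (Y.tensor X).toDGMod :=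
  AddMonoidHom.mk' (fun m => AddMonoidHom.mk' (tmul X m) (tmul_add X m))
    fun m m' => by ext x; exact add_tmul X m m' x

theorem tmulHom_apply (m : Y.toDGMod) (x : X.toDGMod) : tmulHom Y X m x = tmul X m x := rfl

theorem smul_tmul' (c : C) (m : Y.toDGMod) (x : X.toDGMod) :
    c • tmul X m x = tmul X (c • m) x := rfl

theorem op_smul_tmul (m : Y.toDGMod) (x : X.toDGMod) (b : Bᵐᵒᵖ) :
    b • tmul X m x = tmul X m (b • x) := rfl

theorem d_tmul (m : Y.toDGMod) (x : X.toDGMod) :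
    (Y.tensor X).d (tmul X m x) = tmul X (Y.d m) x + tmul X (Y.sgn m) (X.d x) := rfl

theorem tmul_mem {i j k : ℤ} (h : i + j = k) {m : Y.toDGMod} (hm : m ∈ Y.gr i) {x : X.toDGMod}
    (hx : x ∈ X.gr j) : tmul X m x ∈ (Y.tensor X).gr k :=
  tmul_mem_tensorGr h hm hx

end DGBimod

end Tensor


/-! ### Maps between tensor products -/

section TensorMaps

variable {A : DGAlg.{u, v} R} {B : DGAlg.{u, v'} R} {C : DGAlg.{u, v''} R}

open DGMod

/-- A homomorphism of DG bimodules. -/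
structure DGBimodHom (X : DGBimod.{u, v, v', w} A B) (Y : DGBimod.{u, v, v', w'} A B) where
  /-- the underlying homomorphism of right DG modules -/
  toHom : DGHom X.toDGMod Y.toDGMod
  map_smul : ∀ (a : A) (x : X.toDGMod), toHom.1 (a • x) = a • toHom.1 x

/-- Composition of homomorphisms of DG bimodules. -/
def DGBimodHom.comp {X : DGBimod.{u, v, v', w} A B} {Y : DGBimod.{u, v, v', w'} A B}
    {Z : DGBimod.{u, v, v', w''} A B} (g : DGBimodHom Y Z) (f : DGBimodHom X Y) :
    DGBimodHom X Z where
  toHom := DGHom.comp g.toHom f.toHom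
  map_smul a x := (congrArg g.toHom.1 (f.map_smul a x)).trans (g.map_smul a _)

theorem DGHom.map_sgn {M : DGMod.{u, v, w} A} {N : DGMod.{u, v, w'} A} (f : DGHom M N) (m : M) :
    f.1 (M.sgn m) = N.sgn (f.1 m) := by
  refine hom_induction M.isInternal m (by simp) ?_ ?_
  · intro x y hx hy
    simp only [map_add, hx, hy]
  · intro i x hx
    rw [M.sgn_of_mem hx, N.sgn_of_mem (f.2.1 i x hx)]
    simp only [Units.smul_def, map_zsmul]

/-- Construction of homomorphisms out of a tensor product. -/
def DGHom.ofTensor {M : DGMod.{u, v, w} A} {X : DGBimod.{u, v, v', w'} A B}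
    {P : DGMod.{u, v', w''} B} (f : M →+ X.toDGMod →+ P)
    (hf : ∀ m (a : A) x, f (m <• a) x = f m (a • x))
    (hr : ∀ m x (b : Bᵐᵒᵖ), f m (b • x) = b • f m x)
    (hg : ∀ i j, ∀ m ∈ M.gr i, ∀ x ∈ X.gr j, f m x ∈ P.gr (i + j))
    (hd : ∀ m x, f (M.d m) x + f (M.sgn m) (X.d x) = P.d (f m x)) : DGHom (M.tensor X) P :=
  ⟨{ toFun := lift f hf
     map_add' := map_add (lift f hf)
     map_smul' := fun b t => by
      rw [RingHom.id_apply]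
      refine tensor_induction t ?_ ?_ ?_
      · simp
      · exact fun m x => hr m x b
      · intro s t hs ht
        simp only [smul_add, map_add, hs, ht] },
    gr_induction (lift f hf) P.gr hg, fun t => by
      change lift f hf ((M.tensor X).d t) = P.d (lift f hf t)
      refine tensor_induction t ?_ ?_ ?_
      · simp
      · exact fun m x => by rw [d_tmul, map_add]; exact hd m x
      · intro s t hs ht
        simp only [map_add, hs, ht]⟩

/-- The map `f ⊗ X : M ⊗_A X → M' ⊗_A X`. -/
def DGHom.rTensor {M : DGMod.{u, v, w} A} {M' : DGMod.{u, v, w''} A} (f : DGHom M M')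
    (X : DGBimod.{u, v, v', w'} A B) : DGHom (M.tensor X) (M'.tensor X) :=
  DGHom.ofTensor ((tmulHom M' X).comp f.1.toAddMonoidHom)
    (fun m a x => by
      change tmul X (f.1 (m <• a)) x = tmul X (f.1 m) (a • x)
      rw [map_smul, smul_tmul])
    (fun m x b => rfl)
    (fun i j m hm x hx => tmul_mem X rfl (f.2.1 i m hm) hx)
    (fun m x => by
      change tmul X (f.1 (M.d m)) x + tmul X (f.1 (M.sgn m)) (X.d x) =
        tmul X (M'.d (f.1 m)) x + tmul X (M'.sgn (f.1 m)) (X.d x)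
      rw [f.2.2, DGHom.map_sgn])

/-- The map `M ⊗ g : M ⊗_A X → M ⊗_A Y`. -/
def DGHom.lTensor (M : DGMod.{u, v, w} A) {X : DGBimod.{u, v, v', w'} A B}
    {Y : DGBimod.{u, v, v', w''} A B} (g : DGBimodHom X Y) : DGHom (M.tensor X) (M.tensor Y) :=
  DGHom.ofTensor ((AddMonoidHom.compHom.flip g.toHom.1.toAddMonoidHom).comp (tmulHom M Y))
    (fun m a x => by
      change tmul Y (m <• a) (g.toHom.1 x) = tmul Y m (g.toHom.1 (a • x))
      rw [g.map_smul, smul_tmul])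
    (fun m x b => by
      change tmul Y m (g.toHom.1 (b • x)) = b • tmul Y m (g.toHom.1 x)
      rw [map_smul, op_smul_tmul])
    (fun i j m hm x hx => tmul_mem Y rfl hm (g.toHom.2.1 j x hx))
    (fun m x => by
      change tmul Y (M.d m) (g.toHom.1 x) + tmul Y (M.sgn m) (g.toHom.1 (X.d x)) =
        tmul Y (M.d m) (g.toHom.1 x) + tmul Y (M.sgn m) (Y.d (g.toHom.1 x))
      rw [g.toHom.2.2])

theorem DGBimod.sgn_tmul {Y : DGBimod.{u, v'', v, w} C A} (X : DGBimod.{u, v, v', w'} A B)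
    (m : Y.toDGMod) (x : X.toDGMod) :
    (Y.tensor X).sgn (tmul X m x) = tmul X (Y.sgn m) (X.sgn x) := DGMod.sgn_tmul X m x

section Assoc

variable (M : DGMod.{u, v, w} A) (X : DGBimod.{u, v, v', w'} A B)
  (Y : DGBimod.{u, v', v'', w''} B C)

/-- The biadditive map `(m ⊗ x, y) ↦ m ⊗ (x ⊗ y)`. -/
def assocAux : M.tensor X →+ Y.toDGMod →+ M.tensor (X.tensor Y) :=
  lift (AddMonoidHom.mk' (fun m => (AddMonoidHom.compHom (tmulHom M (X.tensor Y) m)).comp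
      (DGBimod.tmulHom X Y)) fun m m' => by
        ext x y
        exact DGMod.add_tmul (X.tensor Y) m m' (DGBimod.tmul Y x y)) fun m a x => by
    ext y
    change tmul (X.tensor Y) (m <• a) (DGBimod.tmul Y x y) =
      tmul (X.tensor Y) m (DGBimod.tmul Y (a • x) y)
    rw [smul_tmul, DGBimod.smul_tmul']

theorem assocAux_tmul (m : M) (x : X.toDGMod) (y : Y.toDGMod) :
    assocAux M X Y (tmul X m x) y = tmul (X.tensor Y) m (DGBimod.tmul Y x y) := rfl

/-- The associativity map `(M ⊗_A X) ⊗_B Y → M ⊗_A (X ⊗_B Y)`. -/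
def DGHom.assoc : DGHom ((M.tensor X).tensor Y) (M.tensor (X.tensor Y)) :=
  DGHom.ofTensor (assocAux M X Y)
    (fun t b y => by
      refine tensor_induction t ?_ ?_ ?_
      · simp
      · intro m x
        rw [op_smul_tmul, assocAux_tmul, assocAux_tmul, DGBimod.smul_tmul]
      · intro s t hs ht
        simp only [smul_add, map_add, AddMonoidHom.add_apply, hs, ht])
    (fun t y c => by
      refine tensor_induction t ?_ ?_ ?_
      · simp
      · intro m x
        rw [assocAux_tmul, assocAux_tmul, op_smul_tmul, DGBimod.op_smul_tmul]
      · intro s t hs ht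
        simp only [smul_add, map_add, AddMonoidHom.add_apply, hs, ht])
    (fun i j t ht y hy => by
      refine gr_induction ((assocAux M X Y).flip y)
        (fun k => (M.tensor (X.tensor Y)).gr (k + j)) ?_ i t ht
      intro i' j' m hm x hx
      exact tmul_mem _ (add_assoc i' j' j).symm hm (DGBimod.tmul_mem Y rfl hx hy))
    (fun t y => by
      refine tensor_induction t ?_ ?_ ?_
      · simp
      · intro m x
        rw [sgn_tmul, assocAux_tmul, assocAux_tmul, d_tmul, d_tmul, map_add,
          AddMonoidHom.add_apply, assocAux_tmul, assocAux_tmul, DGBimod.d_tmul,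
          DGMod.tmul_add (X.tensor Y), add_assoc]
      · intro s t hs ht
        simp only [map_add, AddMonoidHom.add_apply, ← hs, ← ht]
        abel)

theorem DGHom.assoc_tmul (m : M) (x : X.toDGMod) (y : Y.toDGMod) :
    (DGHom.assoc M X Y).1 (tmul Y (tmul X m x) y) = tmul (X.tensor Y) m (DGBimod.tmul Y x y) :=
  rfl

end Assoc

end TensorMaps


/-! ### The diagonal ideal and the diagonal tensor algebra -/

section Ker

variable {A : DGAlg.{u, v} R} {B : DGAlg.{u, v'} R}

theorem DGHom.map_proj {M : DGMod.{u, v, w} A} {N : DGMod.{u, v, w'} A} (f : DGHom M N) (i : ℤ)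
    (m : M) : f.1 (M.proj i m) = N.proj i (f.1 m) := by
  refine hom_induction M.isInternal m (by simp) ?_ ?_
  · intro x y hx hy
    simp only [map_add, hx, hy]
  · intro j x hx
    by_cases h : j = i
    · subst h
      rw [M.proj_same hx, N.proj_same (f.2.1 j x hx)]
    · rw [M.proj_ne h hx, N.proj_ne h (f.2.1 j x hx), map_zero]

/-- The kernel of a homomorphism of DG bimodules. -/
def DGBimodHom.ker {X : DGBimod.{u, v, v', w} A B} {Y : DGBimod.{u, v, v', w'} A B}
    (f : DGBimodHom X Y) : DGBimod.{u, v, v', w} A B where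
  carrier := LinearMap.ker f.toHom.1
  gr i := (X.gr i).comap (LinearMap.ker f.toHom.1).subtype.toAddMonoidHom
  isInternal := by
    have hp : ∀ (i : ℤ) (x : LinearMap.ker f.toHom.1),
        X.toDGMod.proj i x.1 ∈ LinearMap.ker f.toHom.1 := fun i x => by
      have hx : f.toHom.1 x.1 = 0 := x.2
      rw [LinearMap.mem_ker, DGHom.map_proj, hx, map_zero]
    refine isInternal_of_proj (fun i => AddMonoidHom.mk' (fun x => ⟨X.toDGMod.proj i x.1, hp i x⟩)
      fun x y => Subtype.ext (map_add (X.toDGMod.proj i) x.1 y.1)) ?_ ?_ ?_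
    · exact fun i x hx => Subtype.ext (X.toDGMod.proj_same hx)
    · exact fun i j hij x hx => Subtype.ext (X.toDGMod.proj_ne hij hx)
    · intro x
      obtain ⟨s, hs⟩ := X.toDGMod.exists_eq_sum_proj x.1
      have : x = ∑ i ∈ s, (⟨X.toDGMod.proj i x.1, hp i x⟩ : LinearMap.ker f.toHom.1) := by
        refine Subtype.ext (hs.trans ?_)
        exact (map_sum (LinearMap.ker f.toHom.1).subtype
          (fun i => (⟨X.toDGMod.proj i x.1, hp i x⟩ : LinearMap.ker f.toHom.1)) s).symm
      exact this ▸ sum_mem fun i _ => AddSubgroup.mem_iSup_of_mem i (X.toDGMod.proj_mem i x.1)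
  smul_mem h h' := X.smul_mem h h'
  d := AddMonoidHom.mk' (fun x => ⟨X.d x.1, by
      have hx : f.toHom.1 x.1 = 0 := x.2
      rw [LinearMap.mem_ker, f.toHom.2.2, hx, map_zero]⟩)
    fun x y => Subtype.ext (map_add X.d x.1 y.1)
  d_mem h := X.d_mem h
  d_d x := Subtype.ext (X.d_d x.1)
  leibniz {i m} b h := Subtype.ext (X.leibniz b h)
  leftModule :=
    { smul := fun a x => ⟨a • (x.1 : X.toDGMod), by
        have hx : f.toHom.1 x.1 = 0 := x.2
        rw [LinearMap.mem_ker, f.map_smul, hx, smul_zero]⟩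
      one_smul := fun x => Subtype.ext (one_smul A (x.1 : X.toDGMod))
      mul_smul := fun a b x => Subtype.ext (mul_smul a b (x.1 : X.toDGMod))
      smul_zero := fun a => Subtype.ext (smul_zero (A := X.toDGMod) a)
      smul_add := fun a x y => Subtype.ext (smul_add a (x.1 : X.toDGMod) y.1)
      add_smul := fun a b x => Subtype.ext (add_smul a b (x.1 : X.toDGMod))
      zero_smul := fun x => Subtype.ext (zero_smul A (x.1 : X.toDGMod)) }
  smul_op_smul a x b := Subtype.ext (X.smul_op_smul a x.1 b)
  lsmul_mem h h' := X.lsmul_mem h h'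
  lleibniz {i a} x h := Subtype.ext (X.lleibniz x.1 h)

end Ker

section Diagonal

variable {A : DGAlg.{u, v} R} {B : DGAlg.{u, v'} R} (φ : DGAlgHom A B)

/-- The enveloping algebra `Bᵉ = B ⊗_A B`, as a DG `(B, B)`-bimodule. -/
def env : DGBimod.{u, v', v', v'} B B := (B.regBimod.resR φ).tensor (B.regBimod.resL φ)

/-- The pure tensor `b ⊗ b'` of `Bᵉ`. -/
def envTmul (b b' : B) : (env φ).toDGMod :=
  DGBimod.tmul (Y := B.regBimod.resR φ) (B.regBimod.resL φ) b b'

/-- The multiplication map `π_B : Bᵉ → B`, `b ⊗ b' ↦ b b'`. -/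
def envMul : DGBimodHom (env φ) B.regBimod where
  toHom := DGHom.ofTensor (M := B.reg.res φ) (X := B.regBimod.resL φ) (P := B.reg)
    (AddMonoidHom.mul (R := B))
    (fun (m : B) a (x : B) => mul_assoc m (φ a) x)
    (fun (m x : B) b => (mul_assoc m x b.unop).symm)
    (fun i j m hm x hx => B.mul_mem hm hx)
    (fun (m x : B) => by
      exact (B.reg.leibniz_sgn m x).symm)
  map_smul b t := by
    refine DGBimod.tensor_induction (Y := B.regBimod.resR φ) (X := B.regBimod.resL φ) t ?_ ?_ ?_
    · exact (congrArg _ (smul_zero (A := (env φ).toDGMod) b)).trans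
        ((map_zero _).trans ((congrArg (b • ·) (map_zero _)).trans
          (smul_zero (A := B.regBimod.toDGMod) b)).symm)
    · exact fun (m x : B) => mul_assoc b m x
    · intro s t hs ht
      exact (congrArg _ (smul_add (A := (env φ).toDGMod) b s t)).trans ((map_add _ _ _).trans
        ((congrArg₂ (· + ·) hs ht).trans ((congrArg (b • ·) (map_add _ s t)).trans
          (smul_add (A := B.regBimod.toDGMod) b _ _)).symm))

theorem envMul_tmul (b b' : B) : (envMul φ).toHom.1 (envTmul φ b b') = b * b' := rfl

/-- The diagonal ideal `J = ker (π_B : Bᵉ → B)`. -/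
def diagIdeal : DGBimod.{u, v', v', v'} B B := (envMul φ).ker

theorem univDer_mem (b : B) :
    envTmul φ b 1 - envTmul φ 1 b ∈ LinearMap.ker (envMul φ).toHom.1 := by
  have h : (envMul φ).toHom.1 (envTmul φ b 1) = (envMul φ).toHom.1 (envTmul φ 1 b) := by
    rw [envMul_tmul, envMul_tmul, mul_one, one_mul]
  exact (map_sub (envMul φ).toHom.1 (envTmul φ b 1) (envTmul φ 1 b)).trans (sub_eq_zero_of_eq h)

/-- The universal derivation `δ : B → J`, `δ(b) = b ⊗ 1 - 1 ⊗ b`. -/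
def univDer (b : B) : (diagIdeal φ).toDGMod :=
  ⟨envTmul φ b 1 - envTmul φ 1 b, univDer_mem φ b⟩

/-- The identity map `X → Σ X` (of degree 1), `x ↦ Σ x`. -/
def DGBimod.toSusp {A : DGAlg.{u, v} R} {B : DGAlg.{u, v'} R} (X : DGBimod.{u, v, v', w} A B)
    (x : X.toDGMod) : X.susp.toDGMod := x

/-- The shift `Σ J` of the diagonal ideal. -/
def suspDiag : DGBimod.{u, v', v', v'} B B := (diagIdeal φ).susp

/-- `Σ δ(b)`, i.e. `δ(b)` as an element of `Σ J`. -/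
def suspDer (b : B) : (suspDiag φ).toDGMod :=
  (diagIdeal φ).toSusp (univDer φ b)

end Diagonal

section TensorPowers

variable {B : DGAlg.{u, v} R}

/-- The tensor powers `T^n = V^{⊗_B n}` of a DG `(B, B)`-bimodule `V`; these are the tensor
graded components of the tensor algebra `T = ⨁ V^{⊗_B n}`. -/
def tensorPow (V : DGBimod.{u, v, v, v} B B) : ℕ → DGBimod.{u, v, v, v} B B
  | 0 => B.regBimod
  | n + 1 => V.tensor (tensorPow V n)

/-- `X ⊗ g`, as a homomorphism of bimodules. -/
def DGBimodHom.lTensor (X : DGBimod.{u, v, v, v} B B) {Y Z : DGBimod.{u, v, v, v} B B}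
    (g : DGBimodHom Y Z) : DGBimodHom (X.tensor Y) (X.tensor Z) where
  toHom := DGHom.lTensor X.toDGMod g
  map_smul b t := by
    refine DGBimod.tensor_induction t ?_ ?_ ?_
    · rw [smul_zero, map_zero]; exact (smul_zero b).symm
    · exact fun _ _ => rfl
    · intro s t hs ht
      rw [smul_add, map_add, map_add, hs, ht]
      exact (smul_add b _ _).symm

/-- Associativity, as a homomorphism of bimodules. -/
def DGBimodHom.assoc (X Y Z : DGBimod.{u, v, v, v} B B) :
    DGBimodHom ((X.tensor Y).tensor Z) (X.tensor (Y.tensor Z)) where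
  toHom := DGHom.assoc X.toDGMod Y Z
  map_smul b t := by
    refine DGBimod.tensor_induction t ?_ ?_ ?_
    · rw [smul_zero, map_zero]; exact (smul_zero b).symm
    · intro s z
      refine DGBimod.tensor_induction s ?_ ?_ ?_
      · have h : DGBimod.tmul Z (0 : (X.tensor Y).toDGMod) z = 0 := BalTensor.zero_tmul z
        rw [h, smul_zero, map_zero]; exact (smul_zero b).symm
      · exact fun _ _ => rfl
      · intro s s' hs hs'
        rw [DGBimod.add_tmul, smul_add, map_add, map_add, hs, hs']
        exact (smul_add b _ _).symm
    · intro s t hs ht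
      rw [smul_add, map_add, map_add, hs, ht]
      exact (smul_add b _ _).symm

theorem regBimod_lleibniz_sgn (V : DGBimod.{u, v, v, v} B B) (m : B) (x : V.toDGMod) :
    V.d (m • x) = B.d m • x + B.sgn m • V.d x := by
  refine hom_induction B.isInternal' m (by simp) ?_ ?_
  · intro b c hb hc
    simp only [add_smul, map_add, hb, hc]
    abel
  · intro i b hb
    rw [V.lleibniz x hb, B.sgn_of_mem hb]
    simp only [Units.smul_def, smul_assoc]

/-- The canonical map `B ⊗_B V → V`, `b ⊗ v ↦ b v`. -/
def leftUnit (V : DGBimod.{u, v, v, v} B B) : DGBimodHom (B.regBimod.tensor V) V where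
  toHom := DGHom.ofTensor (M := B.reg) (X := V) (P := V.toDGMod) (smulAddHom B V.toDGMod)
    (fun (m : B) a x => mul_smul m a x)
    (fun (m : B) x b => smul_comm m b x)
    (fun i j m hm x hx => V.lsmul_mem hm hx)
    (fun (m : B) x => (regBimod_lleibniz_sgn V m x).symm)
  map_smul b t := by
    refine DGBimod.tensor_induction t ?_ ?_ ?_
    · rw [smul_zero, map_zero, smul_zero]
    · exact fun (m : B) x => mul_smul b m x
    · intro s t hs ht
      rw [smul_add, map_add, map_add, hs, ht, smul_add]

/-- The unit of `B`, as an element of the bimodule `B`. -/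
def regOne (B : DGAlg.{u, v} R) : B.regBimod.toDGMod := (1 : B)

/-- The canonical map `V → V ⊗_B B`, `v ↦ v ⊗ 1`. -/
def rightUnit (V : DGBimod.{u, v, v, v} B B) : DGBimodHom V (V.tensor B.regBimod) where
  toHom := ⟨{
      toFun := fun x => DGBimod.tmul B.regBimod x (regOne B)
      map_add' := fun x y => DGBimod.add_tmul B.regBimod x y (regOne B)
      map_smul' := fun b x => by
        have h : (b.unop • regOne B : B.regBimod.toDGMod) = b • regOne B :=
          (mul_one b.unop).trans (one_mul b.unop).symm
        exact (DGBimod.smul_tmul B.regBimod x b.unop (regOne B)).trans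
          ((congrArg _ h).trans (DGBimod.op_smul_tmul B.regBimod x (regOne B) b).symm) },
    fun i x hx => DGBimod.tmul_mem B.regBimod (add_zero i) hx B.one_mem, fun x => by
      change DGBimod.tmul B.regBimod (V.d x) (regOne B) =
        DGBimod.tmul B.regBimod (V.d x) (regOne B) +
          DGBimod.tmul B.regBimod (V.sgn x) (B.regBimod.d (regOne B))
      have h : B.regBimod.d (regOne B) = 0 := B.d_one
      have h' : DGBimod.tmul B.regBimod (V.sgn x) (0 : B.regBimod.toDGMod) = 0 :=
        map_zero (DGBimod.tmulHom V B.regBimod (V.sgn x))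
      rw [h, h', add_zero]⟩
  map_smul b x := rfl

/-- The multiplication `T^n ⊗_B T^1 → T^{n+1}` of the tensor algebra, i.e. the canonical map
`V^{⊗ n} ⊗_B V → V^{⊗ (n+1)} = V ⊗_B V^{⊗ n}`,
`(v_1 ⊗ ⋯ ⊗ v_n) ⊗ v ↦ v_1 ⊗ ⋯ ⊗ v_n ⊗ v`. -/
def powMul (V : DGBimod.{u, v, v, v} B B) :
    ∀ n, DGBimodHom ((tensorPow V n).tensor V) (tensorPow V (n + 1))
  | 0 => (rightUnit V).comp (leftUnit V)
  | n + 1 => (DGBimodHom.lTensor V (powMul V n)).comp (DGBimodHom.assoc V (tensorPow V n) V)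

end TensorPowers


/-! ### Tensor graded DG modules over a tensor algebra -/

section TGMods

variable {B : DGAlg.{u, v} R}

/-- A tensor graded DG `T`-module, where `T` is the tensor algebra of the DG bimodule `V`: a
family of DG `B`-modules `M^i`, `i : ℤ`, with homomorphisms `M^i ⊗_B V → M^{i+1}` of DG
`B`-modules (indexed by all `i`, `j` with `i + 1 = j`). -/
structure TGMod (V : DGBimod.{u, v, v, v} B B) where
  /-- the tensor graded components -/
  X : ℤ → DGMod.{u, v, w} B
  /-- the action of `V` -/
  a : ∀ i j, i + 1 = j → DGHom ((X i).tensor V) (X j)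

variable {V : DGBimod.{u, v, v, v} B B}

namespace TGMod

/-- The action `x · c` of `c ∈ V` on `x ∈ M^i`. -/
def act (M : TGMod.{u, v, w} V) (i j : ℤ) (h : i + 1 = j) (x : M.X i) (c : V.toDGMod) : M.X j :=
  (M.a i j h).1 (DGMod.tmul V x c)

theorem act_add (M : TGMod.{u, v, w} V) (i j : ℤ) (h : i + 1 = j) (x y : M.X i) (c : V.toDGMod) :
    M.act i j h (x + y) c = M.act i j h x c + M.act i j h y c := by
  unfold act; rw [DGMod.add_tmul, map_add]

theorem act_zero (M : TGMod.{u, v, w} V) (i j : ℤ) (h : i + 1 = j) (c : V.toDGMod) :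
    M.act i j h 0 c = 0 := by
  unfold act; rw [DGMod.zero_tmul, map_zero]

theorem act_neg (M : TGMod.{u, v, w} V) (i j : ℤ) (h : i + 1 = j) (x : M.X i) (c : V.toDGMod) :
    M.act i j h (-x) c = -M.act i j h x c := by
  rw [eq_neg_iff_add_eq_zero, ← act_add, neg_add_cancel, act_zero]

theorem act_units_smul (M : TGMod.{u, v, w} V) (i j : ℤ) (h : i + 1 = j) (e : ℤˣ) (x : M.X i)
    (c : V.toDGMod) : M.act i j h (e • x) c = e • M.act i j h x c := by
  unfold act
  rw [DGMod.units_smul_tmul, Units.smul_def, Units.smul_def, map_zsmul]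

/-- A family of maps `f^i : M^i → N^i` that is `T`-linear, i.e. `f(x · c) = f(x) · c`. -/
def IsTLinear {M : TGMod.{u, v, w} V} {N : TGMod.{u, v, w'} V}
    (f : ∀ i, M.X i →ₗ[Bᵐᵒᵖ] N.X i) : Prop :=
  ∀ i j (h : i + 1 = j) (x : M.X i) (c : V.toDGMod),
    f j (M.act i j h x c) = N.act i j h (f i x) c

end TGMod

open TGMod

/-- `Hom_{C^gr(T)}(M, N)`: the tensor graded DG `T`-module homomorphisms. -/
def TGHom (M : TGMod.{u, v, w} V) (N : TGMod.{u, v, w'} V) :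
    AddSubgroup (∀ i, M.X i →ₗ[Bᵐᵒᵖ] N.X i) where
  carrier := {f | (∀ i, f i ∈ DGHom (M.X i) (N.X i)) ∧ IsTLinear f}
  zero_mem' := ⟨fun i => zero_mem _, fun i j h x c => (act_zero N i j h c).symm⟩
  add_mem' := fun {f g} hf hg => ⟨fun i => add_mem (hf.1 i) (hg.1 i), fun i j h x c => by
    simp only [Pi.add_apply, LinearMap.add_apply, hf.2 i j h, hg.2 i j h, act_add]⟩
  neg_mem' := fun {f} hf => ⟨fun i => neg_mem (hf.1 i), fun i j h x c => by
    simp only [Pi.neg_apply, LinearMap.neg_apply, hf.2 i j h, act_neg]⟩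

/-- The null-homotopic tensor graded homomorphisms: those of the form `∂ h + h ∂` with a tensor
graded `T`-linear map `h : M → Σ⁻¹ N`. Thus `f ~ g` iff `f - g` lies in this subgroup. -/
def tgNullHtp (M : TGMod.{u, v, w} V) (N : TGMod.{u, v, w'} V) : AddSubgroup (TGHom M N) where
  carrier := {f | ∃ h : ∀ i, M.X i →ₗ[Bᵐᵒᵖ] N.X i,
    (∀ i, IsNullHomotopy (f.1 i) (h i)) ∧ IsTLinear h}
  zero_mem' := ⟨0, fun i => .zero, fun i j h x c => (act_zero N i j h c).symm⟩
  add_mem' := fun ⟨h, H, H'⟩ ⟨k, K, K'⟩ => ⟨h + k, fun i => (H i).add (K i), fun i j e x c => by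
    simp only [Pi.add_apply, LinearMap.add_apply, H' i j e, K' i j e, act_add]⟩
  neg_mem' := fun ⟨h, H, H'⟩ => ⟨-h, fun i => (H i).neg, fun i j e x c => by
    simp only [Pi.neg_apply, LinearMap.neg_apply, H' i j e, act_neg]⟩

/-- `Hom_{K^gr(T)}(M, N)`: homotopy classes of tensor graded DG `T`-module homomorphisms. -/
def TGHomK (M : TGMod.{u, v, w} V) (N : TGMod.{u, v, w'} V) : Type _ :=
  TGHom M N ⧸ tgNullHtp M N

instance (M : TGMod.{u, v, w} V) (N : TGMod.{u, v, w'} V) : AddCommGroup (TGHomK M N) :=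
  inferInstanceAs (AddCommGroup (TGHom M N ⧸ tgNullHtp M N))

/-- The class `[f]` in `K^gr(T)` of a homomorphism `f` in `C^gr(T)`. -/
def TGHom.cls {M : TGMod.{u, v, w} V} {N : TGMod.{u, v, w'} V} (f : TGHom M N) : TGHomK M N :=
  QuotientAddGroup.mk f

section Comp

variable {M : TGMod.{u, v, w} V} {N : TGMod.{u, v, w'} V} {P : TGMod.{u, v, w''} V}

/-- Composition in `C^gr(T)`. -/
def TGHom.comp : TGHom N P →+ TGHom M N →+ TGHom M P :=
  AddMonoidHom.mk' (fun g => AddMonoidHom.mk' (fun f => ⟨fun i => (g.1 i).comp (f.1 i),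
      fun i => (DGHom.comp ⟨g.1 i, g.2.1 i⟩ ⟨f.1 i, f.2.1 i⟩).2, fun i j h x c => by
        simp only [LinearMap.comp_apply, f.2.2 i j h, g.2.2 i j h]⟩)
    fun f f' => Subtype.ext (funext fun i => LinearMap.comp_add _ _ _))
    fun g g' => by
      refine AddMonoidHom.ext fun f => Subtype.ext (funext fun i => ?_)
      exact LinearMap.add_comp (f.1 i) (g'.1 i) (g.1 i)

theorem TGHom.comp_val (g : TGHom N P) (f : TGHom M N) (i : ℤ) :
    (TGHom.comp g f).1 i = (g.1 i).comp (f.1 i) := rfl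

theorem comp_mem_left (g : TGHom N P) {f : TGHom M N} (hf : f ∈ tgNullHtp M N) :
    TGHom.comp g f ∈ tgNullHtp M P := by
  obtain ⟨h, H, H'⟩ := hf
  refine ⟨fun i => (g.1 i).comp (h i), fun i => ⟨fun k m hm => ?_, fun m => ?_⟩, ?_⟩
  · exact (g.2.1 i).1 _ _ ((H i).map_mem k m hm)
  · rw [TGHom.comp_val, LinearMap.comp_apply, (H i).eq, map_add, (g.2.1 i).2]; rfl
  · intro i j e x c
    simp only [LinearMap.comp_apply, H' i j e, g.2.2 i j e]

theorem comp_mem_right {g : TGHom N P} (hg : g ∈ tgNullHtp N P) (f : TGHom M N) :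
    TGHom.comp g f ∈ tgNullHtp M P := by
  obtain ⟨h, H, H'⟩ := hg
  refine ⟨fun i => (h i).comp (f.1 i), fun i => ⟨fun k m hm => ?_, fun m => ?_⟩, ?_⟩
  · exact (H i).map_mem k _ ((f.2.1 i).1 k m hm)
  · rw [TGHom.comp_val, LinearMap.comp_apply, (H i).eq, ← (f.2.1 i).2]; rfl
  · intro i j e x c
    simp only [LinearMap.comp_apply, H' i j e, f.2.2 i j e]

/-- Left composition with a homomorphism of `C^gr(T)`, on homotopy classes. -/
def TGHom.compK (g : TGHom N P) : TGHomK M N →+ TGHomK M P :=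
  QuotientAddGroup.map (tgNullHtp M N) (tgNullHtp M P) (TGHom.comp g)
    fun _ hf => comp_mem_left g hf

/-- Composition in `K^gr(T)`: `TGHomK.comp g f = g ∘ f`. -/
def TGHomK.comp : TGHomK N P →+ TGHomK M N →+ TGHomK M P :=
  QuotientAddGroup.lift (tgNullHtp N P) (AddMonoidHom.mk' TGHom.compK
    fun g g' => AddMonoidHom.ext fun f => by
      obtain ⟨f, rfl⟩ := QuotientAddGroup.mk_surjective f
      exact congrArg TGHom.cls (DFunLike.congr_fun (map_add (TGHom.comp (M := M) (N := N) (P := P)) g g') f))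
    fun g hg => AddMonoidHom.ext fun f => by
      obtain ⟨f, rfl⟩ := QuotientAddGroup.mk_surjective f
      exact (QuotientAddGroup.eq_zero_iff _).2 (comp_mem_right hg f)

theorem TGHomK.comp_cls (g : TGHom N P) (f : TGHom M N) :
    TGHomK.comp (TGHom.cls g) (TGHom.cls f) = TGHom.cls (TGHom.comp g f) := rfl

end Comp

/-! The two shifts. -/

section ShiftTensor

variable {M : DGMod.{u, v, w} B} {N : DGMod.{u, v, w'} B}

theorem DGMod.shift_sgn (m : ℤ) (x : M) : (M.shift m).sgn x = m.negOnePow • M.sgn x := by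
  refine hom_induction M.isInternal x ?_ ?_ ?_
  · exact (map_zero (M.shift m).sgn).trans (by rw [map_zero, smul_zero]; rfl)
  · intro x y hx hy
    exact (map_add (M.shift m).sgn x y).trans (by
      rw [map_add, smul_add]; exact congrArg₂ (· + ·) hx hy)
  · intro k x hx
    have hx' : x ∈ (M.shift m).gr (k + m) := by
      change x ∈ M.gr (k + m - m)
      rwa [add_sub_cancel_right]
    rw [M.sgn_of_mem hx, smul_smul, ← Int.negOnePow_add, add_comm m k]
    exact (M.shift m).sgn_of_mem hx'

/-- A homomorphism `f : M ⊗_B V → N`, regarded as a homomorphism `Σ^m M ⊗_B V → Σ^m N` (with the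
same underlying map). -/
def DGHom.shiftTensor (m : ℤ) (f : DGHom (M.tensor V) N) :
    DGHom ((M.shift m).tensor V) (N.shift m) :=
  let g : M →+ V.toDGMod →+ N :=
    (AddMonoidHom.compHom f.1.toAddMonoidHom).comp (DGMod.tmulHom M V)
  have hg : ∀ x c, g x c = f.1 (DGMod.tmul V x c) := fun _ _ => rfl
  have h1 : ∀ x (b : B) c, g (x <• b) c = g x (b • c) := fun x b c => by
    rw [hg, hg, DGMod.smul_tmul]
  have h2 : ∀ x c (b : Bᵐᵒᵖ), g x (b • c) = b • g x c := fun x c b => by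
    rw [hg, hg, ← DGMod.op_smul_tmul, map_smul]
  have h3 : ∀ i j, ∀ x ∈ M.gr (i - m), ∀ c ∈ V.gr j, g x c ∈ N.gr (i + j - m) := by
    intro i j x hx c hc
    rw [show i + j - m = i - m + j by ring]
    exact f.2.1 _ _ (DGMod.tmul_mem V rfl hx hc)
  have h4 : ∀ x c, g (m.negOnePow • M.d x) c + g (m.negOnePow • M.sgn x) (V.d c) =
      m.negOnePow • N.d (g x c) := by
    intro x c
    rw [hg, hg, hg, ← f.2.2, DGMod.d_tmul, DGMod.units_smul_tmul, DGMod.units_smul_tmul, map_add,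
      smul_add]
    simp only [Units.smul_def, map_zsmul]
  DGHom.ofTensor (M := M.shift m) (X := V) (P := N.shift m) g h1 h2 h3
    fun x c => (congrArg (fun y => g (m.negOnePow • M.d x) c + g y (V.d c))
      (DGMod.shift_sgn (M := M) m x)).trans (h4 x c)

end ShiftTensor

/-- The shift `Σ^m M` of a tensor graded DG module; the action of `T` is unchanged. -/
def TGMod.shift (m : ℤ) (M : TGMod.{u, v, w} V) : TGMod.{u, v, w} V where
  X i := (M.X i).shift m
  a i j h := DGHom.shiftTensor m (M.a i j h)

/-- The shift `M[n]` of the tensor grading, `M[n]^i = M^{i+n}`. -/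
def TGMod.tshift (n : ℤ) (M : TGMod.{u, v, w} V) : TGMod.{u, v, w} V where
  X i := M.X (i + n)
  a i j h := M.a (i + n) (j + n) (by omega)

section ShiftMaps

variable {M : TGMod.{u, v, w} V} {N : TGMod.{u, v, w'} V}

/-- The shift functor `Σ^m` on morphisms of `C^gr(T)`. -/
def TGHom.shift (m : ℤ) : TGHom M N →+ TGHom (M.shift m) (N.shift m) :=
  AddMonoidHom.mk' (fun f => ⟨fun i => (f.1 i : M.X i →ₗ[Bᵐᵒᵖ] N.X i),
      fun i => ⟨fun k x hx => (f.2.1 i).1 (k - m) x hx, fun (x : M.X i) => by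
        change f.1 i (m.negOnePow • (M.X i).d x) = m.negOnePow • (N.X i).d (f.1 i x)
        rw [Units.smul_def, map_zsmul, (f.2.1 i).2]; rfl⟩,
      fun i j h x c => f.2.2 i j h x c⟩)
    fun _ _ => rfl

/-- The shift functor `[n]` on morphisms of `C^gr(T)`. -/
def TGHom.tshift (n : ℤ) : TGHom M N →+ TGHom (M.tshift n) (N.tshift n) :=
  AddMonoidHom.mk' (fun f => ⟨fun i => f.1 (i + n), fun i => f.2.1 (i + n),
      fun i j _ x c => f.2.2 (i + n) (j + n) _ x c⟩)
    fun _ _ => rfl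

/-- The shift functor `Σ^m` on morphisms of `K^gr(T)`. -/
def TGHomK.shift (m : ℤ) : TGHomK M N →+ TGHomK (M.shift m) (N.shift m) :=
  QuotientAddGroup.map (tgNullHtp M N) (tgNullHtp (M.shift m) (N.shift m)) (TGHom.shift m) (by
    rintro f ⟨h, H, H'⟩
    refine ⟨fun i => (m.negOnePow • h i : M.X i →ₗ[Bᵐᵒᵖ] N.X i), fun i => ⟨?_, ?_⟩, ?_⟩
    · intro k x hx
      have := (H i).map_mem (k - m) x hx
      rw [show k - m + 1 = k + 1 - m by ring] at this
      exact DGMod.units_smul_mem _ _ this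
    · intro x
      change f.1 i x = m.negOnePow • (N.X i).d (m.negOnePow • h i x) +
        m.negOnePow • h i (m.negOnePow • (M.X i).d x)
      simp only [Units.smul_def, map_zsmul, smul_smul, ← Units.val_mul, Int.units_mul_self,
        Units.val_one, one_smul]
      exact (H i).eq x
    · intro i j e (x : M.X i) c
      change m.negOnePow • h j (M.act i j e x c) = N.act i j e (m.negOnePow • h i x) c
      rw [H' i j e, TGMod.act_units_smul])

/-- The shift functor `[n]` on morphisms of `K^gr(T)`. -/
def TGHomK.tshift (n : ℤ) : TGHomK M N →+ TGHomK (M.tshift n) (N.tshift n) :=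
  QuotientAddGroup.map (tgNullHtp M N) (tgNullHtp (M.tshift n) (N.tshift n)) (TGHom.tshift n) (by
    rintro f ⟨h, H, H'⟩
    exact ⟨fun i => h (i + n), fun i => H (i + n), fun i j _ x c => H' (i + n) (j + n) _ x c⟩)

variable (M) in
/-- The identification `M[k][n] = M[n + k]`; in tensor degree `i` it is the identity of
`M^{i+n+k}`. -/
def TGHom.tshiftAdd (n k : ℤ) : TGHom ((M.tshift k).tshift n) (M.tshift (n + k)) :=
  have key : ∀ {i i' : ℤ} (h : i = i'),
      ((h ▸ LinearMap.id : M.X i →ₗ[Bᵐᵒᵖ] M.X i') ∈ DGHom (M.X i) (M.X i')) ∧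
      ∀ (j j' : ℤ) (hj : j = j') (e : i + 1 = j) (e' : i' + 1 = j') (x : M.X i) (c : V.toDGMod),
        (hj ▸ LinearMap.id : M.X j →ₗ[Bᵐᵒᵖ] M.X j') (M.act i j e x c) =
        M.act i' j' e' ((h ▸ LinearMap.id : M.X i →ₗ[Bᵐᵒᵖ] M.X i') x) c := by
    rintro i _ rfl
    refine ⟨(DGHom.id (M.X i)).2, ?_⟩
    rintro j _ rfl e e' x c
    rfl
  ⟨fun i => ((add_assoc i n k) ▸ LinearMap.id : M.X (i + n + k) →ₗ[Bᵐᵒᵖ] M.X (i + (n + k))),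
    fun i => (key (add_assoc i n k)).1,
    fun i j h x c => (key (add_assoc i n k)).2 _ _ (add_assoc j n k) _ _ x c⟩

end ShiftMaps

/-! The tensor graded module `N ⊗_B T`. -/

/-- The components `(N ⊗_B T)^i`: they are `N ⊗_B T^i` for `i ≥ 0` and `0` for `i < 0`. -/
def tensorTX (N : DGMod.{u, v, w} B) (V : DGBimod.{u, v, v, v} B B) : ℤ → DGMod.{u, v, max w v} B
  | .ofNat n => N.tensor (tensorPow V n)
  | .negSucc _ => DGMod.zero

/-- The action `(n ⊗ t, c) ↦ n ⊗ t c`. -/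
def tensorTa (N : DGMod.{u, v, w} B) (V : DGBimod.{u, v, v, v} B B) :
    ∀ i j, i + 1 = j → DGHom ((tensorTX N V i).tensor V) (tensorTX N V j)
  | .ofNat n, _, rfl =>
    DGHom.comp (DGHom.lTensor N (powMul V n)) (DGHom.assoc N (tensorPow V n) V)
  | .negSucc _, _, _ => 0

/-- The tensor graded DG `T`-module `N ⊗_B T`, where `T` is the tensor algebra of `V`. -/
def tensorT (N : DGMod.{u, v, w} B) (V : DGBimod.{u, v, v, v} B B) : TGMod.{u, v, max w v} V where
  X := tensorTX N V
  a := tensorTa N V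

/-- The components of the `T`-linear extension of `w : N → N ⊗_B V`. -/
def extendX {N : DGMod.{u, v, w} B} (f : DGHom N (N.tensor V)) :
    ∀ i, DGHom (tensorTX N V i) (tensorTX N V (i + 1))
  | .ofNat n => DGHom.comp (DGHom.assoc N V (tensorPow V n)) (DGHom.rTensor f (tensorPow V n))
  | .negSucc _ => 0

theorem extendX_act {N : DGMod.{u, v, w} B} (f : DGHom N (N.tensor V)) :
    ∀ (i j : ℤ) (h : i + 1 = j) (x : tensorTX N V i) (c : V.toDGMod),
      (extendX f j).1 ((tensorTa N V i j h).1 (DGMod.tmul V x c)) =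
      (tensorTa N V (i + 1) (j + 1) (by rw [h])).1 (DGMod.tmul V ((extendX f i).1 x) c)
  | .negSucc n, _, rfl, x, c => by
    have h1 : (tensorTa N V (.negSucc n) _ rfl).1 (DGMod.tmul V x c) = 0 := rfl
    have h2 : (extendX f (.negSucc n)).1 x = 0 := rfl
    rw [h1, h2, map_zero, DGMod.zero_tmul, map_zero]
  | .ofNat n, _, rfl, x, c => by
    have key : ∀ (y : N.tensor V) (t : (tensorPow V n).toDGMod),
        (DGHom.assoc N V (tensorPow V (n + 1))).1
          (DGMod.tmul (tensorPow V (n + 1)) y ((powMul V n).toHom.1 (DGBimod.tmul V t c))) =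
        (DGHom.lTensor N (powMul V (n + 1))).1 ((DGHom.assoc N (tensorPow V (n + 1)) V).1
          (DGMod.tmul V ((DGHom.assoc N V (tensorPow V n)).1
            (DGMod.tmul (tensorPow V n) y t)) c)) := by
      intro y t
      refine DGMod.tensor_induction y ?_ ?_ ?_
      · rw [DGMod.zero_tmul, DGMod.zero_tmul, map_zero, map_zero]
        exact (((congrArg _ (congrArg _ (DGMod.zero_tmul V c))).trans
          (congrArg _ (map_zero _))).trans (map_zero _)).symm
      · intro m v
        rfl
      · intro y y' hy hy'
        rw [DGMod.add_tmul, DGMod.add_tmul, map_add, map_add, hy, hy']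
        exact (((congrArg _ (congrArg _ (DGMod.add_tmul V _ _ c))).trans
          (congrArg _ (map_add _ _ _))).trans (map_add _ _ _)).symm
    let L : N.tensor (tensorPow V n) →+ N.tensor (tensorPow V (n + 2)) :=
      ((extendX f (.ofNat (n + 1))).1.toAddMonoidHom.comp
        (tensorTa N V (.ofNat n) _ rfl).1.toAddMonoidHom).comp
          ((DGMod.tmulHom (N.tensor (tensorPow V n)) V).flip c)
    let L' : N.tensor (tensorPow V n) →+ N.tensor (tensorPow V (n + 2)) :=
      ((tensorTa N V (.ofNat (n + 1)) _ rfl).1.toAddMonoidHom.comp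
          ((DGMod.tmulHom (N.tensor (tensorPow V (n + 1))) V).flip c)).comp
        (extendX f (.ofNat n)).1.toAddMonoidHom
    have hL : ∀ y, L y = L' y := by
      intro y
      refine DGMod.tensor_induction y ?_ ?_ ?_
      · rw [map_zero, map_zero]
      · intro m t
        exact key (f.1 m) t
      · intro y y' hy hy'
        rw [map_add, map_add, hy, hy']
    exact hL x

/-- The `T`-linear extension `N ⊗_B T → N ⊗_B T[1]` of a homomorphism `f : N → N ⊗_B V`:
if `f n = ∑ n_k ⊗ v_k`, then `n ⊗ t ↦ ∑ n_k ⊗ v_k ⊗ t`. -/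
def extend {N : DGMod.{u, v, w} B} (f : DGHom N (N.tensor V)) :
    TGHom (tensorT N V) ((tensorT N V).tshift 1) :=
  ⟨fun i => (extendX f i).1, fun i => (extendX f i).2, extendX_act f⟩

end TGMods


/-! ### The element `ω_N` -/

section Derivation

variable {A : DGAlg.{u, v} R} {B : DGAlg.{u, v'} R} (φ : DGAlgHom A B)

/-- `b ↦ b ⊗ b'` and `b' ↦ b ⊗ b'`, as a biadditive map into `Bᵉ`. -/
def envTmulHom : B →+ B →+ (env φ).toDGMod :=
  DGBimod.tmulHom (B.regBimod.resR φ) (B.regBimod.resL φ)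

theorem univDer_val (b : B) : (univDer φ b).1 = envTmulHom φ b 1 - envTmulHom φ 1 b := rfl

theorem univDer_add (b c : B) : univDer φ (b + c) = univDer φ b + univDer φ c := by
  refine Subtype.ext ?_
  refine (univDer_val φ _).trans ?_
  rw [map_add, map_add, AddMonoidHom.add_apply, add_sub_add_comm]
  rfl

theorem univDer_mul (b c : B) : univDer φ (b * c) = univDer φ b <• c + b • univDer φ c := by
  refine Subtype.ext ?_
  have h1 : (univDer φ b <• c).1 = envTmulHom φ b c - envTmulHom φ 1 (b * c) := by
    have h : (univDer φ b <• c).1 =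
      (envTmulHom φ b 1 - envTmulHom φ 1 b : (env φ).toDGMod) <• c := rfl
    rw [h, smul_sub]
    have h' : (envTmulHom φ b 1 : (env φ).toDGMod) <• c = envTmulHom φ b (1 * c) := rfl
    rw [h', one_mul]
    rfl
  have h2 : (b • univDer φ c).1 = envTmulHom φ (b * c) 1 - envTmulHom φ b c := by
    have h : (b • univDer φ c).1 =
      b • (envTmulHom φ c 1 - envTmulHom φ 1 c : (env φ).toDGMod) := rfl
    rw [h, smul_sub]
    have h' : b • (envTmulHom φ 1 c : (env φ).toDGMod) = envTmulHom φ (b * 1) c := rfl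
    rw [h', mul_one]
    rfl
  have h3 : (univDer φ b <• c + b • univDer φ c).1 =
    (univDer φ b <• c).1 + (b • univDer φ c).1 := rfl
  rw [h3, h1, h2, univDer_val]
  abel

theorem env_d_tmul (b c : B) : (env φ).d (envTmulHom φ b c) =
    envTmulHom φ (B.d b) c + envTmulHom φ (B.sgn b) (B.d c) := rfl

theorem univDer_d (b : B) : (diagIdeal φ).d (univDer φ b) = univDer φ (B.d b) := by
  refine Subtype.ext ?_
  have h : ((diagIdeal φ).d (univDer φ b)).1 =
    (env φ).d (envTmulHom φ b 1 - envTmulHom φ 1 b) := rfl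
  have h1 : B.sgn (1 : B) = 1 := map_one B.sgn
  rw [h, map_sub, env_d_tmul, env_d_tmul, B.d_one, h1, map_zero, map_zero,
    AddMonoidHom.zero_apply, univDer_val, add_zero, zero_add]

theorem univDer_mem_gr {i : ℤ} {b : B} (hb : b ∈ B.gr i) :
    univDer φ b ∈ (diagIdeal φ).gr i := by
  change (univDer φ b).1 ∈ (env φ).gr i
  rw [univDer_val]
  exact sub_mem (DGBimod.tmul_mem (Y := B.regBimod.resR φ) (B.regBimod.resL φ) (add_zero i)
      hb B.one_mem)
    (DGBimod.tmul_mem (Y := B.regBimod.resR φ) (B.regBimod.resL φ) (zero_add i) B.one_mem hb)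

theorem DGBimod.toSusp_add (X : DGBimod.{u, v, v', w} A B) (x y : X.toDGMod) :
    X.toSusp (x + y) = X.toSusp x + X.toSusp y := rfl

theorem DGBimod.toSusp_neg (X : DGBimod.{u, v, v', w} A B) (x : X.toDGMod) :
    X.toSusp (-x) = -X.toSusp x := rfl

theorem DGBimod.toSusp_op_smul (X : DGBimod.{u, v, v', w} A B) (x : X.toDGMod) (b : B) :
    X.toSusp (x <• b) = X.toSusp x <• b := rfl

theorem DGBimod.toSusp_d (X : DGBimod.{u, v, v', w} A B) (x : X.toDGMod) :
    X.susp.d (X.toSusp x) = X.toSusp ((1 : ℤ).negOnePow • X.d x) := rfl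

theorem DGBimod.susp_smul {X : DGBimod.{u, v, v', w} A B} (a : A) (x : X.toDGMod) :
    a • X.toSusp x = X.toSusp (A.sgn a • x) := rfl

theorem DGAlg.sgn_sgn (B : DGAlg.{u, v} R) (b : B) : B.sgn (B.sgn b) = b := B.reg.sgn_sgn b

theorem suspDer_add (b c : B) : suspDer φ (b + c) = suspDer φ b + suspDer φ c :=
  (congrArg (diagIdeal φ).toSusp (univDer_add φ b c)).trans ((diagIdeal φ).toSusp_add _ _)

/-- `b ↦ Σ δ(b)` as an additive map. -/
def suspDerHom : B →+ (suspDiag φ).toDGMod := AddMonoidHom.mk' (suspDer φ) (suspDer_add φ)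

theorem suspDerHom_apply (b : B) : suspDerHom φ b = suspDer φ b := rfl

theorem suspDerHom_mul (b c : B) :
    suspDerHom φ (b * c) = suspDerHom φ b <• c + B.sgn b • suspDerHom φ c := by
  have h : B.sgn b • suspDer φ c = (diagIdeal φ).toSusp (b • univDer φ c) :=
    (DGBimod.susp_smul (X := diagIdeal φ) (B.sgn b) (univDer φ c)).trans
      (by rw [DGAlg.sgn_sgn])
  rw [suspDerHom_apply, suspDerHom_apply, suspDerHom_apply, h]
  exact (congrArg (diagIdeal φ).toSusp (univDer_mul φ b c)).trans
    (((diagIdeal φ).toSusp_add _ _).trans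
      (congrArg (fun x : (diagIdeal φ).susp.toDGMod => x + (diagIdeal φ).toSusp (b • univDer φ c))
        ((diagIdeal φ).toSusp_op_smul (univDer φ b) c)))

theorem DGBimod.susp_d_toSusp (X : DGBimod.{u, v, v', w} A B) {x y : X.toDGMod}
    (h : X.d x = y) : X.susp.d (X.toSusp x) = -X.toSusp y := by
  have h2 : (1 : ℤ).negOnePow • y = -y := by
    rw [Int.negOnePow_one, Units.smul_def]; simp
  rw [X.toSusp_d, h, h2, X.toSusp_neg]

theorem suspDerHom_d (b : B) :
    (suspDiag φ).d (suspDerHom φ b) = -suspDerHom φ (B.d b) := by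
  rw [suspDerHom_apply, suspDerHom_apply]
  exact DGBimod.susp_d_toSusp (diagIdeal φ) (univDer_d φ b)

theorem suspDerHom_mem {i : ℤ} {b : B} (hb : b ∈ B.gr i) :
    suspDerHom φ b ∈ (suspDiag φ).gr (i + 1) := by
  have h := univDer_mem_gr φ hb
  rw [← add_sub_cancel_right i 1] at h
  exact h

end Derivation

section Omega

variable {A : DGAlg.{u, v} R} {B : DGAlg.{u, v'} R} (φ : DGAlgHom A B)
  {N : DGMod.{u, v', w} B} (E : SemifreeBasis N)

/-- The right `B`-linear map `N → N ⊗_B ΣJ` with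
`e_λ ↦ ∑_μ (-1)^{|e_μ|} e_μ ⊗ Σδ(b_{μλ})`, where `∂ e_λ = ∑_μ e_μ b_{μλ}`. (The sign is the Koszul
sign from the identification `Σ(N ⊗_B J) ≅ N ⊗_B ΣJ`; it is what makes the map commute with the
differentials.) -/
def atiyahLin : N →ₗ[Bᵐᵒᵖ] N.tensor (suspDiag φ) :=
  E.basis.constr ℕ fun l => (E.basis.repr (N.d (E.basis l))).sum fun m b =>
    (E.deg m).negOnePow • DGMod.tmul (suspDiag φ) (E.basis m) (suspDer φ b.unop)

/-- The auxiliary additive map `∑_μ e_μ b_μ ↦ ∑_μ (-1)^{|e_μ|} e_μ ⊗ Σδ(b_μ)`. -/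
def connAux : N →+ N.tensor (suspDiag φ) :=
  (Finsupp.liftAddHom fun m => (E.deg m).negOnePow •
    ((DGMod.tmulHom N (suspDiag φ) (E.basis m)).comp
      ((suspDerHom φ).comp (opAddEquiv (α := B)).symm.toAddMonoidHom))).comp
    E.basis.repr.toLinearMap.toAddMonoidHom

theorem connAux_basis (m : E.ι) (b : B) : connAux φ E (E.basis m <• b) =
    (E.deg m).negOnePow • DGMod.tmul (suspDiag φ) (E.basis m) (suspDerHom φ b) := by
  change Finsupp.liftAddHom _ (E.basis.repr (E.basis m <• b)) = _
  rw [map_smul, Module.Basis.repr_self, Finsupp.smul_single, Finsupp.liftAddHom_apply_single,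
    smul_eq_mul, mul_one]
  rfl

theorem atiyahLin_basis (l : E.ι) : atiyahLin φ E (E.basis l) = connAux φ E (N.d (E.basis l)) :=
  Module.Basis.constr_basis _ _ _ _

@[elab_as_elim]
theorem SemifreeBasis.induction {p : N → Prop} (x : N) (h0 : p 0)
    (hadd : ∀ x y, p x → p y → p (x + y))
    (hb : ∀ m j, ∀ b ∈ B.gr j, p (E.basis m <• b)) : p x := by
  obtain ⟨f, rfl⟩ := E.basis.repr.symm.surjective x
  induction f using Finsupp.induction_linear with
  | zero => rw [map_zero]; exact h0
  | add f g hf hg => rw [map_add]; exact hadd _ _ hf hg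
  | single m b =>
    rw [Module.Basis.repr_symm_single]
    refine hom_induction B.isInternal' (p := fun c => p (E.basis m <• c)) b.unop ?_ ?_ ?_
    · rw [op_zero, zero_smul]; exact h0
    · intro c c' hc hc'
      rw [op_add, add_smul]; exact hadd _ _ hc hc'
    · exact fun j c hc => hb m j c hc

theorem connAux_smul (x : N) (c : B) : connAux φ E (x <• c) =
    connAux φ E x <• c + DGMod.tmul (suspDiag φ) (N.sgn x) (suspDerHom φ c) := by
  refine SemifreeBasis.induction E x ?_ ?_ ?_
  · rw [smul_zero, map_zero, map_zero, DGMod.zero_tmul, smul_zero, add_zero]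
  · intro x y hx hy
    rw [smul_add, map_add, hx, hy, map_add, map_add, DGMod.add_tmul, smul_add]
    abel
  · intro m j b hb
    rw [smul_smul, ← op_mul, connAux_basis, connAux_basis, suspDerHom_mul, DGMod.tmul_add,
      N.sgn_smul, N.sgn_of_mem (E.mem_gr m), smul_add, ← DGMod.op_smul_tmul, ← DGMod.smul_tmul,
      smul_comm (op (B.sgn b)), DGMod.units_smul_tmul]
    simp only [Units.smul_def]
    rw [smul_comm (op c)]

theorem atiyahLin_eq (x : N) :
    atiyahLin φ E x = (N.tensor (suspDiag φ)).d (connAux φ E x) + connAux φ E (N.d x) := by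
  refine SemifreeBasis.induction E x ?_ ?_ ?_
  · simp
  · intro x y hx hy
    simp only [map_add, hx, hy]
    abel
  · intro m j b hb
    have hd : (N.tensor (suspDiag φ)).d
        (DGMod.tmul (suspDiag φ) (E.basis m) (suspDerHom φ b)) =
        DGMod.tmul (suspDiag φ) (N.d (E.basis m)) (suspDerHom φ b) -
        (E.deg m).negOnePow • DGMod.tmul (suspDiag φ) (E.basis m) (suspDerHom φ (B.d b)) := by
      rw [DGMod.d_tmul, suspDerHom_d, N.sgn_of_mem (E.mem_gr m), DGMod.units_smul_tmul,
        ← DGMod.tmulHom_apply, ← DGMod.tmulHom_apply, map_neg, smul_neg, sub_eq_add_neg]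
      rfl
    have hs : N.sgn (N.d (E.basis m)) = -((E.deg m).negOnePow • N.d (E.basis m)) := by
      rw [N.sgn_of_mem (N.d_mem (E.mem_gr m)), Int.negOnePow_sub, Int.negOnePow_one, mul_neg,
        mul_one]
      simp only [Units.smul_def, Units.val_neg, neg_zsmul]
    rw [map_smul, atiyahLin_basis, connAux_basis, N.leibniz b (E.mem_gr m), map_add, connAux_smul,
      hs, ← DGMod.tmulHom_apply _ (-_), map_neg, AddMonoidHom.neg_apply, DGMod.tmulHom_apply,
      DGMod.units_smul_tmul]
    simp only [Units.smul_def, map_zsmul]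
    rw [connAux_basis, hd, smul_sub]
    simp only [Units.smul_def]
    abel

theorem connAux_proj (i : ℤ) (x : N) :
    connAux φ E (N.proj i x) = (N.tensor (suspDiag φ)).proj (i + 1) (connAux φ E x) := by
  refine SemifreeBasis.induction E x ?_ ?_ ?_
  · simp
  · intro x y hx hy
    simp only [map_add, hx, hy]
  · intro m j b hb
    have h1 := N.smul_mem (E.mem_gr m) hb
    have h2 : connAux φ E (E.basis m <• b) ∈ (N.tensor (suspDiag φ)).gr (E.deg m + j + 1) := by
      rw [connAux_basis]
      exact DGMod.units_smul_mem _ _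
        (DGMod.tmul_mem _ (add_assoc _ _ _).symm (E.mem_gr m) (suspDerHom_mem φ hb))
    by_cases h : E.deg m + j = i
    · subst h
      rw [N.proj_same h1, DGMod.proj_same _ h2]
    · rw [N.proj_ne h h1, DGMod.proj_ne _ (by omega) h2, map_zero]

theorem connAux_mem {i : ℤ} {x : N} (hx : x ∈ N.gr i) :
    connAux φ E x ∈ (N.tensor (suspDiag φ)).gr (i + 1) := by
  rw [← N.proj_same hx, connAux_proj]
  exact DGMod.proj_mem _ _ _

/-- The map `atiyahLin` as a homomorphism of DG `B`-modules `N → N ⊗_B ΣJ`. -/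
def atiyah : DGHom N (N.tensor (suspDiag φ)) :=
  ⟨atiyahLin φ E, fun i x hx => by
    rw [atiyahLin_eq]
    have h1 := DGMod.d_mem _ (connAux_mem φ E hx)
    have h2 := connAux_mem φ E (N.d_mem hx)
    rw [add_sub_cancel_right] at h1
    rw [sub_add_cancel] at h2
    exact add_mem h1 h2, fun x => by
    rw [atiyahLin_eq, atiyahLin_eq, map_add, N.d_d, DGMod.d_d, map_zero, add_zero, zero_add]⟩

/-- The tensor graded DG `T`-module `N ⊗_B T`, where `T = ⨁ (ΣJ)^{⊗_B n}` is the diagonal tensor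
algebra. -/
abbrev diagT (N : DGMod.{u, v', w} B) : TGMod.{u, v', max w v'} (suspDiag φ) :=
  tensorT N (suspDiag φ)

/-- The element `ω_N` of `Hom_{K^gr(T)}(N ⊗_B T, N ⊗_B T[1])`: the class of the homomorphism
`e_λ ⊗ t ↦ ∑_μ (-1)^{|e_μ|} e_μ ⊗ Σδ(b_{μλ}) ⊗ t`. -/
def omega : TGHomK (diagT φ N) ((diagT φ N).tshift 1) := TGHom.cls (extend (atiyah φ E))

/-- `Σ^m(ω_N[n])`, as a morphism `Σ^m(N ⊗_B T[n]) → Σ^m(N ⊗_B T[n + 1])` of `K^gr(T)`. -/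
def omegaShift (m n : ℤ) : TGHomK (((diagT φ N).tshift n).shift m)
    (((diagT φ N).tshift (n + 1)).shift m) :=
  TGHomK.shift m (TGHomK.comp (TGHom.cls (TGHom.tshiftAdd (diagT φ N) n 1))
    (TGHomK.tshift n (omega φ E)))

/-- Left composition with `Σ^m(ω_N[n])`, from
`Hom_{K^gr(T)}(N ⊗_B T, Σ^m(N ⊗_B T[n]))` to `Hom_{K^gr(T)}(N ⊗_B T, Σ^m(N ⊗_B T[n + 1]))`. -/
def omegaComp (m n : ℤ) : TGHomK (diagT φ N) (((diagT φ N).tshift n).shift m) →+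
    TGHomK (diagT φ N) (((diagT φ N).tshift (n + 1)).shift m) :=
  TGHomK.comp (omegaShift φ E m n)

/-- The graded group `*Hom_{K^gr(T)}(N ⊗_B T, Σ^m(N ⊗_B T))`, the direct sum over `n : ℤ` of the
groups `Hom_{K^gr(T)}(N ⊗_B T, Σ^m(N ⊗_B T[n]))`. -/
abbrev StarHom (N : DGMod.{u, v', w} B) (m : ℤ) : Type _ :=
  ⨁ n : ℤ, TGHomK (diagT φ N) (((diagT φ N).tshift n).shift m)

/-- The left action of `Σ^m ω_N` on `*Hom_{K^gr(T)}(N ⊗_B T, Σ^m(N ⊗_B T))`, homogeneous of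
degree `1`. -/
def omegaAct (m : ℤ) : StarHom φ N m →+ StarHom φ N m :=
  DirectSum.toAddMonoid fun n =>
    (DirectSum.of (fun n : ℤ => TGHomK (diagT φ N) (((diagT φ N).tshift n).shift m))
      (n + 1)).comp (omegaComp φ E m n)

/-- The standing assumptions on `φ : A → B`: `B` is semifree as a DG `A`-module, and
`B/A` vanishes in degrees `≤ 0`. -/
structure IsSetting : Prop where
  semifree : IsSemifree (B.reg.res φ)
  pos : ∀ n ≤ 0, ∀ b ∈ B.gr n, ∃ a : A, φ a = b

/-- Condition `(AR1)` for a DG `B`-module `N`. -/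
structure AR1 (N : DGMod.{u, v', w} B) : Prop where
  semifree : IsSemifree N
  nonneg : ∀ i < 0, N.gr i = ⊥
  perfect_B : IsPerfect (B.reg.res φ)
  perfect : IsPerfect (N.res φ)
  vanishing : ∀ n : ℤ, 1 ≤ n → Subsingleton (HomK N (B.reg.shift n))

end Omega

end DG

end

/-! The DG module N ⊗_B T is the free tensor graded T-module on N placed in tensor degree 0.
Restriction to N therefore identifies Hom in K^gr(T) from N ⊗_B T to P with Hom in K(B) from N to
P^0 (`extendT_restrictT`, `mem_tgNullHtp_iff`). Under this identification, composition with
Σ^m(ω_N[n]) is induced by the Atiyah map N → N ⊗_B ΣJ tensored with T^n; it goes from Hom(N, Σ^m(N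
⊗_B T^n)) to Hom(N, Σ^m(N ⊗_B ΣJ ⊗_B T^n)).

Tensoring 0 → J → Bᵉ → B → 0 with N on the left and T^n on the right gives an exact triangle N ⊗_A
T^n → N ⊗_B T^n → N ⊗_B ΣJ ⊗_B T^n with this second map. A semifree basis of N splits it as a
triangle of graded modules (`atiyahSplitting`), so exactness can be checked by explicit formulas
(`Splitting.exists_lift`, `Splitting.exists_null`). The map in question is thus surjective if Hom(N,
Σ^{m+1}(N ⊗_A T^n)) = 0, and injective if Hom(N, Σ^m(N ⊗_A T^n)) = 0.

For these vanishing statements, N is semifree over A, because B is, and it is perfect over A. So up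
to homotopy it is a retract of a finite semifree DG A-module F (`exists_homotopy_section`). As N is
zero in negative degrees, basis elements of F of negative degree do not matter, and one of degree d
≥ 0 contributes a copy of Σ^d T^n. Hence it suffices to know Hom(N, Σ^i T^n) = 0 for all i ≥ j in
order to kill Hom(N, Σ^j(N ⊗_A T^n)) (`vanishes_tensor`).

Finally, Hom(N, Σ^j T^n) vanishes for j ≥ 1, and also for j = 0 if n ≥ 1 (`vanishes_tensorPow`). For
n = 0 this is part of (AR1). For the induction the same triangle is applied to B in place of N: the
Atiyah map of B is zero, so Hom(N, Σ^j(ΣJ ⊗_B T^n)) embeds into Hom(N, Σ^{j+1}(B ⊗_A T^n)), which is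
zero for j ≥ 0. The shift gained here gives injectivity for m = 0 and n ≥ 1. -/

noncomputable section

namespace DG

universe u v v' v'' w w' w'' w'''

variable {R : Type u} [CommRing R]

/-! ### Homomorphisms into shifts, as plain linear maps -/

section Chains

variable {B : DGAlg.{u, v} R} {S : DGMod.{u, v, w} B} {P : DGMod.{u, v, w'} B}
  {Q : DGMod.{u, v, w''} B}

/-- `f` is a homomorphism of DG modules `S → Σ^k P`. -/
structure IsChain (k : ℤ) (f : S →ₗ[Bᵐᵒᵖ] P) : Prop where
  map_mem : ∀ i, ∀ x ∈ S.gr i, f x ∈ P.gr (i - k)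
  map_d : ∀ x, f (S.d x) = k.negOnePow • P.d (f x)

/-- `h` is a null homotopy of `f`, regarded as a map `S → Σ^k P`. -/
structure IsNull (k : ℤ) (f h : S →ₗ[Bᵐᵒᵖ] P) : Prop where
  map_mem : ∀ i, ∀ x ∈ S.gr i, h x ∈ P.gr (i + 1 - k)
  eq : ∀ x, f x = k.negOnePow • P.d (h x) + h (S.d x)

variable (S P) in
/-- Every homomorphism of DG modules `S → Σ^k P` is null-homotopic. -/
def Vanishes (k : ℤ) : Prop :=
  ∀ f : S →ₗ[Bᵐᵒᵖ] P, IsChain k f → ∃ h, IsNull k f h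

/-- Converts the vanishing assumed in (AR1) into a form where maps into Σ^k P are linear maps into P
with a degree and a sign. The two DG modules share a carrier, and no iterated shifts have to be
compared. -/
theorem vanishes_of_subsingleton {k : ℤ} (H : Subsingleton (HomK S (P.shift k))) :
    Vanishes S P k := by
  intro f hf
  let F : DGHom S (P.shift k) := ⟨f, hf.map_mem, hf.map_d⟩
  have h0 : (QuotientAddGroup.mk F : DGHom S (P.shift k) ⧸ nullHtp S (P.shift k)) = 0 :=
    H.elim (α := HomK S (P.shift k)) _ _
  obtain ⟨h, hh⟩ := (QuotientAddGroup.eq_zero_iff F).1 h0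
  exact ⟨h, hh.map_mem, hh.eq⟩

theorem IsChain.add {k : ℤ} {f g : S →ₗ[Bᵐᵒᵖ] P} (hf : IsChain k f) (hg : IsChain k g) :
    IsChain k (f + g) :=
  ⟨fun i x hx => add_mem (hf.map_mem i x hx) (hg.map_mem i x hx), fun x => by
    simp only [LinearMap.add_apply, hf.map_d, hg.map_d, map_add, smul_add]⟩

theorem IsChain.neg {k : ℤ} {f : S →ₗ[Bᵐᵒᵖ] P} (hf : IsChain k f) : IsChain k (-f) :=
  ⟨fun i x hx => neg_mem (hf.map_mem i x hx), fun x => by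
    simp only [LinearMap.neg_apply, hf.map_d, map_neg, smul_neg]⟩

theorem IsChain.units_smul {k : ℤ} {f : S →ₗ[Bᵐᵒᵖ] P} (hf : IsChain k f) (e : ℤˣ) :
    IsChain k (e • f) := by
  obtain rfl | rfl := Int.units_eq_one_or e
  · rw [one_smul]; exact hf
  · have h : (-1 : ℤˣ) • f = -f := by simp [Units.smul_def]
    rw [h]; exact hf.neg

theorem IsNull.add {k : ℤ} {f f' h h' : S →ₗ[Bᵐᵒᵖ] P} (H : IsNull k f h) (H' : IsNull k f' h') :
    IsNull k (f + f') (h + h') :=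
  ⟨fun i x hx => add_mem (H.map_mem i x hx) (H'.map_mem i x hx), fun x => by
    simp only [LinearMap.add_apply, H.eq, H'.eq, map_add, smul_add]; abel⟩

theorem IsNull.neg {k : ℤ} {f h : S →ₗ[Bᵐᵒᵖ] P} (H : IsNull k f h) : IsNull k (-f) (-h) :=
  ⟨fun i x hx => neg_mem (H.map_mem i x hx), fun x => by
    simp only [LinearMap.neg_apply, H.eq, map_neg, smul_neg]; abel⟩

theorem IsNull.sub {k : ℤ} {f f' h h' : S →ₗ[Bᵐᵒᵖ] P} (H : IsNull k f h) (H' : IsNull k f' h') :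
    IsNull k (f - f') (h - h') := by
  rw [sub_eq_add_neg, sub_eq_add_neg]
  exact H.add H'.neg

/-- The boundary `∂ h + h ∂` of a homogeneous map is a homomorphism of DG modules. -/
theorem IsNull.isChain {k : ℤ} {f h : S →ₗ[Bᵐᵒᵖ] P} (H : IsNull k f h) : IsChain k f := by
  refine ⟨fun i x hx => ?_, fun x => ?_⟩
  · rw [H.eq]
    have h1 := P.d_mem (H.map_mem i x hx)
    have h2 := H.map_mem _ _ (S.d_mem hx)
    rw [show i + 1 - k - 1 = i - k by ring] at h1
    rw [sub_add_cancel] at h2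
    exact add_mem (DGMod.units_smul_mem _ _ h1) h2
  · rw [H.eq, H.eq, S.d_d, map_zero, add_zero, map_add]
    simp only [Units.smul_def, map_zsmul, P.d_d, smul_zero, zero_add]

theorem IsChain.comp {k : ℤ} {f : S →ₗ[Bᵐᵒᵖ] P} (hf : IsChain k f) (g : DGHom P Q) :
    IsChain k (g.1 ∘ₗ f) :=
  ⟨fun i x hx => g.2.1 _ _ (hf.map_mem i x hx), fun x => by
    simp only [LinearMap.comp_apply, hf.map_d, Units.smul_def, map_zsmul, g.2.2]⟩

theorem IsNull.comp {k : ℤ} {f h : S →ₗ[Bᵐᵒᵖ] P} (H : IsNull k f h) (g : DGHom P Q) :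
    IsNull k (g.1 ∘ₗ f) (g.1 ∘ₗ h) :=
  ⟨fun i x hx => g.2.1 _ _ (H.map_mem i x hx), fun x => by
    simp only [LinearMap.comp_apply, H.eq, Units.smul_def, map_zsmul, g.2.2, map_add]⟩

/-- Left composition with a null-homotopic endomorphism. -/
theorem IsChain.comp_null {k : ℤ} {f : S →ₗ[Bᵐᵒᵖ] P} (hf : IsChain k f)
    {g h : P →ₗ[Bᵐᵒᵖ] Q} (H : IsNullHomotopy g h) :
    IsNull k (g ∘ₗ f) (k.negOnePow • (h ∘ₗ f)) := by
  refine ⟨fun i x hx => ?_, fun x => ?_⟩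
  · have h1 := H.map_mem _ _ (hf.map_mem i x hx)
    rw [show i - k + 1 = i + 1 - k by ring] at h1
    exact DGMod.units_smul_mem _ _ h1
  · have h1 : ∀ y, (k.negOnePow • (h ∘ₗ f)) y = k.negOnePow • h (f y) := fun y => rfl
    -- The sign (−1)^k squares to one in the term with ∂h; in the term with h∂ it cancels the sign
    -- with which f commutes with the differentials.
    rw [h1, h1, hf.map_d, LinearMap.comp_apply, H.eq]
    obtain e | e := Int.units_eq_one_or k.negOnePow <;> simp [e]

/-- A homomorphism with a left inverse reflects vanishing. -/
theorem Vanishes.of_retract {k : ℤ} (H : Vanishes S Q k) (s : DGHom P Q) (r : DGHom Q P)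
    (hrs : ∀ x, r.1 (s.1 x) = x) : Vanishes S P k := by
  intro f hf
  obtain ⟨h, hh⟩ := H _ (hf.comp s)
  have e : r.1 ∘ₗ (s.1 ∘ₗ f) = f := LinearMap.ext fun x => hrs _
  exact ⟨_, e ▸ hh.comp r⟩

end Chains

/-! ### Graded-split triangles -/

section Splitting

variable {B : DGAlg.{u, v} R} {S : DGMod.{u, v, w} B} {Q : DGMod.{u, v, w'} B}
  {Y : DGMod.{u, v, w''} B} {Z : DGMod.{u, v, w'''} B}

/-- A decomposition of graded modules `Q = Y ⊕ Σ⁻¹ Z` which exhibits `Q → Y → Z` as part of an exact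
triangle. -/
structure Splitting (π : DGHom Q Y) (ω : DGHom Y Z) where
  /-- the projection to `Z` -/
  ρ : Q →ₗ[Bᵐᵒᵖ] Z
  /-- the inclusion of `Y` -/
  σ : Y →ₗ[Bᵐᵒᵖ] Q
  /-- the inclusion of `Z` -/
  κ : Z →ₗ[Bᵐᵒᵖ] Q
  ρ_mem : ∀ i, ∀ x ∈ Q.gr i, ρ x ∈ Z.gr (i + 1)
  σ_mem : ∀ i, ∀ x ∈ Y.gr i, σ x ∈ Q.gr i
  κ_mem : ∀ i, ∀ x ∈ Z.gr i, κ x ∈ Q.gr (i - 1)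
  d_ρ : ∀ x, Z.d (ρ x) + ρ (Q.d x) = ω.1 (π.1 x)
  π_σ : ∀ y, π.1 (σ y) = y
  ρ_σ : ∀ y, ρ (σ y) = 0
  π_κ : ∀ z, π.1 (κ z) = 0
  ρ_κ : ∀ z, ρ (κ z) = z
  decomp : ∀ x, σ (π.1 x) + κ (ρ x) = x

namespace Splitting

variable {π : DGHom Q Y} {ω : DGHom Y Z} (s : Splitting π ω)

include s

theorem ext {x y : Q} (h : π.1 x = π.1 y) (h' : s.ρ x = s.ρ y) : x = y := by
  rw [← s.decomp x, h, h', s.decomp]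

/-- Checked on both components: π commutes with ∂ and kills κ, and the right-hand side of `d_ρ` is
zero on the image of κ. Thus κ is a homomorphism of DG modules Z → ΣQ, the third map of the
triangle. -/
theorem d_κ (z : Z) : Q.d (s.κ z) = -s.κ (Z.d z) := by
  refine s.ext ?_ ?_
  · rw [π.2.2, s.π_κ, map_zero, map_neg, s.π_κ, neg_zero]
  · have h := s.d_ρ (s.κ z)
    rw [s.π_κ, map_zero, s.ρ_κ] at h
    rw [map_neg, s.ρ_κ, eq_neg_iff_add_eq_zero, add_comm, h]

theorem isChain_κ {k : ℤ} {g : S →ₗ[Bᵐᵒᵖ] Z} (hg : IsChain k g) : IsChain (k + 1) (s.κ ∘ₗ g) := by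
  refine ⟨fun i x hx => ?_, fun x => ?_⟩
  · have h1 := s.κ_mem _ _ (hg.map_mem i x hx)
    rwa [show i - k - 1 = i - (k + 1) by ring] at h1
  · simp only [LinearMap.comp_apply, hg.map_d, Units.smul_def, map_zsmul, s.d_κ,
      Int.negOnePow_succ, Units.val_neg, neg_smul, smul_neg, neg_neg]

/-- Exactness at `Z`. -/
theorem exists_lift {k : ℤ} (H : Vanishes S Q (k + 1)) {g : S →ₗ[Bᵐᵒᵖ] Z} (hg : IsChain k g) :
    ∃ f : S →ₗ[Bᵐᵒᵖ] Y, IsChain k f ∧ ∃ h, IsNull k (g - ω.1 ∘ₗ f) h := by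
  -- The composite of g with κ : Z → ΣQ is null-homotopic by assumption. Of the two components of
  -- the homotopy h, the one in Y yields f up to sign, and the one in Z is a homotopy from g to ω ∘
  -- f.
  obtain ⟨h, hh⟩ := H _ (s.isChain_κ hg)
  have hmem : ∀ i, ∀ x ∈ S.gr i, h x ∈ Q.gr (i - k) := fun i x hx => by
    have := hh.map_mem i x hx
    rwa [show i + 1 - (k + 1) = i - k by ring] at this
  have hf : IsChain k (π.1 ∘ₗ h) := by
    refine ⟨fun i x hx => π.2.1 _ _ (hmem i x hx), fun x => ?_⟩
    have h1 := congrArg π.1 (hh.eq x)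
    rw [LinearMap.comp_apply, s.π_κ, map_add, Int.negOnePow_succ] at h1
    simp only [Units.smul_def, Units.val_neg, neg_smul, map_neg, map_zsmul, π.2.2] at h1
    simp only [LinearMap.comp_apply, Units.smul_def]
    exact (neg_add_eq_zero.1 h1.symm).symm
  -- The differential of Σ^{k+1} Q carries the sign −(−1)^k, and `d_ρ` replaces ρ∂h by ωπh − ∂ρh;
  -- this forces the sign of f.
  refine ⟨-(k.negOnePow • (π.1 ∘ₗ h)), (hf.units_smul _).neg, s.ρ ∘ₗ h, fun i x hx => ?_, fun x => ?_⟩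
  · have h1 := s.ρ_mem _ _ (hmem i x hx)
    rwa [show i - k + 1 = i + 1 - k by ring] at h1
  · have h1 := congrArg s.ρ (hh.eq x)
    rw [LinearMap.comp_apply, s.ρ_κ, map_add, Int.negOnePow_succ] at h1
    have h2 := s.d_ρ (h x)
    have h3 : (-(k.negOnePow • (π.1 ∘ₗ h))) x = -(k.negOnePow • π.1 (h x)) := rfl
    rw [LinearMap.sub_apply, LinearMap.comp_apply, h3, h1]
    simp only [LinearMap.comp_apply, Units.smul_def, Units.val_neg, neg_smul, map_neg, map_zsmul,
      ← h2, smul_add]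
    abel

/-- Exactness at `Y`. -/
theorem exists_null {k : ℤ} (H : Vanishes S Q k) {f : S →ₗ[Bᵐᵒᵖ] Y} (hf : IsChain k f)
    {h : S →ₗ[Bᵐᵒᵖ] Z} (hh : IsNull k (ω.1 ∘ₗ f) h) : ∃ h', IsNull k f h' := by
  -- A null homotopy of ω ∘ f is what is needed to lift f through π to a homomorphism into Σ^k Q.
  -- The lift F is null-homotopic by assumption, hence so is f = π ∘ F.
  let F : S →ₗ[Bᵐᵒᵖ] Q := s.σ ∘ₗ f + s.κ ∘ₗ (k.negOnePow • h)
  have hF : ∀ x, F x = s.σ (f x) + s.κ (k.negOnePow • h x) := fun x => rfl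
  have hπ : ∀ x, π.1 (F x) = f x := fun x => by
    rw [hF, map_add, s.π_σ, s.π_κ, add_zero]
  have hρ : ∀ x, s.ρ (F x) = k.negOnePow • h x := fun x => by
    rw [hF, map_add, s.ρ_σ, s.ρ_κ, zero_add]
  have hc : IsChain k F := by
    refine ⟨fun i x hx => ?_, fun x => s.ext ?_ ?_⟩
    · have h1 := s.κ_mem _ _ (DGMod.units_smul_mem _ k.negOnePow (hh.map_mem i x hx))
      rw [show i + 1 - k - 1 = i - k by ring] at h1
      exact add_mem (s.σ_mem _ _ (hf.map_mem i x hx)) h1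
    · rw [hπ, hf.map_d]
      simp only [Units.smul_def, map_zsmul, π.2.2, hπ]
    · have h1 := s.d_ρ (F x)
      have h2 := hh.eq x
      rw [hπ, hρ] at h1
      rw [LinearMap.comp_apply] at h2
      rw [h2] at h1
      have h3 := eq_sub_of_add_eq' h1
      rw [hρ, Units.smul_def, Units.smul_def, map_zsmul, h3]
      simp only [Units.smul_def, map_zsmul]
      rw [add_sub_cancel_left]
  obtain ⟨h', hh'⟩ := H _ hc
  exact ⟨π.1 ∘ₗ h', (LinearMap.ext hπ : π.1 ∘ₗ F = f) ▸ hh'.comp π⟩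

end Splitting

end Splitting

-- Coefficients from A move across the tensor sign, so the tensors e_l ⊗ x generate N ⊗_A W
-- additively.
@[elab_as_elim]
theorem SemifreeBasis.tensor_induction {A : DGAlg.{u, v} R} {B : DGAlg.{u, v'} R}
    {N : DGMod.{u, v, w} A} (E : SemifreeBasis N) {W : DGBimod.{u, v, v', w'} A B} {p : N.tensor W → Prop}
    (t : N.tensor W) (h0 : p 0) (hb : ∀ l x, p (DGMod.tmul W (E.basis l) x))
    (hadd : ∀ s t, p s → p t → p (s + t)) : p t := by
  refine DGMod.tensor_induction t h0 ?_ hadd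
  intro x y
  refine SemifreeBasis.induction E x ?_ ?_ ?_
  · rwa [DGMod.zero_tmul]
  · intro x x' hx hx'
    rw [DGMod.add_tmul]; exact hadd _ _ hx hx'
  · intro l j b _
    rw [DGMod.smul_tmul]; exact hb _ _

/-! ### The triangle `N ⊗_A X → N ⊗_B X → N ⊗_B ΣJ ⊗_B X` -/

section Triangle

variable {A : DGAlg.{u, v} R} {B : DGAlg.{u, v'} R} (φ : DGAlgHom A B)

/-- The inclusion `ΣJ → Bᵉ`, of degree `-1`. -/
def diagVal : (suspDiag φ).toDGMod →+ (env φ).toDGMod :=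
  AddMonoidHom.mk' (fun v => ((v : (diagIdeal φ).toDGMod)).1) fun _ _ => rfl

theorem diagVal_injective : Function.Injective (diagVal φ) := fun _ _ h => Subtype.ext h

theorem diagVal_op_smul (v : (suspDiag φ).toDGMod) (b : Bᵐᵒᵖ) :
    diagVal φ (b • v) = b • diagVal φ v := rfl

theorem diagVal_smul (v : (suspDiag φ).toDGMod) (b : B) :
    diagVal φ (b • v) = B.sgn b • diagVal φ v := rfl

theorem diagVal_suspDerHom (b : B) :
    diagVal φ (suspDerHom φ b) = envTmulHom φ b 1 - envTmulHom φ 1 b := rfl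

theorem diagVal_mem {i : ℤ} {v : (suspDiag φ).toDGMod} (hv : v ∈ (suspDiag φ).gr i) :
    diagVal φ v ∈ (env φ).gr (i - 1) := hv

@[elab_as_elim]
theorem env_induction {p : (env φ).toDGMod → Prop} (t : (env φ).toDGMod) (h0 : p 0)
    (htmul : ∀ b c, p (envTmulHom φ b c)) (hadd : ∀ s t, p s → p t → p (s + t)) : p t :=
  BalTensor.induction t h0 htmul hadd

/-- The multiplication map `Bᵉ → B`, as an additive map. -/
def envProd : (env φ).toDGMod →+ B := (envMul φ).toHom.1.toAddMonoidHom

theorem envProd_tmul (b c : B) : envProd φ (envTmulHom φ b c) = b * c := rfl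

theorem envProd_diagVal (v : (suspDiag φ).toDGMod) : envProd φ (diagVal φ v) = 0 :=
  ((v : (diagIdeal φ).toDGMod)).2

/-- The tensor product Bᵉ is taken over A, so φ(a) ⊗ 1 = 1 ⊗ φ(a). This makes the connection
`connAux` linear over A and hence defined on N ⊗_A X. -/
theorem suspDerHom_map (a : A) : suspDerHom φ (φ a) = 0 := by
  refine diagVal_injective φ ?_
  rw [map_zero, diagVal_suspDerHom, sub_eq_zero]
  have h := DGBimod.smul_tmul (Y := B.regBimod.resR φ) (B.regBimod.resL φ) (1 : B) a (1 : B)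
  have h1 : (φ a * 1 : B) = φ a := mul_one _
  have h2 : (1 * φ a : B) = φ a := one_mul _
  change envTmulHom φ (1 * φ a) 1 = envTmulHom φ 1 (φ a * 1) at h
  rwa [h1, h2] at h

/-! ### The DG module N ⊗_A X and its projection to N ⊗_B X -/

variable (N : DGMod.{u, v', w} B) (X : DGBimod.{u, v', v', w'} B B)

/-- The DG module `N ⊗_A X`. -/
abbrev resTensor : DGMod.{u, v', max w w'} B := (N.res φ).tensor (X.resL φ)

/-- The pure tensor `x ⊗ t` of `N ⊗_A X`. -/
def resTmul : N →+ X.toDGMod →+ resTensor φ N X := DGMod.tmulHom (N.res φ) (X.resL φ)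

variable {N X}

theorem resTmul_smul (x : N) (a : A) (t : X.toDGMod) :
    resTmul φ N X (x <• φ a) t = resTmul φ N X x (φ a • t) :=
  DGMod.smul_tmul (M := N.res φ) (X.resL φ) x a t

theorem resTmul_op_smul (x : N) (t : X.toDGMod) (b : Bᵐᵒᵖ) :
    resTmul φ N X x (b • t) = b • resTmul φ N X x t := rfl

theorem resTmul_mem {i j k : ℤ} (h : i + j = k) {x : N} (hx : x ∈ N.gr i) {t : X.toDGMod}
    (ht : t ∈ X.gr j) : resTmul φ N X x t ∈ (resTensor φ N X).gr k :=
  DGMod.tmul_mem (M := N.res φ) (X.resL φ) h hx ht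

theorem d_resTmul (x : N) (t : X.toDGMod) : (resTensor φ N X).d (resTmul φ N X x t) =
    resTmul φ N X (N.d x) t + resTmul φ N X (N.sgn x) (X.d t) := rfl

@[elab_as_elim]
theorem resTensor_induction {p : resTensor φ N X → Prop} (t : resTensor φ N X) (h0 : p 0)
    (htmul : ∀ x t, p (resTmul φ N X x t)) (hadd : ∀ s t, p s → p t → p (s + t)) : p t :=
  BalTensor.induction t h0 htmul hadd

/-- The natural map `N ⊗_A X → N ⊗_B X`. -/
def resProj : DGHom (resTensor φ N X) (N.tensor X) :=
  DGHom.ofTensor (M := N.res φ) (X := X.resL φ) (P := N.tensor X) (DGMod.tmulHom N X)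
    (fun (x : N) a (t : X.toDGMod) => DGMod.smul_tmul X x (φ a) t)
    (fun _ _ _ => rfl) (fun _ _ _ hx _ ht => DGMod.tmul_mem X rfl hx ht) (fun _ _ => rfl)

theorem resProj_tmul (x : N) (t : X.toDGMod) :
    (resProj φ).1 (resTmul φ N X x t) = DGMod.tmul X x t := rfl

/-! ### Connection, graded section and inclusion attached to a semifree basis -/

variable (E : SemifreeBasis N)

/-- The correction term in the Leibniz rule `connAux_smul` contains δ of the scalar, which is zero
on φ(A). -/
theorem connAux_map_smul (x : N) (a : A) : connAux φ E (x <• φ a) = connAux φ E x <• φ a := by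
  rw [connAux_smul, suspDerHom_map, DGMod.tmul_zero, add_zero]

theorem connAux_sgn (x : N) :
    connAux φ E (N.sgn x) = -(N.tensor (suspDiag φ)).sgn (connAux φ E x) := by
  refine hom_induction N.isInternal x (by simp) ?_ ?_
  · intro x y hx hy
    simp only [map_add, hx, hy, neg_add]
  · intro i x hx
    rw [N.sgn_of_mem hx, DGMod.sgn_of_mem _ (connAux_mem φ E hx), Int.negOnePow_succ]
    simp only [Units.smul_def, map_zsmul, Units.val_neg, neg_smul, neg_neg]

/-- The biadditive map `(x, t) ↦ connAux x ⊗ t`. -/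
def connTensorAux : N →+ X.toDGMod →+ N.tensor ((suspDiag φ).tensor X) :=
  (assocAux N (suspDiag φ) X).comp (connAux φ E)

/-- The map `x ⊗ t ↦ connAux x ⊗ t`. -/
def connTensor : resTensor φ N X →ₗ[Bᵐᵒᵖ] N.tensor ((suspDiag φ).tensor X) where
  toFun := DGMod.lift (M := N.res φ) (X := X.resL φ) (connTensorAux φ E)
    (fun (x : N) a (t : X.toDGMod) => by
      change (DGHom.assoc N (suspDiag φ) X).1 (DGMod.tmul X (connAux φ E (x <• φ a)) t) =
        (DGHom.assoc N (suspDiag φ) X).1 (DGMod.tmul X (connAux φ E x) (φ a • t))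
      rw [connAux_map_smul, DGMod.smul_tmul])
  map_add' := map_add _
  map_smul' b t := by
    refine resTensor_induction φ t ?_ ?_ ?_
    · simp
    · exact fun x t => map_smul (DGHom.assoc N (suspDiag φ) X).1 b
        (DGMod.tmul X (connAux φ E x) t)
    · intro s t hs ht
      simp only [smul_add, map_add, hs, ht]

theorem connTensor_tmul (x : N) (t : X.toDGMod) : connTensor φ E (resTmul φ N X x t) =
    (DGHom.assoc N (suspDiag φ) X).1 (DGMod.tmul X (connAux φ E x) t) := rfl

theorem connTensor_mem (i : ℤ) (x : resTensor φ N X) (hx : x ∈ (resTensor φ N X).gr i) :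
    connTensor φ E x ∈ (N.tensor ((suspDiag φ).tensor X)).gr (i + 1) := by
  refine DGMod.gr_induction (M := N.res φ) (X := X.resL φ)
    (connTensor φ E (X := X)).toAddMonoidHom
    (fun k => (N.tensor ((suspDiag φ).tensor X)).gr (k + 1)) ?_ i x hx
  intro i j x hx t ht
  exact (DGHom.assoc N (suspDiag φ) X).2.1 _ _
    (DGMod.tmul_mem X (by ring) (connAux_mem φ E hx) ht)

/-- Writing ∇ for `connAux`, the Atiyah map is ∂∇ + ∇∂ by `atiyahLin_eq`. Since ∇ has degree 1, the
two terms in which ∂ hits the factor X cancel (`connAux_sgn`). So ∇ ⊗ X is a null homotopy of the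
composite N ⊗_A X → N ⊗_B X → N ⊗_B ΣJ ⊗_B X. -/
theorem d_connTensor (x : resTensor φ N X) :
    (N.tensor ((suspDiag φ).tensor X)).d (connTensor φ E x) +
      connTensor φ E ((resTensor φ N X).d x) =
    (DGHom.comp (DGHom.assoc N (suspDiag φ) X) (DGHom.rTensor (atiyah φ E) X)).1
      ((resProj φ).1 x) := by
  refine resTensor_induction φ x ?_ ?_ ?_
  · simp
  · intro x t
    have h : (DGHom.comp (DGHom.assoc N (suspDiag φ) X) (DGHom.rTensor (atiyah φ E) X)).1
      ((resProj φ).1 (resTmul φ N X x t)) =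
        (DGHom.assoc N (suspDiag φ) X).1 (DGMod.tmul X (atiyahLin φ E x) t) := rfl
    rw [h, d_resTmul, map_add, connTensor_tmul, connTensor_tmul, connTensor_tmul,
      ← (DGHom.assoc N (suspDiag φ) X).2.2, ← map_add, ← map_add, DGMod.d_tmul, atiyahLin_eq,
      connAux_sgn, DGMod.add_tmul, ← DGMod.tmulHom_apply _ (-_), map_neg,
      AddMonoidHom.neg_apply, DGMod.tmulHom_apply]
    congr 1
    abel
  · intro s t hs ht
    simp only [map_add, ← hs, ← ht]
    abel

/-- The additive map `x ↦ (t ↦ ∑ e_λ ⊗ b_λ t)`, where `x = ∑ e_λ b_λ`. -/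
def sectAux : N →+ X.toDGMod →+ resTensor φ N X :=
  (Finsupp.liftAddHom fun l => ((AddMonoidHom.compHom (resTmul φ N X (E.basis l))).comp
    (smulAddHom B X.toDGMod)).comp (opAddEquiv (α := B)).symm.toAddMonoidHom).comp
      E.basis.repr.toLinearMap.toAddMonoidHom

theorem sectAux_basis (l : E.ι) (b : B) (t : X.toDGMod) :
    sectAux φ E (E.basis l <• b) t = resTmul φ N X (E.basis l) (b • t) := by
  refine DFunLike.congr_fun (f := sectAux φ E (E.basis l <• b))
    (g := (AddMonoidHom.compHom (resTmul φ N X (E.basis l))).comp (smulAddHom B X.toDGMod) b) ?_ t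
  change Finsupp.liftAddHom _ (E.basis.repr (E.basis l <• b)) = _
  rw [map_smul, Module.Basis.repr_self, Finsupp.smul_single, Finsupp.liftAddHom_apply_single,
    smul_eq_mul, mul_one]
  rfl

theorem sectAux_smul (x : N) (c : B) (t : X.toDGMod) :
    sectAux φ E (x <• c) t = sectAux φ E x (c • t) := by
  refine SemifreeBasis.induction E x ?_ ?_ ?_
  · rw [smul_zero, map_zero]; rfl
  · intro x y hx hy
    rw [smul_add, map_add, map_add, AddMonoidHom.add_apply, AddMonoidHom.add_apply, hx, hy]
  · intro m j b hb
    rw [smul_smul, ← op_mul, sectAux_basis, sectAux_basis, mul_smul]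

theorem sectAux_op_smul (x : N) (t : X.toDGMod) (c : Bᵐᵒᵖ) :
    sectAux φ E x (c • t) = c • sectAux φ E x t := by
  refine SemifreeBasis.induction E x ?_ ?_ ?_
  · rw [map_zero]; exact (smul_zero c).symm
  · intro x y hx hy
    rw [map_add, AddMonoidHom.add_apply, AddMonoidHom.add_apply, hx, hy, smul_add]
  · intro m j b hb
    rw [sectAux_basis, sectAux_basis, smul_comm b c, resTmul_op_smul]

/-- Both sides of `key` are additive in x, so compatibility with the projections to homogeneous
components need only be checked on e_m b with b homogeneous; membership follows from it. -/
theorem sectAux_mem (i j : ℤ) (x : N) (hx : x ∈ N.gr i) (t : X.toDGMod) (ht : t ∈ X.gr j) :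
    sectAux φ E x t ∈ (resTensor φ N X).gr (i + j) := by
  have key : ∀ x : N, sectAux φ E (N.proj i x) t =
      (resTensor φ N X).proj (i + j) (sectAux φ E x t) := by
    intro x
    refine SemifreeBasis.induction E x ?_ ?_ ?_
    · simp
    · intro x y hx hy
      simp only [map_add, AddMonoidHom.add_apply, hx, hy]
    · intro m l b hb
      have h1 := N.smul_mem (E.mem_gr m) hb
      have h2 : sectAux φ E (E.basis m <• b) t ∈ (resTensor φ N X).gr (E.deg m + l + j) := by
        rw [sectAux_basis]
        exact resTmul_mem φ (add_assoc _ _ _).symm (E.mem_gr m) (X.lsmul_mem hb ht)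
      by_cases h : E.deg m + l = i
      · subst h
        rw [N.proj_same h1, DGMod.proj_same _ h2]
      · rw [N.proj_ne h h1, DGMod.proj_ne _ (by omega) h2, map_zero, AddMonoidHom.zero_apply]
  rw [← N.proj_same hx, key]
  exact DGMod.proj_mem _ _ _

/-- The graded section `e_λ b ⊗ t ↦ e_λ ⊗ b t` of `N ⊗_A X → N ⊗_B X`. -/
def sect : N.tensor X →ₗ[Bᵐᵒᵖ] resTensor φ N X where
  toFun := DGMod.lift (sectAux φ E) (sectAux_smul φ E)
  map_add' := map_add _
  map_smul' b t := by
    refine DGMod.tensor_induction t ?_ ?_ ?_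
    · simp
    · exact fun x t => sectAux_op_smul φ E x t b
    · intro s t hs ht
      simp only [smul_add, map_add, hs, ht]

theorem sect_tmul (x : N) (t : X.toDGMod) : sect φ E (DGMod.tmul X x t) = sectAux φ E x t := rfl

theorem sect_mem (i : ℤ) (x : N.tensor X) (hx : x ∈ (N.tensor X).gr i) :
    sect φ E x ∈ (resTensor φ N X).gr i :=
  DGMod.gr_induction (sect φ E (X := X)).toAddMonoidHom (resTensor φ N X).gr
    (fun i j x hx t ht => sectAux_mem φ E i j x hx t ht) i x hx

/-- The universal property of `Bᵉ = B ⊗_A B`. -/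
def envLift {P : Type*} [AddCommGroup P] (f : B →+ B →+ P)
    (hf : ∀ b (a : A) c, f (b * φ a) c = f b (φ a * c)) : (env φ).toDGMod →+ P :=
  DGMod.lift (M := B.reg.res φ) (X := B.regBimod.resL φ) f hf

variable (X) in
/-- The biadditive map `(b, c) ↦ (t ↦ x b ⊗ c t)`. -/
def envActAux (x : N) : B →+ B →+ X.toDGMod →+ resTensor φ N X :=
  AddMonoidHom.mk' (fun b => (AddMonoidHom.compHom (resTmul φ N X (x <• b))).comp
    (smulAddHom B X.toDGMod)) fun b b' => by
      ext c t
      change resTmul φ N X (x <• (b + b')) (c • t) =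
        resTmul φ N X (x <• b) (c • t) + resTmul φ N X (x <• b') (c • t)
      rw [op_add, add_smul, map_add, AddMonoidHom.add_apply]

theorem envActAux_apply (x : N) (b c : B) (t : X.toDGMod) :
    envActAux φ X x b c t = resTmul φ N X (x <• b) (c • t) := rfl

variable (N X) in
/-- The triadditive map `(x, b ⊗ c, t) ↦ x b ⊗ c t`. -/
def envAct : N →+ (env φ).toDGMod →+ X.toDGMod →+ resTensor φ N X :=
  AddMonoidHom.mk' (fun x => envLift φ (envActAux φ X x) fun b a c => by
      ext t
      rw [envActAux_apply, envActAux_apply, op_mul, mul_smul, resTmul_smul, mul_smul])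
    fun x x' => by
      refine AddMonoidHom.ext fun s => ?_
      refine env_induction φ s ?_ ?_ ?_
      · rw [map_zero, map_zero]
      · intro b c
        refine AddMonoidHom.ext fun t => ?_
        change envActAux φ X (x + x') b c t = envActAux φ X x b c t + envActAux φ X x' b c t
        rw [envActAux_apply, envActAux_apply, envActAux_apply, smul_add, map_add,
          AddMonoidHom.add_apply]
      · intro s s' hs hs'
        rw [map_add, map_add, hs, hs']

theorem envAct_tmul (x : N) (b c : B) (t : X.toDGMod) :
    envAct φ N X x (envTmulHom φ b c) t = resTmul φ N X (x <• b) (c • t) := rfl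

theorem op_smul_envTmul (b c d : B) : envTmulHom φ b c <• d = envTmulHom φ b (c * d) := rfl

theorem smul_envTmul (b c d : B) : d • envTmulHom φ b c = envTmulHom φ (d * b) c := rfl

theorem envAct_smul (x : N) (c : B) (s : (env φ).toDGMod) (t : X.toDGMod) :
    envAct φ N X (x <• c) s t = envAct φ N X x (c • s) t := by
  refine env_induction φ s ?_ ?_ ?_
  · rw [smul_zero, map_zero, map_zero]
  · intro b d
    rw [smul_envTmul, envAct_tmul, envAct_tmul, op_mul, mul_smul]
  · intro s s' hs hs'
    rw [smul_add, map_add, map_add, AddMonoidHom.add_apply, AddMonoidHom.add_apply, hs, hs']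

theorem envAct_op_smul (x : N) (c : B) (s : (env φ).toDGMod) (t : X.toDGMod) :
    envAct φ N X x (s <• c) t = envAct φ N X x s (c • t) := by
  refine env_induction φ s ?_ ?_ ?_
  · rw [smul_zero, map_zero, AddMonoidHom.zero_apply, AddMonoidHom.zero_apply]
  · intro b d
    rw [op_smul_envTmul, envAct_tmul, envAct_tmul, mul_smul]
  · intro s s' hs hs'
    rw [smul_add, map_add, map_add, AddMonoidHom.add_apply, AddMonoidHom.add_apply, hs, hs']

theorem envAct_linear (x : N) (s : (env φ).toDGMod) (t : X.toDGMod) (b : Bᵐᵒᵖ) :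
    envAct φ N X x s (b • t) = b • envAct φ N X x s t := by
  refine env_induction φ s ?_ ?_ ?_
  · rw [map_zero]; exact (smul_zero b).symm
  · intro c d
    rw [envAct_tmul, envAct_tmul, smul_comm d b, resTmul_op_smul]
  · intro s s' hs hs'
    rw [map_add, AddMonoidHom.add_apply, AddMonoidHom.add_apply, hs, hs', smul_add]

theorem envAct_mem (i j l : ℤ) (x : N) (hx : x ∈ N.gr i) (s : (env φ).toDGMod)
    (hs : s ∈ (env φ).gr j) (t : X.toDGMod) (ht : t ∈ X.gr l) :
    envAct φ N X x s t ∈ (resTensor φ N X).gr (i + j + l) := by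
  refine DGMod.gr_induction (M := B.reg.res φ) (X := B.regBimod.resL φ)
    ((envAct φ N X x).flip t) (fun j => (resTensor φ N X).gr (i + j + l)) ?_ j s hs
  intro j k b hb c hc
  exact resTmul_mem φ (by ring) (N.smul_mem hx hb) (X.lsmul_mem hc ht)

/-- Over B the middle factor Bᵉ is multiplied out. On J the product is zero, which gives π ∘ κ = 0
in `atiyahSplitting`. -/
theorem resProj_envAct (x : N) (s : (env φ).toDGMod) (t : X.toDGMod) :
    (resProj φ).1 (envAct φ N X x s t) =
      DGMod.tmul X (x <• envProd φ s) t := by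
  refine env_induction φ s ?_ ?_ ?_
  · rw [map_zero, map_zero, AddMonoidHom.zero_apply, map_zero, op_zero, zero_smul,
      DGMod.zero_tmul]
  · intro b c
    rw [envAct_tmul, resProj_tmul, ← DGMod.smul_tmul, smul_smul, ← op_mul, envProd_tmul]
  · intro s s' hs hs'
    rw [map_add, AddMonoidHom.add_apply, map_add, hs, hs', ← DGMod.add_tmul, ← add_smul, ← op_add,
      map_add]

/-- The projection `b ⊗ c ↦ Σδ(b) c` of `Bᵉ` to `ΣJ`. -/
def envDer : (env φ).toDGMod →+ (suspDiag φ).toDGMod :=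
  envLift φ (AddMonoidHom.mk' (fun b => AddMonoidHom.mk' (fun c => suspDerHom φ b <• c)
      fun c c' => by rw [op_add, add_smul])
    fun b b' => by
      ext c
      change suspDerHom φ (b + b') <• c = suspDerHom φ b <• c + suspDerHom φ b' <• c
      rw [map_add, smul_add]) fun b a c => by
        change suspDerHom φ (b * φ a) <• c = suspDerHom φ b <• (φ a * c)
        rw [suspDerHom_mul, suspDerHom_map, smul_zero, add_zero, smul_smul, op_mul]

theorem envDer_tmul (b c : B) : envDer φ (envTmulHom φ b c) = suspDerHom φ b <• c := rfl

/-- For s = b ⊗ c this reads δ(b)c = b ⊗ c − 1 ⊗ bc. So `envDer` is the projection of Bᵉ to J along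
the complement 1 ⊗ B. -/
theorem diagVal_envDer (s : (env φ).toDGMod) :
    diagVal φ (envDer φ s) = s - envTmulHom φ 1 (envProd φ s) := by
  refine env_induction φ s ?_ ?_ ?_
  · simp only [map_zero, sub_zero]
  · intro b c
    rw [envDer_tmul, diagVal_op_smul, diagVal_suspDerHom, smul_sub, op_smul_envTmul,
      op_smul_envTmul, one_mul, envProd_tmul]
  · intro s s' hs hs'
    rw [map_add, map_add, map_add, hs, hs', map_add, add_sub_add_comm]

theorem envDer_diagVal (v : (suspDiag φ).toDGMod) : envDer φ (diagVal φ v) = v := by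
  refine diagVal_injective φ ?_
  rw [diagVal_envDer, envProd_diagVal, map_zero, sub_zero]

/-- Because ∇(e_l b) = ± e_l ⊗ Σδ(b), at a basis element the connection acts on the factor Bᵉ as the
projection `envDer`. As `envDer` is the identity on J, this yields ρ ∘ κ = id in `atiyahSplitting`.
-/
theorem connTensor_envAct (l : E.ι) (s : (env φ).toDGMod) (t : X.toDGMod) :
    connTensor φ E (envAct φ N X (E.basis l) s t) = (E.deg l).negOnePow •
      DGMod.tmul ((suspDiag φ).tensor X) (E.basis l) (DGBimod.tmul X (envDer φ s) t) := by
  rw [← DGHom.assoc_tmul]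
  refine env_induction φ s ?_ ?_ ?_
  · rw [map_zero, map_zero, AddMonoidHom.zero_apply, map_zero, DGMod.tmul_zero, DGMod.zero_tmul,
      map_zero, smul_zero]
  · intro b c
    rw [envAct_tmul, connTensor_tmul, connAux_basis, envDer_tmul, ← DGMod.op_smul_tmul,
      ← DGMod.smul_tmul, Units.smul_def, smul_comm (op c), ← Units.smul_def,
      DGMod.units_smul_tmul, Units.smul_def, map_zsmul, ← Units.smul_def]
  · intro s s' hs hs'
    rw [map_add, AddMonoidHom.add_apply, map_add, hs, hs', map_add, DGMod.tmul_add,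
      DGMod.add_tmul, map_add, smul_add]

variable (N X) in
/-- The map `x ⊗ (v ⊗ t) ↦ (-1)^{|x|} x v t`, where `v ∈ ΣJ` acts as an element of `Bᵉ`. -/
def inclAux : N →+ ((suspDiag φ).tensor X).toDGMod →+ resTensor φ N X :=
  AddMonoidHom.mk' (fun x => DGMod.lift (M := (suspDiag φ).toDGMod) (X := X)
      ((envAct φ N X (N.sgn x)).comp (diagVal φ))
      fun v b t => envAct_op_smul φ (N.sgn x) b (diagVal φ v) t) fun x x' => by
    refine AddMonoidHom.ext fun s => ?_
    refine DGBimod.tensor_induction s ?_ ?_ ?_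
    · exact (map_zero _).trans (map_zero _).symm
    · intro v t
      change envAct φ N X (N.sgn (x + x')) (diagVal φ v) t =
        envAct φ N X (N.sgn x) (diagVal φ v) t + envAct φ N X (N.sgn x') (diagVal φ v) t
      rw [map_add, map_add, AddMonoidHom.add_apply, AddMonoidHom.add_apply]
    · intro s s' hs hs'
      exact (map_add _ _ _).trans ((congrArg₂ (· + ·) hs hs').trans (map_add _ _ _).symm)

theorem inclAux_tmul (x : N) (v : (suspDiag φ).toDGMod) (t : X.toDGMod) :
    inclAux φ N X x (DGBimod.tmul X v t) = envAct φ N X (N.sgn x) (diagVal φ v) t := rfl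

variable (N X) in
/-- The inclusion `x ⊗ (v ⊗ t) ↦ (-1)^{|x|} x v t` of `N ⊗_B ΣJ ⊗_B X` into `N ⊗_A X`. -/
def incl : N.tensor ((suspDiag φ).tensor X) →ₗ[Bᵐᵒᵖ] resTensor φ N X where
  toFun := DGMod.lift (inclAux φ N X) fun x b s => by
    refine DGBimod.tensor_induction s ?_ ?_ ?_
    · rw [smul_zero, map_zero, map_zero]
    · intro v t
      rw [DGBimod.smul_tmul', inclAux_tmul, inclAux_tmul, N.sgn_smul, envAct_smul, diagVal_smul]
    · intro s s' hs hs'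
      rw [smul_add, map_add, map_add, hs, hs']
  map_add' := map_add _
  map_smul' b t := by
    refine DGMod.tensor_induction t ?_ ?_ ?_
    · simp
    · intro x s
      refine DGBimod.tensor_induction s ?_ ?_ ?_
      · rw [DGMod.tmul_zero, smul_zero, map_zero, smul_zero]
      · intro v t
        exact envAct_linear φ (N.sgn x) (diagVal φ v) t b
      · intro s s' hs hs'
        rw [DGMod.tmul_add, smul_add, map_add, map_add, hs, hs', smul_add]
    · intro s t hs ht
      simp only [smul_add, map_add, hs, ht]

theorem incl_tmul (x : N) (v : (suspDiag φ).toDGMod) (t : X.toDGMod) :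
    incl φ N X (DGMod.tmul ((suspDiag φ).tensor X) x (DGBimod.tmul X v t)) =
      envAct φ N X (N.sgn x) (diagVal φ v) t := rfl

theorem incl_mem (i : ℤ) (x : N.tensor ((suspDiag φ).tensor X))
    (hx : x ∈ (N.tensor ((suspDiag φ).tensor X)).gr i) :
    incl φ N X x ∈ (resTensor φ N X).gr (i - 1) := by
  refine DGMod.gr_induction (incl φ N X).toAddMonoidHom
    (fun i => (resTensor φ N X).gr (i - 1)) ?_ i x hx
  intro i j x hx s hs
  refine DGMod.gr_induction (M := (suspDiag φ).toDGMod) (X := X) (inclAux φ N X x)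
    (fun j => (resTensor φ N X).gr (i + j - 1)) ?_ j s hs
  intro j k v hv t ht
  have h := envAct_mem φ i (j - 1) k (N.sgn x) (by
    rw [N.sgn_of_mem hx]; exact DGMod.units_smul_mem _ _ hx) _ (diagVal_mem φ hv) t ht
  rwa [show i + (j - 1) + k = i + (j + k) - 1 by ring] at h

variable (X) in
/-- The exact triangle `N ⊗_A X → N ⊗_B X → N ⊗_B ΣJ ⊗_B X`, whose second map is the Atiyah class
of `N` tensored with `X`. -/
def atiyahSplitting : Splitting (resProj φ (N := N) (X := X))
    (DGHom.comp (DGHom.assoc N (suspDiag φ) X) (DGHom.rTensor (atiyah φ E) X)) where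
  ρ := connTensor φ E
  σ := sect φ E
  κ := incl φ N X
  ρ_mem := connTensor_mem φ E
  σ_mem := sect_mem φ E
  κ_mem := incl_mem φ
  d_ρ := d_connTensor φ E
  π_σ y := by
    refine SemifreeBasis.tensor_induction E y ?_ ?_ ?_
    · simp
    · intro l t
      have h := sectAux_basis φ E (X := X) l 1 t
      rw [op_one, one_smul, one_smul] at h
      rw [sect_tmul, h, resProj_tmul]
    · intro s t hs ht
      rw [map_add, map_add, hs, ht]
  ρ_σ y := by
    refine SemifreeBasis.tensor_induction E y ?_ ?_ ?_
    · simp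
    · intro l t
      have h := sectAux_basis φ E (X := X) l 1 t
      rw [op_one, one_smul, one_smul] at h
      -- The basis element equals e_l φ(1), and δ(φ(1)) = 0: the connection vanishes on the basis.
      have h1 : connAux φ E (E.basis l) = 0 := by
        have h2 := connAux_map_smul φ E (E.basis l) 1
        have h3 := connAux_basis φ E l (φ 1)
        rw [suspDerHom_map, DGMod.tmul_zero, smul_zero, connAux_map_smul] at h3
        rwa [map_one, op_one, one_smul] at h3
      rw [sect_tmul, h, connTensor_tmul, h1, DGMod.zero_tmul, map_zero]
    · intro s t hs ht
      rw [map_add, map_add, hs, ht, add_zero]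
  π_κ z := by
    refine DGMod.tensor_induction z ?_ ?_ ?_
    · simp
    · intro x s
      refine DGBimod.tensor_induction s ?_ ?_ ?_
      · rw [DGMod.tmul_zero, map_zero, map_zero]
      · intro v t
        rw [incl_tmul, resProj_envAct, envProd_diagVal, op_zero, zero_smul, DGMod.zero_tmul]
      · intro s s' hs hs'
        rw [DGMod.tmul_add, map_add, map_add, hs, hs', add_zero]
    · intro s t hs ht
      rw [map_add, map_add, hs, ht, add_zero]
  ρ_κ z := by
    -- The map ρ is explicit only at basis elements, hence the reduction to e_l ⊗ (v ⊗ t). The sign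
    -- in `incl` cancels the sign in `connAux`.
    refine SemifreeBasis.tensor_induction E z ?_ ?_ ?_
    · simp
    · intro l s
      refine DGBimod.tensor_induction s ?_ ?_ ?_
      · rw [DGMod.tmul_zero, map_zero, map_zero]
      · intro v t
        rw [incl_tmul, N.sgn_of_mem (E.mem_gr l)]
        simp only [Units.smul_def, map_zsmul, AddMonoidHom.coe_smul, Pi.smul_apply]
        rw [connTensor_envAct, envDer_diagVal, ← Units.smul_def, smul_smul, Int.units_mul_self,
          one_smul]
      · intro s s' hs hs'
        rw [DGMod.tmul_add, map_add, map_add, hs, hs']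
    · intro s t hs ht
      rw [map_add, map_add, hs, ht]
  decomp x := by
    refine resTensor_induction φ x ?_ ?_ ?_
    · simp
    · intro x t
      refine SemifreeBasis.induction E x ?_ ?_ ?_
      · simp
      · intro x x' hx hx'
        simp only [map_add, AddMonoidHom.add_apply]
        rw [add_add_add_comm, hx, hx']
      · intro l j b hb
        -- At e_l b ⊗ t, the map σπ gives e_l ⊗ bt, and κρ gives e_l b ⊗ t − e_l ⊗ bt because δ(b) =
        -- b ⊗ 1 − 1 ⊗ b.
        rw [resProj_tmul, sect_tmul, sectAux_basis, connTensor_tmul, connAux_basis,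
          DGMod.units_smul_tmul]
        simp only [Units.smul_def, map_zsmul]
        rw [DGHom.assoc_tmul, incl_tmul, N.sgn_of_mem (E.mem_gr l)]
        simp only [Units.smul_def, map_zsmul, AddMonoidHom.coe_smul, Pi.smul_apply]
        rw [smul_smul, ← Units.val_mul, Int.units_mul_self, Units.val_one, one_smul,
          diagVal_suspDerHom, map_sub, AddMonoidHom.sub_apply, envAct_tmul, envAct_tmul, op_one,
          one_smul, one_smul, add_sub_cancel]
    · intro s t hs ht
      simp only [map_add]
      rw [add_add_add_comm, hs, ht]

end Triangle

/-! ### Semifree DG modules -/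

/-- The condition at l sees only the values below l (`hQ`). So well-founded recursion can choose g
l, with the values not yet constructed filled in by the default. -/
theorem exists_wellFounded_choice {ι α : Type*} [LinearOrder ι] [WellFoundedLT ι] [Inhabited α]
    (Q : ι → (ι → α) → α → Prop)
    (hQ : ∀ l g g' x, (∀ m < l, g m = g' m) → Q l g x → Q l g' x)
    (H : ∀ l g, (∀ m < l, Q m g (g m)) → ∃ x, Q l g x) : ∃ g, ∀ l, Q l g (g l) := by
  classical
  let step : ∀ l, (∀ m, m < l → α) → α := fun l r =>
    if h : ∃ x, Q l (fun m => if hm : m < l then r m hm else default) x then h.choose else default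
  let g : ι → α := (wellFounded_lt (α := ι)).fix step
  have hg : ∀ l, g l = step l fun m _ => g m := fun l => WellFounded.fix_eq _ _ _
  refine ⟨g, fun l => ?_⟩
  induction l using WellFoundedLT.induction with
  | ind l ih =>
    have e : ∀ m < l, g m = if m < l then g m else default := fun m hm => (if_pos hm).symm
    obtain ⟨x, hx⟩ := H l g ih
    have h : ∃ x, Q l (fun m => if m < l then g m else default) x := ⟨x, hQ l _ _ x e hx⟩
    rw [hg l]
    refine hQ l _ _ _ (fun m hm => (e m hm).symm) ?_
    have h' : step l (fun m _ => g m) = h.choose := dif_pos h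
    rw [h']
    exact h.choose_spec

section Semifree

variable {A : DGAlg.{u, v} R} {M : DGMod.{u, v, w} A} {P : DGMod.{u, v, w'} A}

/-- The axioms of a semifree basis, for a basis with an index set in an arbitrary universe. -/
structure IsSemifreeBasis {ι : Type*} [LinearOrder ι] (b : Module.Basis ι Aᵐᵒᵖ M) (deg : ι → ℤ) :
    Prop where
  mem_gr : ∀ i, b i ∈ M.gr (deg i)
  d_mem : ∀ i, M.d (b i) ∈ Submodule.span Aᵐᵒᵖ (b '' Set.Iio i)

@[elab_as_elim]
theorem basis_induction {ι : Type*} (b : Module.Basis ι Aᵐᵒᵖ M) {p : M → Prop} (x : M) (h0 : p 0)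
    (hadd : ∀ x y, p x → p y → p (x + y))
    (hb : ∀ m j, ∀ a ∈ A.gr j, p (b m <• a)) : p x := by
  obtain ⟨f, rfl⟩ := b.repr.symm.surjective x
  induction f using Finsupp.induction_linear with
  | zero => rw [map_zero]; exact h0
  | add f g hf hg => rw [map_add]; exact hadd _ _ hf hg
  | single m a =>
    rw [Module.Basis.repr_symm_single]
    refine hom_induction A.isInternal' (p := fun c => p (b m <• c)) a.unop ?_ ?_ ?_
    · rw [op_zero, zero_smul]; exact h0
    · intro c c' hc hc'
      rw [op_add, add_smul]; exact hadd _ _ hc hc'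
    · exact fun j c hc => hb m j c hc

/-- A linear map which is homogeneous on a homogeneous basis is homogeneous. -/
theorem map_mem_of_basis {ι : Type*} (b : Module.Basis ι Aᵐᵒᵖ M) {deg : ι → ℤ}
    (hb : ∀ i, b i ∈ M.gr (deg i)) (k : ℤ) (f : M →ₗ[Aᵐᵒᵖ] P)
    (hf : ∀ i, f (b i) ∈ P.gr (deg i + k)) (i : ℤ) (x : M) (hx : x ∈ M.gr i) :
    f x ∈ P.gr (i + k) := by
  have key : f (M.proj i x) = P.proj (i + k) (f x) := by
    refine basis_induction b x (by simp) ?_ ?_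
    · intro x y hx hy
      simp only [map_add, hx, hy]
    · intro m j a ha
      have h1 := M.smul_mem (hb m) ha
      have h2 : f (b m <• a) ∈ P.gr (deg m + j + k) := by
        rw [map_smul, show deg m + j + k = deg m + k + j by ring]
        exact P.smul_mem (hf m) ha
      by_cases h : deg m + j = i
      · subst h
        rw [M.proj_same h1, P.proj_same h2]
      · rw [M.proj_ne h h1, P.proj_ne (by omega) h2, map_zero]
  rw [← M.proj_same hx, key]
  exact P.proj_mem _ _

theorem map_sgn_of_map_mem {k : ℤ} {f : M →ₗ[Aᵐᵒᵖ] P}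
    (hf : ∀ i, ∀ x ∈ M.gr i, f x ∈ P.gr (i + k)) (x : M) :
    f (M.sgn x) = k.negOnePow • P.sgn (f x) := by
  refine hom_induction M.isInternal x (by simp) ?_ ?_
  · intro x y hx hy
    simp only [map_add, hx, hy, smul_add]
  · intro i x hx
    rw [M.sgn_of_mem hx, P.sgn_of_mem (hf i x hx), smul_smul, ← Int.negOnePow_add, Units.smul_def,
      map_zsmul, ← Units.smul_def, show k + (i + k) = i + 2 * k by ring, Int.negOnePow_add,
      Int.negOnePow_two_mul, mul_one]

/-- The graded commutator `∂ f - (-1)^k f ∂` of a linear map of degree `k` with the differential. -/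
def gradedComm (k : ℤ) (f : M →ₗ[Aᵐᵒᵖ] P) (hf : ∀ i, ∀ x ∈ M.gr i, f x ∈ P.gr (i + k)) :
    M →ₗ[Aᵐᵒᵖ] P where
  toFun x := P.d (f x) - k.negOnePow • f (M.d x)
  map_add' x y := by
    simp only [map_add, smul_add]
    abel
  map_smul' a x := by
    obtain ⟨a, rfl⟩ := op_surjective a
    rw [RingHom.id_apply, M.leibniz_sgn, map_add, f.map_smul, f.map_smul, f.map_smul,
      P.leibniz_sgn, map_sgn_of_map_mem hf, smul_sub]
    obtain e | e := Int.units_eq_one_or k.negOnePow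
    · simp only [e, one_smul]; abel
    · simp only [e, Units.smul_def, Units.val_neg, Units.val_one, neg_smul, one_smul, smul_neg,
        smul_add]
      abel

theorem gradedComm_apply (k : ℤ) (f : M →ₗ[Aᵐᵒᵖ] P)
    (hf : ∀ i, ∀ x ∈ M.gr i, f x ∈ P.gr (i + k)) (x : M) :
    gradedComm k f hf x = P.d (f x) - k.negOnePow • f (M.d x) := rfl

/-- Injectivity in homology in degree i − 1 gives some x with ∂x = a, and surjectivity in degree i
corrects x by a cycle until p x agrees with m up to a boundary. This is the extension step over one
basis element in `exists_homotopy_section`. -/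
theorem IsQuasiIso.exists_preimage {p : DGHom P M} (hp : DGHom.IsQuasiIso p) {i : ℤ} {a : P}
    (ha : a ∈ P.gr (i - 1)) (hda : P.d a = 0) {m : M} (hm : m ∈ M.gr i) (hma : p.1 a = M.d m) :
    ∃ x ∈ P.gr i, ∃ z ∈ M.gr (i + 1), P.d x = a ∧ p.1 x = m + M.d z := by
  have h1 : (QuotientAddGroup.mk ⟨a, ha, hda⟩ : P.homology (i - 1)) = 0 := by
    refine (hp (i - 1)).1 ?_
    rw [map_zero]
    refine (QuotientAddGroup.eq_zero_iff _).2 ⟨m, ?_, hma.symm⟩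
    rw [sub_add_cancel]; exact hm
  obtain ⟨x, hx, hxa⟩ := (QuotientAddGroup.eq_zero_iff _).1 h1
  replace hxa : P.d x = a := hxa
  replace hx : x ∈ P.gr i := by
    have h : x ∈ P.gr (i - 1 + 1) := hx
    rwa [sub_add_cancel] at h
  have hc0 : M.d (m - p.1 x) = 0 := by
    rw [map_sub, ← p.2.2, hxa, hma, sub_self]
  have hc : m - p.1 x ∈ M.cycles i := ⟨(M.gr i).sub_mem hm (p.2.1 _ _ hx), hc0⟩
  obtain ⟨y, hy⟩ := (hp i).2 (QuotientAddGroup.mk ⟨_, hc⟩)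
  obtain ⟨y, rfl⟩ := QuotientAddGroup.mk_surjective y
  obtain ⟨z, hz, hzy⟩ := (QuotientAddGroup.eq_iff_sub_mem (N := M.boundaries i)).1 hy
  replace hzy : M.d z = p.1 y.1 - (m - p.1 x) := hzy
  have hy0 : P.d y.1 = 0 := y.2.2
  refine ⟨x + y.1, add_mem hx y.2.1, z, hz, ?_, ?_⟩
  · rw [map_add, hxa, hy0, add_zero]
  · rw [map_add, hzy]; abel

/-- A quasiisomorphism to a semifree DG module has a section up to homotopy. -/
theorem exists_homotopy_section {ι : Type*} [LinearOrder ι] [WellFoundedLT ι]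
    {b : Module.Basis ι Aᵐᵒᵖ M} {deg : ι → ℤ} (hb : IsSemifreeBasis b deg)
    {p : DGHom P M} (hp : DGHom.IsQuasiIso p) :
    ∃ (s : DGHom M P) (h : M →ₗ[Aᵐᵒᵖ] M), IsNullHomotopy (p.1 ∘ₗ s.1 - LinearMap.id) h := by
  classical
  -- A value at l is a pair, the images of b l under the section s and under the homotopy h. They
  -- must be constructed together, since the choice of s at b l depends on h at earlier basis
  -- elements.
  let _ : Inhabited (P × M) := ⟨0⟩
  let S : (ι → P × M) → (M →ₗ[Aᵐᵒᵖ] P) := fun g => b.constr ℕ fun l => (g l).1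
  let T : (ι → P × M) → (M →ₗ[Aᵐᵒᵖ] M) := fun g => b.constr ℕ fun l => (g l).2
  have hS : ∀ g l, S g (b l) = (g l).1 := fun g l => b.constr_basis _ _ _
  have hT : ∀ g l, T g (b l) = (g l).2 := fun g l => b.constr_basis _ _ _
  let D : ι → P × M → Prop := fun l x => x.1 ∈ P.gr (deg l + 0) ∧ x.2 ∈ M.gr (deg l + 1)
  -- The identities ∂s = s∂ and ps − id = ∂h + h∂ at b l. Apart from the new pair x they involve
  -- only values below l, because ∂(b l) lies in the span of earlier basis elements.
  let Q : ι → (ι → P × M) → P × M → Prop := fun l g x => D l x ∧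
    P.d x.1 = S g (M.d (b l)) ∧ p.1 x.1 - b l = M.d x.2 + T g (M.d (b l))
  have hSD : ∀ g, (∀ l, D l (g l)) → ∀ i, ∀ x ∈ M.gr i, S g x ∈ P.gr (i + 0) := fun g hg =>
    map_mem_of_basis b hb.mem_gr 0 _ fun l => by rw [hS]; exact (hg l).1
  have hTD : ∀ g, (∀ l, D l (g l)) → ∀ i, ∀ x ∈ M.gr i, T g x ∈ M.gr (i + 1) := fun g hg =>
    map_mem_of_basis b hb.mem_gr 1 _ fun l => by rw [hT]; exact (hg l).2
  have hcongr : ∀ l g g', (∀ m < l, g m = g' m) →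
      ∀ x ∈ Submodule.span Aᵐᵒᵖ (b '' Set.Iio l), S g x = S g' x ∧ T g x = T g' x := by
    intro l g g' h x hx
    refine ⟨LinearMap.eqOn_span (f := S g) (g := S g') ?_ hx,
      LinearMap.eqOn_span (f := T g) (g := T g') ?_ hx⟩
    · rintro _ ⟨m, hm, rfl⟩
      rw [hS, hS, h m hm]
    · rintro _ ⟨m, hm, rfl⟩
      rw [hT, hT, h m hm]
  have hQ : ∀ l g g' x, (∀ m < l, g m = g' m) → Q l g x → Q l g' x := by
    intro l g g' x h hx
    obtain ⟨h1, h2⟩ := hcongr l g g' h _ (hb.d_mem l)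
    exact ⟨hx.1, h1 ▸ hx.2.1, h2 ▸ hx.2.2⟩
  /- the conditions on basis elements below `l` propagate to their span -/
  have hspan : ∀ (s : Set ι) g, (hD : ∀ l, D l (g l)) → (∀ m ∈ s, Q m g (g m)) →
      ∀ x ∈ Submodule.span Aᵐᵒᵖ (b '' s),
        P.d (S g x) = S g (M.d x) ∧ p.1 (S g x) - x = M.d (T g x) + T g (M.d x) := by
    intro s g hD hs x hx
    -- Graded commutators with ∂ are linear although ∂ is not, so both identities extend from basis
    -- elements to their span.
    have h1 := LinearMap.eqOn_span (f := gradedComm 0 (S g) (hSD g hD)) (g := 0) (s := b '' s)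
      (by
        rintro _ ⟨m, hm, rfl⟩
        rw [gradedComm_apply, hS, (hs m hm).2.1]
        simp) hx
    have h2 := LinearMap.eqOn_span (f := gradedComm 1 (T g) (hTD g hD))
      (g := p.1 ∘ₗ S g - LinearMap.id) (s := b '' s)
      (by
        rintro _ ⟨m, hm, rfl⟩
        rw [gradedComm_apply, hT, LinearMap.sub_apply, LinearMap.comp_apply, hS,
          LinearMap.id_apply, (hs m hm).2.2]
        simp) hx
    rw [gradedComm_apply] at h1 h2
    refine ⟨?_, ?_⟩
    · simpa [sub_eq_zero] using h1
    · have h3 : p.1 (S g x) - x = M.d (T g x) - (1 : ℤ).negOnePow • T g (M.d x) := h2.symm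
      rw [h3]
      simp
  obtain ⟨g, hg⟩ := exists_wellFounded_choice Q hQ (by
    intro l g ih
    -- Values not below l are replaced by 0, so that the linear extensions of g' are homogeneous on
    -- all of M.
    let g' : ι → P × M := fun m => if m < l then g m else 0
    have hgg' : ∀ m < l, g m = g' m := fun m hm => (if_pos hm).symm
    have hD : ∀ m, D m (g' m) := fun m => by
      by_cases hm : m < l
      · rw [← hgg' m hm]; exact (ih m hm).1
      · have : g' m = 0 := if_neg hm
        rw [this]; exact ⟨zero_mem _, zero_mem _⟩
    have hs : ∀ m ∈ Set.Iio l, Q m g' (g' m) := fun m hm => by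
      rw [← hgg' m hm]
      exact hQ m g g' _ (fun n hn => hgg' n (hn.trans hm)) (ih m hm)
    obtain ⟨h1, h2⟩ := hspan _ g' hD hs _ (hb.d_mem l)
    rw [M.d_d, map_zero] at h1 h2
    rw [add_zero] at h2
    have hdl := M.d_mem (hb.mem_gr l)
    have h3 := hSD g' hD _ _ hdl
    have h4 := hTD g' hD _ _ hdl
    rw [add_zero] at h3
    rw [sub_add_cancel] at h4
    -- By the identities known at ∂(b l), the element s(∂(b l)) is a cycle and p sends it to the
    -- boundary of b l + h(∂(b l)). The resulting x and z are the new values of s and h.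
    obtain ⟨x, hx, z, hz, hxa, hxz⟩ := IsQuasiIso.exists_preimage hp h3 h1
      (add_mem (hb.mem_gr l) h4) (by rw [map_add, ← h2]; abel)
    refine ⟨(x, z), hQ l g' g _ (fun m hm => (hgg' m hm).symm) ⟨⟨?_, hz⟩, hxa, ?_⟩⟩
    · rw [add_zero]; exact hx
    · change p.1 x - b l = M.d z + _
      rw [hxz]; abel)
  have hD : ∀ l, D l (g l) := fun l => (hg l).1
  have hall : ∀ x, P.d (S g x) = S g (M.d x) ∧ p.1 (S g x) - x = M.d (T g x) + T g (M.d x) :=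
    fun x => hspan Set.univ g hD (fun m _ => hg m) x (by
      rw [Set.image_univ, b.span_eq]; trivial)
  refine ⟨⟨S g, fun i x hx => ?_, fun x => (hall x).1.symm⟩, T g, hTD g hD, fun x => (hall x).2⟩
  have h := hSD g hD i x hx
  rwa [add_zero] at h

end Semifree

/-! ### Semifree modules along a semifree extension -/

section Restriction

variable {A : DGAlg.{u, v} R} {B : DGAlg.{u, v'} R} (φ : DGAlgHom A B) {N : DGMod.{u, v', w} B}

/-- A semifree DG module over a semifree extension `B` of `A` is semifree over `A`. -/
theorem exists_isSemifreeBasis_res (D : SemifreeBasis (B.reg.res φ)) (E : SemifreeBasis N) :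
    let _ := D.linearOrder
    let _ := E.linearOrder
    ∃ (b : Module.Basis (E.ι ×ₗ D.ι) Aᵐᵒᵖ (N.res φ)) (deg : E.ι ×ₗ D.ι → ℤ),
      IsSemifreeBasis b deg := by
  intro _ _
  let _ : Module Aᵐᵒᵖ Bᵐᵒᵖ := Module.compHom Bᵐᵒᵖ φ.toAlgHom.toRingHom.op
  let _ : Module Bᵐᵒᵖ (N.res φ) := N.module
  have _ : IsScalarTower Aᵐᵒᵖ Bᵐᵒᵖ (N.res φ) :=
    ⟨fun a b x => mul_smul (op (φ a.unop)) b (x : N)⟩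
  let e : B.reg.res φ ≃ₗ[Aᵐᵒᵖ] Bᵐᵒᵖ :=
    { opAddEquiv (α := B) with map_smul' := fun a x => rfl }
  let val : B.reg.res φ →+ B := AddMonoidHom.id B
  let c : Module.Basis E.ι Bᵐᵒᵖ (N.res φ) := E.basis
  -- The products of a basis element of N and one of B, ordered lexicographically with the index
  -- from N taking precedence.
  let b := ((D.basis.map e).smulTower' c).reindex toLex
  have hb : ∀ x, b x = op (val (D.basis (ofLex x).2)) • (E.basis (ofLex x).1 : N) := fun x => by
    rw [Module.Basis.reindex_apply, Module.Basis.smulTower'_apply]; rfl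
  refine ⟨b, fun x => E.deg (ofLex x).1 + D.deg (ofLex x).2, fun x => ?_, fun x => ?_⟩
  · rw [hb]
    exact N.smul_mem (E.mem_gr _) (D.mem_gr (ofLex x).2)
  · let W := Submodule.span Aᵐᵒᵖ (b '' Set.Iio x)
    have key : ∀ (k : E.ι) (s : Set D.ι), (∀ m ∈ s, toLex (k, m) < x) →
        ∀ y ∈ Submodule.span Aᵐᵒᵖ (D.basis '' s), (op (val y) • (E.basis k : N) : N) ∈ W := by
      intro k s hs y hy
      induction hy using Submodule.span_induction with
      | mem y hy =>
        obtain ⟨m, hm, rfl⟩ := hy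
        refine Submodule.subset_span ⟨toLex (k, m), hs m hm, ?_⟩
        rw [hb]; rfl
      | zero =>
        have h : (op (0 : B) • (E.basis k : N) : N) = 0 := by rw [op_zero, zero_smul]
        exact h.symm ▸ W.zero_mem
      | add y z _ _ hy hz =>
        have h : (op (val y + val z) • (E.basis k : N) : N) =
          op (val y) • E.basis k + op (val z) • E.basis k := by rw [op_add, add_smul]
        exact h.symm ▸ W.add_mem hy hz
      | smul a y _ hy =>
        have h : (op (val y * φ a.unop) • (E.basis k : N) : N) =
          op (φ a.unop) • (op (val y) • (E.basis k : N) : N) := by rw [op_mul, mul_smul]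
        exact h.symm ▸ W.smul_mem a hy
    have h1 : ∀ y ∈ Submodule.span Bᵐᵒᵖ (E.basis '' Set.Iio (ofLex x).1), ∀ d : Bᵐᵒᵖ,
        (d • y : N) ∈ W := by
      intro y hy
      induction hy using Submodule.span_induction with
      | mem y hy =>
        obtain ⟨k, hk, rfl⟩ := hy
        intro d
        refine key k Set.univ (fun m _ => Prod.Lex.lt_iff.2 (Or.inl hk)) d.unop ?_
        rw [Set.image_univ, D.basis.span_eq]; trivial
      | zero => intro d; rw [smul_zero]; exact W.zero_mem
      | add y z _ _ hy hz => intro d; rw [smul_add]; exact W.add_mem (hy d) (hz d)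
      | smul a y _ hy => intro d; rw [smul_smul]; exact hy _
    -- In ∂(e d) = ∂e · d ± e · ∂d, the first term involves smaller e with arbitrary coefficients
    -- from B, and the second the same e with smaller d. Both are lexicographically smaller.
    have h2 : N.d (op (val (D.basis (ofLex x).2)) • (E.basis (ofLex x).1 : N)) =
        op (val (D.basis (ofLex x).2)) • N.d (E.basis (ofLex x).1) +
          (E.deg (ofLex x).1).negOnePow •
            (op (B.d (val (D.basis (ofLex x).2))) • (E.basis (ofLex x).1 : N)) :=
      N.leibniz (val (D.basis (ofLex x).2)) (E.mem_gr (ofLex x).1)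
    rw [hb]
    refine h2.symm ▸ W.add_mem (h1 _ (E.d_mem _) _) ?_
    refine DGMod.units_smul_mem W.toAddSubgroup _ (key _ (Set.Iio (ofLex x).2) ?_ _
      (D.d_mem (ofLex x).2))
    exact fun m hm => Prod.Lex.lt_iff.2 (Or.inr ⟨rfl, hm⟩)

end Restriction

/-! ### Vanishing for tensor products with perfect DG modules -/

section Perfect

variable {A : DGAlg.{u, v} R} {B : DGAlg.{u, v'} R}

/-- The map `f ⊗ X` for a linear map `f`. -/
def linRTensor {M : DGMod.{u, v, w} A} {M' : DGMod.{u, v, w''} A} (f : M →ₗ[Aᵐᵒᵖ] M')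
    (X : DGBimod.{u, v, v', w'} A B) : M.tensor X →ₗ[Bᵐᵒᵖ] M'.tensor X where
  toFun := DGMod.lift ((DGMod.tmulHom M' X).comp f.toAddMonoidHom) fun m a x => by
    change DGMod.tmul X (f (m <• a)) x = DGMod.tmul X (f m) (a • x)
    rw [map_smul, DGMod.smul_tmul]
  map_add' := map_add _
  map_smul' b t := by
    refine DGMod.tensor_induction t ?_ ?_ ?_
    · simp
    · exact fun m x => rfl
    · intro s t hs ht
      simp only [smul_add, map_add, hs, ht]

theorem linRTensor_tmul {M : DGMod.{u, v, w} A} {M' : DGMod.{u, v, w''} A} (f : M →ₗ[Aᵐᵒᵖ] M')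
    (X : DGBimod.{u, v, v', w'} A B) (m : M) (x : X.toDGMod) :
    linRTensor f X (DGMod.tmul X m x) = DGMod.tmul X (f m) x := rfl

/-- As h has degree 1, it anticommutes with the sign in the differential of the tensor product, and
the terms containing ∂x cancel. -/
theorem isNullHomotopy_linRTensor {M : DGMod.{u, v, w} A} {M' : DGMod.{u, v, w''} A}
    {f h : M →ₗ[Aᵐᵒᵖ] M'} (H : IsNullHomotopy f h) (X : DGBimod.{u, v, v', w'} A B) :
    IsNullHomotopy (linRTensor f X) (linRTensor h X) := by
  refine ⟨fun i t ht => ?_, fun t => ?_⟩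
  · refine DGMod.gr_induction (linRTensor h X).toAddMonoidHom
      (fun i => (M'.tensor X).gr (i + 1)) ?_ i t ht
    intro i j m hm x hx
    exact DGMod.tmul_mem X (by ring) (H.map_mem i m hm) hx
  · refine DGMod.tensor_induction t ?_ ?_ ?_
    · simp
    · intro m x
      rw [linRTensor_tmul, linRTensor_tmul, DGMod.d_tmul, DGMod.d_tmul, map_add, linRTensor_tmul,
        linRTensor_tmul, H.eq, map_sgn_of_map_mem H.map_mem, DGMod.add_tmul,
        DGMod.units_smul_tmul, Int.negOnePow_one, Units.smul_def, Units.val_neg, Units.val_one,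
        neg_smul, one_smul]
      abel
    · intro s t hs ht
      simp only [map_add, hs, ht]
      abel

/-! ### Coordinates on the tensor product with a semifree module -/

variable {F : DGMod.{u, v, w} A} (E : SemifreeBasis F) (X : DGBimod.{u, v, v', w'} A B)

theorem SemifreeBasis.repr_mem (i : E.ι) {j : ℤ} {x : F} (hx : x ∈ F.gr j) :
    (E.basis.repr x i).unop ∈ A.gr (j - E.deg i) := by
  have key : ∀ x : F, (E.basis.repr (F.proj j x) i).unop =
      A.reg.proj (j - E.deg i) (E.basis.repr x i).unop := by
    classical
    intro x
    refine SemifreeBasis.induction E x ?_ ?_ ?_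
    · simp only [map_zero, Finsupp.coe_zero, Pi.zero_apply, unop_zero]
      exact (map_zero (A.reg.proj (j - E.deg i))).symm
    · intro x y hx hy
      simp only [map_add, Finsupp.coe_add, Pi.add_apply, unop_add]
      rw [hx, hy]
      exact (map_add (A.reg.proj (j - E.deg i)) _ _).symm
    · intro m l a ha
      have h1 := F.smul_mem (E.mem_gr m) ha
      have h2 : E.basis.repr (E.basis m <• a) i = if m = i then op a else 0 := by
        rw [map_smul, Module.Basis.repr_self, Finsupp.smul_single, smul_eq_mul, mul_one,
          Finsupp.single_apply]
      rw [h2]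
      by_cases h : E.deg m + l = j
      · subst h
        rw [F.proj_same h1, h2]
        split_ifs with hm
        · subst hm
          rw [add_sub_cancel_left]
          exact (A.reg.proj_same ha).symm
        · exact (map_zero (A.reg.proj _)).symm
      · rw [F.proj_ne h h1, map_zero]
        split_ifs with hm
        · subst hm
          exact (A.reg.proj_ne (by omega) ha).symm
        · exact (map_zero (A.reg.proj _)).symm
  rw [← F.proj_same hx, key]
  exact A.reg.proj_mem _ _

/-- The coordinate map `e_l a ⊗ x ↦ δ_{il} a x`. -/
def tensorCoord (i : E.ι) : F.tensor X →ₗ[Bᵐᵒᵖ] X.toDGMod where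
  toFun := DGMod.lift ((smulAddHom A X.toDGMod).comp ((opAddEquiv (α := A)).symm.toAddMonoidHom.comp
    ((Finsupp.applyAddHom i).comp E.basis.repr.toLinearMap.toAddMonoidHom))) fun m a x => by
      change (E.basis.repr (m <• a) i).unop • x = (E.basis.repr m i).unop • (a • x)
      rw [map_smul, Finsupp.smul_apply, smul_eq_mul, unop_mul, mul_smul, unop_op]
  map_add' := map_add _
  map_smul' b t := by
    refine DGMod.tensor_induction t ?_ ?_ ?_
    · simp
    · exact fun m x => smul_comm (E.basis.repr m i).unop b x
    · intro s t hs ht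
      simp only [smul_add, map_add, hs, ht]

theorem tensorCoord_tmul (i : E.ι) (m : F) (x : X.toDGMod) :
    tensorCoord E X i (DGMod.tmul X m x) = (E.basis.repr m i).unop • x := rfl

theorem tensorCoord_basis_self (i : E.ι) (x : X.toDGMod) :
    tensorCoord E X i (DGMod.tmul X (E.basis i) x) = x := by
  rw [tensorCoord_tmul, Module.Basis.repr_self, Finsupp.single_eq_same, unop_one, one_smul]

theorem tensorCoord_basis_ne {i l : E.ι} (h : l ≠ i) (x : X.toDGMod) :
    tensorCoord E X i (DGMod.tmul X (E.basis l) x) = 0 := by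
  rw [tensorCoord_tmul, Module.Basis.repr_self, Finsupp.single_eq_of_ne h.symm, unop_zero, zero_smul]

theorem tensorCoord_mem (i : E.ι) (k : ℤ) (t : F.tensor X) (ht : t ∈ (F.tensor X).gr k) :
    tensorCoord E X i t ∈ X.gr (k - E.deg i) := by
  refine DGMod.gr_induction (tensorCoord E X i).toAddMonoidHom
    (fun k => X.gr (k - E.deg i)) ?_ k t ht
  intro j l m hm x hx
  have h := X.lsmul_mem (E.repr_mem i hm) hx
  rwa [show j - E.deg i + l = j + l - E.deg i by ring] at h

/-- The map `x ↦ e_i ⊗ x`. -/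
def tensorIncl (i : E.ι) : X.toDGMod →ₗ[Bᵐᵒᵖ] F.tensor X where
  toFun x := DGMod.tmul X (E.basis i) x
  map_add' := DGMod.tmul_add X _
  map_smul' _ _ := rfl

theorem sum_tensorCoord [Fintype E.ι] (t : F.tensor X) :
    ∑ i, DGMod.tmul X (E.basis i) (tensorCoord E X i t) = t := by
  classical
  have h : ∑ i, tensorIncl E X i ∘ₗ tensorCoord E X i = LinearMap.id := by
    refine LinearMap.ext fun t => ?_
    refine SemifreeBasis.tensor_induction E t ?_ ?_ ?_
    · rw [map_zero, map_zero]
    · intro l x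
      rw [LinearMap.sum_apply, Finset.sum_eq_single l]
      · exact congrArg (DGMod.tmul X (E.basis l)) (tensorCoord_basis_self E X l x)
      · intro i _ hi
        rw [LinearMap.comp_apply, tensorCoord_basis_ne E X hi.symm, map_zero]
      · exact fun h => (h (Finset.mem_univ l)).elim
    · intro s t hs ht
      rw [map_add, map_add, hs, ht]
  have h2 := LinearMap.congr_fun h t
  rwa [LinearMap.sum_apply] at h2

/-- The coefficient of e_i in ∂e_l has degree |e_l| − 1 − |e_i| < 0, and A is zero in negative
degrees. So the degree of the basis elements provides the filtration for the arguments below, in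
place of their given order. -/
theorem tensorCoord_d_basis {i l : E.ι} (h : E.deg l ≤ E.deg i) (x : X.toDGMod) :
    tensorCoord E X i (DGMod.tmul X (F.d (E.basis l)) x) = 0 := by
  have h1 := E.repr_mem i (F.d_mem (E.mem_gr l))
  rw [A.gr_neg _ (by omega), Submodule.mem_bot] at h1
  rw [tensorCoord_tmul, h1, zero_smul]

/-- Components of t at basis elements of degree larger than |e_i| are absent, and by
`tensorCoord_d_basis` the others do not leak into the coordinate at e_i. So a coordinate of a
homomorphism into F ⊗_A X above which all coordinates vanish is itself a homomorphism into a shift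
of X. -/
theorem tensorCoord_d [Fintype E.ι] {i : E.ι} {t : F.tensor X}
    (ht : ∀ l, E.deg i < E.deg l → tensorCoord E X l t = 0) :
    tensorCoord E X i ((F.tensor X).d t) = (E.deg i).negOnePow • X.d (tensorCoord E X i t) := by
  classical
  conv_lhs => rw [← sum_tensorCoord E X t]
  rw [map_sum, map_sum, Finset.sum_eq_single i]
  · rw [DGMod.d_tmul, map_add, tensorCoord_d_basis E X le_rfl, zero_add, F.sgn_of_mem (E.mem_gr i),
      DGMod.units_smul_tmul, Units.smul_def, map_zsmul, tensorCoord_basis_self, Units.smul_def]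
  · intro l _ hl
    by_cases h : E.deg l ≤ E.deg i
    · rw [DGMod.d_tmul, map_add, tensorCoord_d_basis E X h, zero_add, F.sgn_of_mem (E.mem_gr l),
        DGMod.units_smul_tmul, Units.smul_def, map_zsmul, tensorCoord_basis_ne E X hl, smul_zero]
    · rw [ht l (not_le.1 h), DGMod.tmul_zero, map_zero, map_zero]
  · exact fun h => (h (Finset.mem_univ i)).elim

/-! ### Killing coordinates up to homotopy -/

variable {S : DGMod.{u, v', w''} B} {M : DGMod.{u, v, w'''} A}

theorem IsNull.sum {ι : Type*} (s : Finset ι) {P : DGMod.{u, v', w} B} {k : ℤ}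
    {f h : ι → (S →ₗ[Bᵐᵒᵖ] P)} (H : ∀ i ∈ s, IsNull k (f i) (h i)) :
    IsNull k (∑ i ∈ s, f i) (∑ i ∈ s, h i) := by
  classical
  induction s using Finset.induction_on with
  | empty => exact ⟨fun i x _ => zero_mem _, fun x => by simp⟩
  | insert a s ha ih =>
    rw [Finset.sum_insert ha, Finset.sum_insert ha]
    exact (H a (Finset.mem_insert_self _ _)).add
      (ih fun i hi => H i (Finset.mem_insert_of_mem hi))

/-- A homogeneous map is a null homotopy of its boundary. -/
theorem exists_isNull {P : DGMod.{u, v', w} B} {k : ℤ} (h : S →ₗ[Bᵐᵒᵖ] P)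
    (hh : ∀ i, ∀ x ∈ S.gr i, h x ∈ P.gr (i + 1 - k)) : ∃ g, IsNull k g h := by
  have hh' : ∀ i, ∀ x ∈ S.gr i, h x ∈ P.gr (i + (1 - k)) := fun i x hx => by
    rw [← add_sub_assoc]; exact hh i x hx
  -- As a map into P, the homotopy has degree 1 − k, and (−1)^k times its graded commutator with ∂
  -- is (−1)^k ∂h + h∂.
  refine ⟨k.negOnePow • gradedComm (1 - k) h hh', hh, fun x => ?_⟩
  change k.negOnePow • gradedComm (1 - k) h hh' x = _
  rw [gradedComm_apply, Int.negOnePow_sub, Int.negOnePow_one]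
  obtain e | e := Int.units_eq_one_or k.negOnePow
  · simp [e, Units.smul_def]
  · simp only [e, Units.smul_def, Units.val_neg, Units.val_one, neg_smul, one_smul, mul_neg,
      mul_one, neg_neg]
    abel

/-- Correcting a map to `F ⊗_A X` so that the coordinate at `e_i` becomes zero. -/
theorem exists_isNull_tensorIncl [Fintype E.ι] [DecidableEq E.ι] {k : ℤ}
    {f : S →ₗ[Bᵐᵒᵖ] F.tensor X} (hf : IsChain k f)
    {i : E.ι} (hi : ∀ l, E.deg i < E.deg l → ∀ x, tensorCoord E X l (f x) = 0)
    (H : Vanishes S X.toDGMod (k + E.deg i)) :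
    ∃ g h : S →ₗ[Bᵐᵒᵖ] F.tensor X, IsNull k g h ∧
      ∀ l, E.deg i ≤ E.deg l → ∀ x, tensorCoord E X l (g x) =
        if l = i then tensorCoord E X i (f x) else 0 := by
  -- All coordinates of larger degree vanish, so the coordinate at e_i is a homomorphism into a
  -- shift of X, to which the vanishing hypothesis applies.
  have hc : IsChain (k + E.deg i) (tensorCoord E X i ∘ₗ f) := by
    refine ⟨fun j x hx => ?_, fun x => ?_⟩
    · have h := tensorCoord_mem E X i _ _ (hf.map_mem j x hx)
      rwa [sub_sub] at h
    · rw [LinearMap.comp_apply, LinearMap.comp_apply, hf.map_d, Units.smul_def, map_zsmul,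
        ← Units.smul_def, tensorCoord_d E X fun l hl => hi l hl x, smul_smul, Int.negOnePow_add]
  obtain ⟨h, hh⟩ := H _ hc
  have hmem : ∀ j, ∀ x ∈ S.gr j, tensorIncl E X i (h x) ∈ (F.tensor X).gr (j + 1 - k) :=
    fun j x hx => DGMod.tmul_mem X (by ring) (E.mem_gr i) (hh.map_mem j x hx)
  have hd : ∀ x, k.negOnePow • (F.tensor X).d (tensorIncl E X i (h x)) +
      tensorIncl E X i (h (S.d x)) = DGMod.tmul X (E.basis i) (tensorCoord E X i (f x)) +
        k.negOnePow • DGMod.tmul X (F.d (E.basis i)) (h x) := by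
    intro x
    have h1 := hh.eq x
    rw [LinearMap.comp_apply] at h1
    have h2 : (F.tensor X).d (tensorIncl E X i (h x)) = DGMod.tmul X (F.d (E.basis i)) (h x) +
        (E.deg i).negOnePow • DGMod.tmul X (E.basis i) (X.d (h x)) := by
      rw [← DGMod.units_smul_tmul, ← F.sgn_of_mem (E.mem_gr i)]; rfl
    rw [h1, h2, DGMod.tmul_add, DGMod.tmul_units_smul, smul_add, smul_smul, Int.negOnePow_add]
    change _ + DGMod.tmul X (E.basis i) (h (S.d x)) = _
    abel
  -- The boundary of e_i ⊗ h has the same coordinate at e_i as f; the remaining term ± ∂e_i ⊗ h only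
  -- has coordinates at basis elements of degree below |e_i|.
  obtain ⟨g, hg⟩ := exists_isNull (tensorIncl E X i ∘ₗ h) hmem
  refine ⟨g, _, hg, fun l hl x => ?_⟩
  rw [hg.eq, LinearMap.comp_apply, LinearMap.comp_apply, hd, map_add, Units.smul_def, map_zsmul,
    tensorCoord_d_basis E X hl, smul_zero, add_zero]
  split_ifs with h'
  · subst h'; rw [tensorCoord_basis_self]
  · rw [tensorCoord_basis_ne E X (Ne.symm h')]

/-- The inductive step towards `vanishes_tensor`: killing the coordinates of maximal degree. -/
theorem exists_isNull_linRTensor [Fintype E.ι] {k : ℤ} (H : ∀ j, k ≤ j → Vanishes S X.toDGMod j)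
    (p : DGHom F M) (hM : ∀ i < 0, M.gr i = ⊥) {j : ℤ} (hj : k ≤ j) (D : ℕ) :
    ∀ f : S →ₗ[Bᵐᵒᵖ] F.tensor X, IsChain j f →
      (∀ i, (D : ℤ) ≤ E.deg i → ∀ x, tensorCoord E X i (f x) = 0) →
      ∃ h, IsNull j (linRTensor p.1 X ∘ₗ f) h := by
  classical
  induction D with
  | zero =>
    intro f _ h0
    -- Only basis elements of negative degree remain, and p sends them into components of M that are
    -- zero.
    have h : linRTensor p.1 X ∘ₗ f = 0 := by
      refine LinearMap.ext fun x => ?_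
      rw [LinearMap.comp_apply, ← sum_tensorCoord E X (f x), map_sum]
      refine Finset.sum_eq_zero fun i _ => ?_
      rcases le_or_gt 0 (E.deg i) with hi | hi
      · rw [h0 i (by simpa using hi), DGMod.tmul_zero, map_zero]
      · have h1 := p.2.1 _ _ (E.mem_gr i)
        rw [hM _ hi, AddSubgroup.mem_bot] at h1
        rw [linRTensor_tmul, h1, DGMod.zero_tmul]
    rw [h]
    exact ⟨0, fun i x _ => zero_mem _, fun x => by simp⟩
  | succ D ih =>
    intro f hf h0
    have step : ∀ i, ∃ g h : S →ₗ[Bᵐᵒᵖ] F.tensor X, IsNull j g h ∧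
        ∀ l, (D : ℤ) ≤ E.deg l → ∀ x, tensorCoord E X l (g x) =
          if l = i then tensorCoord E X i (f x) else 0 := by
      intro i
      -- No correction is needed when the degree differs from D: in larger degree the coordinate is
      -- already zero, and smaller degrees are not constrained.
      by_cases hi : E.deg i = D
      · obtain ⟨g, h, h1, h2⟩ := exists_isNull_tensorIncl E X hf (i := i)
          (fun l hl x => h0 l (by push_cast; omega) x) (H _ (by omega))
        exact ⟨g, h, h1, hi ▸ h2⟩
      · refine ⟨0, 0, ⟨fun i x _ => zero_mem _, fun x => by simp⟩, fun l hl x => ?_⟩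
        rw [LinearMap.zero_apply, map_zero]
        split_ifs with h
        · subst h
          rw [h0 l (by push_cast; omega)]
        · rfl
    choose g h hgh hg using step
    have hs := IsNull.sum Finset.univ (fun i _ => hgh i)
    -- All coordinates in degree D are removed at once, since the corrections for different i do not
    -- interfere in degrees ≥ D.
    obtain ⟨h', hh'⟩ := ih (f - ∑ i, g i) (by
      rw [sub_eq_add_neg]; exact hf.add hs.isChain.neg) (by
      intro l hl x
      rw [LinearMap.sub_apply, LinearMap.sum_apply, map_sub, map_sum, Finset.sum_eq_single l]
      · rw [hg l l hl, if_pos rfl, sub_self]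
      · intro i _ hi
        rw [hg i l hl, if_neg hi.symm]
      · exact fun h => (h (Finset.mem_univ l)).elim)
    have hp := hs.comp (DGHom.rTensor p X)
    have e : linRTensor p.1 X ∘ₗ (f - ∑ i, g i) + (DGHom.rTensor p X).1 ∘ₗ (∑ i, g i) =
        linRTensor p.1 X ∘ₗ f := by
      refine LinearMap.ext fun x => ?_
      change linRTensor p.1 X (f x - (∑ i, g i) x) + linRTensor p.1 X ((∑ i, g i) x) = _
      rw [← map_add, sub_add_cancel]; rfl
    exact ⟨_, e ▸ hh'.add hp⟩

/-- If `M` is semifree and perfect and vanishes in negative degrees, then homomorphisms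
`S → Σ^j (M ⊗_A X)` are null-homotopic as soon as homomorphisms `S → Σ^i X` are for `i ≥ j`. -/
theorem vanishes_tensor {ι : Type*} [LinearOrder ι] [WellFoundedLT ι]
    {b : Module.Basis ι Aᵐᵒᵖ M} {deg : ι → ℤ} (hb : IsSemifreeBasis b deg) (hP : IsPerfect M)
    (hM : ∀ i < 0, M.gr i = ⊥) {k : ℤ} (H : ∀ j, k ≤ j → Vanishes S X.toDGMod j) {j : ℤ}
    (hj : k ≤ j) : Vanishes S (M.tensor X) j := by
  intro g hg
  obtain ⟨F, E, p, hfin, hp⟩ := hP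
  obtain ⟨s, h, hh⟩ := exists_homotopy_section hb hp
  have := Fintype.ofFinite E.ι
  -- A bound above all degrees makes the hypothesis on coordinates of degree ≥ D void, so the
  -- induction on D can start from an arbitrary homomorphism.
  obtain ⟨D, hD⟩ : ∃ D : ℕ, ∀ i, E.deg i < D := by
    refine ⟨∑ i, ((E.deg i).toNat + 1), fun i => ?_⟩
    have h1 := Finset.single_le_sum (f := fun i => (E.deg i).toNat + 1) (fun _ _ => Nat.zero_le _)
      (Finset.mem_univ i)
    have h2 := Int.self_le_toNat (E.deg i)
    have h3 : ((E.deg i).toNat + 1 : ℤ) ≤ ((∑ i, ((E.deg i).toNat + 1) : ℕ) : ℤ) := by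
      exact_mod_cast h1
    omega
  obtain ⟨h1, hh1⟩ := exists_isNull_linRTensor E X H p hM hj D _ (hg.comp (DGHom.rTensor s X))
    fun i hi => (not_le.2 (hD i) hi).elim
  have h2 := hg.comp_null (isNullHomotopy_linRTensor hh X)
  -- Here g = (ps ⊗ X)g − ((ps − id) ⊗ X)g. The first term is null-homotopic by the induction over
  -- degrees in F, the second because ps is homotopic to the identity.
  have e : linRTensor p.1 X ∘ₗ ((DGHom.rTensor s X).1 ∘ₗ g) -
      linRTensor (p.1 ∘ₗ s.1 - LinearMap.id) X ∘ₗ g = g := by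
    have key : ∀ t : M.tensor X, linRTensor p.1 X ((DGHom.rTensor s X).1 t) -
        linRTensor (p.1 ∘ₗ s.1 - LinearMap.id) X t = t := by
      intro t
      refine DGMod.tensor_induction t ?_ ?_ ?_
      · simp
      · intro m x
        change DGMod.tmul X (p.1 (s.1 m)) x - DGMod.tmul X (p.1 (s.1 m) - m) x = _
        rw [← DGMod.tmulHom_apply, ← DGMod.tmulHom_apply, map_sub, AddMonoidHom.sub_apply,
          sub_sub_cancel]
        rfl
      · intro s t hs ht
        rw [map_add, map_add, map_add, add_sub_add_comm, hs, ht]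
    exact LinearMap.ext fun x => key (g x)
  exact ⟨_, e ▸ hh1.sub h2⟩

end Perfect

/-! ### Vanishing for the tensor powers of `ΣJ` -/

section Powers

variable {A : DGAlg.{u, v} R} {B : DGAlg.{u, v'} R} (φ : DGAlgHom A B)

/-- The element `1` as a basis of `B`. -/
def regBasisOne (B : DGAlg.{u, v'} R) : Module.Basis PUnit.{v' + 1} Bᵐᵒᵖ B.reg :=
  (Module.Basis.singleton PUnit Bᵐᵒᵖ).map
    ({ (opAddEquiv (α := B)).symm with map_smul' := fun _ _ => rfl } : Bᵐᵒᵖ ≃ₗ[Bᵐᵒᵖ] B.reg)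

theorem regBasisOne_apply (i : PUnit) : regBasisOne B i = (1 : B) := by
  unfold regBasisOne
  rw [Module.Basis.map_apply, Module.Basis.singleton_apply]
  rfl

theorem d_regBasisOne (i : PUnit) : B.reg.d (regBasisOne B i) = 0 :=
  (congrArg B.reg.d (regBasisOne_apply i)).trans B.d_one

/-- The element `1` as a semifree basis of `B`. -/
def regBasis (B : DGAlg.{u, v'} R) : SemifreeBasis B.reg where
  ι := PUnit
  basis := regBasisOne B
  deg _ := 0
  mem_gr i := (regBasisOne_apply (B := B) i).symm ▸ B.one_mem
  d_mem i := (d_regBasisOne (B := B) i).symm ▸ zero_mem _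

/-- Since ∂1 = 0, the Atiyah map formed with the basis {1} is zero, and with it the second map in
the triangle for B. -/
theorem atiyah_regBasis : (atiyah φ (regBasis B)).1 = 0 :=
  (regBasis B).basis.ext fun i => (atiyahLin_basis φ (regBasis B) i).trans
    ((congrArg _ (d_regBasisOne i)).trans (map_zero _))

/-- The map `x ↦ 1 ⊗ x`. -/
def leftUnitInv (X : DGBimod.{u, v', v', v'} B B) :
    DGHom X.toDGMod (B.regBimod.tensor X).toDGMod :=
  ⟨{  toFun := fun x => DGBimod.tmul X (regOne B) x
      map_add' := fun x y => DGBimod.tmul_add X _ x y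
      map_smul' := fun _ _ => rfl },
    fun i x hx => DGBimod.tmul_mem X (zero_add i) B.one_mem hx, fun x => by
      have h1 : B.regBimod.d (regOne B) = 0 := B.d_one
      have h2 : B.regBimod.sgn (regOne B) = regOne B := map_one B.sgn
      change DGBimod.tmul X (regOne B) (X.d x) = DGBimod.tmul X (B.regBimod.d (regOne B)) x +
        DGBimod.tmul X (B.regBimod.sgn (regOne B)) (X.d x)
      have h3 : DGBimod.tmul X (0 : B.regBimod.toDGMod) x = 0 := BalTensor.zero_tmul x
      rw [h1, h2, h3, zero_add]⟩

variable {S : DGMod.{u, v', w} B}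

/-- In the triangle for B the second map is zero, so homotopy classes of maps into Σ^j(ΣJ ⊗_B X)
inject into those of maps into Σ^{j+1}(B ⊗_A X). This shift is why the conclusion starts at j = 0
although the hypothesis starts at j = 1. -/
theorem vanishes_suspDiag_tensor (X : DGBimod.{u, v', v', v'} B B)
    (hsf : IsSemifree (B.reg.res φ)) (hP : IsPerfect (B.reg.res φ))
    (H : ∀ j : ℤ, 1 ≤ j → Vanishes S X.toDGMod j) {j : ℤ} (hj : 0 ≤ j) :
    Vanishes S ((suspDiag φ).tensor X).toDGMod j := by
  obtain ⟨D⟩ := hsf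
  let _ := D.linearOrder
  have _ := D.wellFounded
  have hD : IsSemifreeBasis D.basis D.deg := ⟨D.mem_gr, D.d_mem⟩
  have hQ : Vanishes S (resTensor φ B.reg X) (j + 1) := vanishes_tensor (X.resL φ) hD hP
    (fun i hi => (congrArg Submodule.toAddSubgroup (B.gr_neg i hi)).trans rfl) (k := 1) H
    (by omega)
  have hZ : Vanishes S (B.reg.tensor ((suspDiag φ).tensor X)) j := by
    intro g hg
    -- As the second map is zero, a lift of g up to homotopy is a null homotopy of g.
    obtain ⟨f, -, h, hh⟩ := (atiyahSplitting φ X (regBasis B)).exists_lift hQ hg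
    refine ⟨h, ?_⟩
    have h0 : (DGHom.comp (DGHom.assoc B.reg (suspDiag φ) X)
        (DGHom.rTensor (atiyah φ (regBasis B)) X)).1 = 0 := by
      refine LinearMap.ext fun t => ?_
      refine DGMod.tensor_induction t ?_ ?_ ?_
      · rw [map_zero, map_zero]
      · intro m x
        change (DGHom.assoc B.reg (suspDiag φ) X).1
          (DGMod.tmul X ((atiyah φ (regBasis B)).1 m) x) = 0
        rw [atiyah_regBasis, LinearMap.zero_apply, DGMod.zero_tmul, map_zero]
      · intro s t hs ht
        rw [map_add, map_add, hs, ht]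
    rwa [h0, LinearMap.zero_comp, sub_zero] at hh
  refine hZ.of_retract (leftUnitInv ((suspDiag φ).tensor X))
    (leftUnit ((suspDiag φ).tensor X)).toHom fun x => ?_
  exact one_smul B x

/-- Induction on n: a new factor ΣJ needs the previous power only for j ≥ 1 and returns the range j
≥ 0, so j = 0 is available from n = 1 on. -/
theorem vanishes_tensorPow (hsf : IsSemifree (B.reg.res φ)) (hP : IsPerfect (B.reg.res φ))
    (H : ∀ j : ℤ, 1 ≤ j → Vanishes S B.reg j) :
    ∀ (n : ℕ) (j : ℤ), 1 ≤ j ∨ 0 ≤ j ∧ 1 ≤ n →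
      Vanishes S (tensorPow (suspDiag φ) n).toDGMod j
  | 0, j, hj => H j (by omega)
  | n + 1, j, hj => vanishes_suspDiag_tensor φ (tensorPow (suspDiag φ) n) hsf hP
      (fun i hi => vanishes_tensorPow hsf hP H n i (Or.inl hi)) (by omega)

/-- The vanishing of `Hom_{K(B)}(N, Σ^j (N ⊗_A T^n))` under `(AR1)`. -/
theorem vanishes_resTensor {N : DGMod.{u, v', w} B} (hφ : IsSetting φ) (hN : AR1 φ N) (n : ℕ)
    {j : ℤ} (hj : 1 ≤ j ∨ 0 ≤ j ∧ 1 ≤ n) :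
    Vanishes N (resTensor φ N (tensorPow (suspDiag φ) n)) j := by
  obtain ⟨D⟩ := hφ.semifree
  obtain ⟨E⟩ := hN.semifree
  let _ := D.linearOrder
  let _ := E.linearOrder
  have _ := D.wellFounded
  have _ := E.wellFounded
  obtain ⟨b, deg, hb⟩ := exists_isSemifreeBasis_res φ D E
  have H := vanishes_tensorPow (S := N) φ hφ.semifree hN.perfect_B
    fun j hj => vanishes_of_subsingleton (hN.vanishing j hj)
  -- Only the groups for T^n with shift i ≥ j enter, and the admissible range of j is closed
  -- upwards.
  exact vanishes_tensor ((tensorPow (suspDiag φ) n).resL φ) hb hN.perfect hN.nonneg (k := j)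
    (fun i hi => H n i (by omega)) le_rfl

end Powers

/-! ### The universal property of `N ⊗_B T` -/

section AssocInv

variable {A : DGAlg.{u, v} R} {B : DGAlg.{u, v'} R} {C : DGAlg.{u, v''} R}
  (M : DGMod.{u, v, w} A) (X : DGBimod.{u, v, v', w'} A B) (Y : DGBimod.{u, v', v'', w''} B C)

/-- The biadditive map `(m, x ⊗ y) ↦ (m ⊗ x) ⊗ y`. -/
def assocInvAux : M →+ (X.tensor Y).toDGMod →+ (M.tensor X).tensor Y :=
  AddMonoidHom.mk' (fun m => DGMod.lift (M := X.toDGMod) (X := Y)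
      ((DGMod.tmulHom (M.tensor X) Y).comp (DGMod.tmulHom M X m)) fun x b y => by
        change DGMod.tmul Y (DGMod.tmul X m (x <• b)) y = DGMod.tmul Y (DGMod.tmul X m x) (b • y)
        rw [← DGMod.op_smul_tmul, DGMod.smul_tmul]) fun m m' => by
    refine AddMonoidHom.ext fun t => ?_
    refine DGBimod.tensor_induction t ?_ ?_ ?_
    · exact (map_zero _).trans (map_zero _).symm
    · intro x y
      change DGMod.tmul Y (DGMod.tmul X (m + m') x) y =
        DGMod.tmul Y (DGMod.tmul X m x) y + DGMod.tmul Y (DGMod.tmul X m' x) y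
      rw [DGMod.add_tmul, DGMod.add_tmul]
    · intro s t hs ht
      exact (map_add _ _ _).trans ((congrArg₂ (· + ·) hs ht).trans (map_add _ _ _).symm)

theorem assocInvAux_tmul (m : M) (x : X.toDGMod) (y : Y.toDGMod) :
    assocInvAux M X Y m (DGBimod.tmul Y x y) = DGMod.tmul Y (DGMod.tmul X m x) y := rfl

/-- The associativity map `M ⊗_A (X ⊗_B Y) → (M ⊗_A X) ⊗_B Y`. -/
def DGHom.assocInv : DGHom (M.tensor (X.tensor Y)) ((M.tensor X).tensor Y) :=
  DGHom.ofTensor (assocInvAux M X Y)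
    (fun m a t => by
      refine DGBimod.tensor_induction t ?_ ?_ ?_
      · rw [smul_zero, map_zero, map_zero]
      · intro x y
        rw [DGBimod.smul_tmul', assocInvAux_tmul, assocInvAux_tmul, DGMod.smul_tmul]
      · intro s t hs ht
        rw [smul_add, map_add, map_add, hs, ht])
    (fun m t c => by
      refine DGBimod.tensor_induction t ?_ ?_ ?_
      · rw [smul_zero, map_zero, smul_zero]
      · intro x y
        rw [DGBimod.op_smul_tmul, assocInvAux_tmul, assocInvAux_tmul, DGMod.op_smul_tmul]
      · intro s t hs ht
        rw [smul_add, map_add, map_add, hs, ht, smul_add])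
    (fun i j m hm t ht => by
      refine DGMod.gr_induction (M := X.toDGMod) (X := Y) (assocInvAux M X Y m)
        (fun j => ((M.tensor X).tensor Y).gr (i + j)) ?_ j t ht
      intro k l x hx y hy
      exact DGMod.tmul_mem Y (add_assoc i k l) (DGMod.tmul_mem X rfl hm hx) hy)
    (fun m t => by
      refine DGBimod.tensor_induction t ?_ ?_ ?_
      · simp
      · intro x y
        rw [DGBimod.d_tmul, map_add, assocInvAux_tmul, assocInvAux_tmul, assocInvAux_tmul,
          assocInvAux_tmul, DGMod.d_tmul, DGMod.d_tmul, DGMod.sgn_tmul, DGMod.add_tmul, add_assoc]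
      · intro s t hs ht
        simp only [map_add, ← hs, ← ht]
        abel)

end AssocInv

/-! ### Iterated action and generators of the tensor powers -/

section Free

variable {B : DGAlg.{u, v} R}

/-- The right action of `B` on `M` as a biadditive map. -/
def rightActHom (M : DGMod.{u, v, w} B) : M →+ B →+ M :=
  AddMonoidHom.mk' (fun m => AddMonoidHom.mk' (fun b => m <• b)
      fun b c => by rw [op_add, add_smul])
    fun m m' => AddMonoidHom.ext fun b => smul_add (op b) m m'

/-- The canonical map `M ⊗_B B → M`. -/
def DGHom.rid (M : DGMod.{u, v, w} B) : DGHom (M.tensor B.regBimod) M :=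
  DGHom.ofTensor (P := M) (X := B.regBimod)
    (rightActHom M)
    (fun m a (b : B) => (mul_smul (op b) (op a) m).symm)
    (fun m (b : B) c => mul_smul c (op b) m)
    (fun _ _ _ hm _ hb => M.smul_mem hm hb)
    (fun m b => (M.leibniz_sgn m b).symm)

/-- The canonical map `M → M ⊗_B B`. -/
def DGHom.ridInv (M : DGMod.{u, v, w} B) : DGHom M (M.tensor B.regBimod) :=
  ⟨{  toFun := fun x => DGMod.tmul B.regBimod x (regOne B)
      map_add' := fun x y => DGMod.add_tmul B.regBimod x y (regOne B)
      map_smul' := fun b x => by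
        have h : (b.unop • regOne B : B.regBimod.toDGMod) = b • regOne B :=
          (mul_one b.unop).trans (one_mul b.unop).symm
        exact (DGMod.smul_tmul B.regBimod x b.unop (regOne B)).trans
          ((congrArg _ h).trans (DGMod.op_smul_tmul B.regBimod x (regOne B) b).symm) },
    fun i x hx => DGMod.tmul_mem B.regBimod (add_zero i) hx B.one_mem, fun x => by
      change DGMod.tmul B.regBimod (M.d x) (regOne B) =
        DGMod.tmul B.regBimod (M.d x) (regOne B) +
          DGMod.tmul B.regBimod (M.sgn x) (B.regBimod.d (regOne B))
      have h : B.regBimod.d (regOne B) = 0 := B.d_one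
      rw [h, DGMod.tmul_zero, add_zero]⟩

variable {V : DGBimod.{u, v, v, v} B B} (P : TGMod.{u, v, w'} V)

/-- The action `P^i ⊗_B T^n → P^j`, where `i + n = j`. -/
def TGMod.iterAct : ∀ (n : ℕ) (i j : ℤ), i + n = j →
    DGHom ((P.X i).tensor (tensorPow V n)) (P.X j)
  | 0, i, j, h => (show i = j by simpa using h) ▸ DGHom.rid (P.X i)
  -- As T^{n+1} = V ⊗_B T^n, the leftmost factor acts first and the remaining ones act on P^{i+1}.
  | n + 1, i, j, h => DGHom.comp (TGMod.iterAct n (i + 1) j (by push_cast at h; omega))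
      (DGHom.comp (DGHom.rTensor (P.a i (i + 1) rfl) (tensorPow V n))
        (DGHom.assocInv (P.X i) V (tensorPow V n)))

/-- `tensorPow` adds factors on the left, while T acts by appending them on the right through
`powMul`. Induction on n with i varying reconciles the two conventions: the leftmost factor is
absorbed into p. -/
theorem TGMod.iterAct_powMul (n : ℕ) : ∀ (i j k : ℤ) (h : i + n = j) (h' : i + (n + 1 : ℕ) = k)
    (h'' : j + 1 = k) (p : P.X i) (t : (tensorPow V n).toDGMod) (c : V.toDGMod),
    (P.iterAct (n + 1) i k h').1 (DGMod.tmul (tensorPow V (n + 1)) p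
        ((powMul V n).toHom.1 (DGBimod.tmul V t c))) =
      P.act j k h'' ((P.iterAct n i j h).1 (DGMod.tmul (tensorPow V n) p t)) c := by
  induction n with
  | zero =>
    intro i j k h h' h'' p (b : B) c
    obtain rfl : i = j := by simpa using h
    subst h''
    have h1 : (powMul V 0).toHom.1 (DGBimod.tmul V (Y := tensorPow V 0) b c) =
      DGBimod.tmul (tensorPow V 0) (b • c) (regOne B) := rfl
    refine (congrArg (fun y => (P.iterAct 1 i (i + 1) h').1
      (DGMod.tmul (tensorPow V 1) p y)) h1).trans ?_
    change P.act i (i + 1) rfl p (b • c) <• (1 : B) = P.act i (i + 1) rfl (p <• b) c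
    rw [op_one, one_smul]
    unfold TGMod.act
    rw [DGMod.smul_tmul]
  | succ n ih =>
    intro i j k h h' h'' p t c
    refine DGBimod.tensor_induction t ?_ ?_ ?_
    · have h1 : DGBimod.tmul V (0 : (tensorPow V (n + 1)).toDGMod) c = 0 := BalTensor.zero_tmul c
      have h2 : DGMod.tmul (tensorPow V (n + 1)) p (0 : (tensorPow V (n + 1)).toDGMod) = 0 :=
        DGMod.tmul_zero _ p
      have h3 : DGMod.tmul (tensorPow V (n + 2)) p (0 : (tensorPow V (n + 2)).toDGMod) = 0 :=
        DGMod.tmul_zero _ p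
      exact ((congrArg (fun y => (P.iterAct (n + 2) i k h').1
          (DGMod.tmul (tensorPow V (n + 2)) p ((powMul V (n + 1)).toHom.1 y))) h1).trans
        (by rw [map_zero, h3, map_zero])).trans
        ((congrArg (fun y => P.act j k h'' ((P.iterAct (n + 1) i j h).1 y) c) h2).trans
          (by rw [map_zero, TGMod.act_zero])).symm
    · intro v t
      have h1 : (powMul V (n + 1)).toHom.1
          (DGBimod.tmul V (Y := tensorPow V (n + 1)) (DGBimod.tmul (tensorPow V n) v t) c) =
        DGBimod.tmul (tensorPow V (n + 1)) v ((powMul V n).toHom.1 (DGBimod.tmul V t c)) := rfl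
      exact (congrArg (fun y => (P.iterAct (n + 2) i k h').1
        (DGMod.tmul (tensorPow V (n + 2)) p y)) h1).trans
        (ih (i + 1) j k (by push_cast at h; omega) (by push_cast at h' ⊢; omega) h''
          (P.act i (i + 1) rfl p v) t c)
    · intro s t hs ht
      have h1 : ∀ s t : (tensorPow V (n + 1)).toDGMod,
        DGBimod.tmul V (s + t) c = DGBimod.tmul V s c + DGBimod.tmul V t c := fun s t =>
          BalTensor.add_tmul s t c
      have h2 : ∀ s t : (tensorPow V (n + 1)).toDGMod, DGMod.tmul (tensorPow V (n + 1)) p (s + t) =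
        DGMod.tmul (tensorPow V (n + 1)) p s + DGMod.tmul (tensorPow V (n + 1)) p t :=
          DGMod.tmul_add _ p
      exact ((congrArg (fun y => (P.iterAct (n + 2) i k h').1
          (DGMod.tmul (tensorPow V (n + 2)) p ((powMul V (n + 1)).toHom.1 y))) (h1 s t)).trans
        (by rw [map_add, DGMod.tmul_add, map_add])).trans
        ((congrArg₂ (· + ·) hs ht).trans
        ((congrArg (fun y => P.act j k h'' ((P.iterAct (n + 1) i j h).1 y) c) (h2 s t)).trans
          (by rw [map_add, TGMod.act_add])).symm)

/-- The products t · c with t in T^n and c in V generate T^{n+1}. Testing against additive maps F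
lets the induction pass to F(x ⊗ –), with the leftmost factor x fixed. -/
theorem powMul_ext (n : ℕ) : ∀ {G : Type w} [AddCommGroup G]
    (F : (tensorPow V (n + 1)).toDGMod →+ G),
    (∀ t c, F ((powMul V n).toHom.1 (DGBimod.tmul V t c)) = 0) → F = 0 := by
  induction n with
  | zero =>
    intro G _ F hF
    refine AddMonoidHom.ext fun t => ?_
    refine DGBimod.tensor_induction (Y := V) (X := B.regBimod) t ?_ ?_ ?_
    · exact map_zero F
    · intro x (b : B)
      -- Every x ⊗ b in V ⊗_B B is the product of 1 in T^0 with xb, because (xb) ⊗ 1 = x ⊗ b.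
      have h1 : (powMul V 0).toHom.1 (DGBimod.tmul V (Y := tensorPow V 0) (1 : B) (x <• b)) =
        DGBimod.tmul B.regBimod ((1 : B) • (x <• b)) (regOne B) := rfl
      have h2 := hF (1 : B) (x <• b)
      rw [h1, one_smul, DGBimod.smul_tmul] at h2
      have h3 : b • regOne B = (b : B) := mul_one b
      rw [h3] at h2
      exact h2
    · intro s t hs ht
      exact (map_add F s t).trans ((congrArg₂ (· + ·) hs ht).trans (add_zero 0))
  | succ n ih =>
    intro G _ F hF
    refine AddMonoidHom.ext fun t => ?_
    refine DGBimod.tensor_induction (Y := V) (X := tensorPow V (n + 1)) t ?_ ?_ ?_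
    · exact map_zero F
    · intro x s
      exact DFunLike.congr_fun (ih (F.comp (DGBimod.tmulHom V (tensorPow V (n + 1)) x))
        fun t c => hF (DGBimod.tmul (tensorPow V n) x t) c) s
    · intro s t hs ht
      exact (map_add F s t).trans ((congrArg₂ (· + ·) hs ht).trans (add_zero 0))

/-! ### The adjunction between extension to N ⊗_B T and restriction to N -/

variable {P} {N : DGMod.{u, v, w} B}

/-- The restriction of a map `N ⊗_B T → P` to `N`. -/
def restrictT (f : ∀ i, tensorTX N V i →ₗ[Bᵐᵒᵖ] P.X i) : N →ₗ[Bᵐᵒᵖ] P.X 0 :=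
  (f 0 : N.tensor B.regBimod →ₗ[Bᵐᵒᵖ] P.X 0) ∘ₗ (DGHom.ridInv N).1

/-- The `T`-linear extension of a map `N → P^0` to `N ⊗_B T`. -/
def extendT (g : N →ₗ[Bᵐᵒᵖ] P.X 0) : ∀ i, tensorTX N V i →ₗ[Bᵐᵒᵖ] P.X i
  | .ofNat n => (P.iterAct n 0 n (zero_add _)).1 ∘ₗ linRTensor g (tensorPow V n)
  | .negSucc _ => 0

theorem isTLinear_extendT (g : N →ₗ[Bᵐᵒᵖ] P.X 0) :
    TGMod.IsTLinear (M := tensorT N V) (extendT g)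
  | .negSucc n, _, rfl, x, c => by
    have h1 : (tensorT N V).act (.negSucc n) _ rfl x c = 0 := rfl
    exact (congrArg (extendT g _) h1).trans
      ((map_zero (extendT g (.negSucc n + 1))).trans (P.act_zero (.negSucc n) _ rfl c).symm)
  | .ofNat n, _, rfl, x, c => by
    refine DGMod.tensor_induction (M := N) (X := tensorPow V n) x ?_ ?_ ?_
    · have h1 : (tensorT N V).act (.ofNat n) _ rfl (0 : N.tensor (tensorPow V n)) c = 0 :=
        TGMod.act_zero _ _ _ _ _
      exact ((congrArg (extendT g _) h1).trans (map_zero (extendT g (.ofNat n + 1)))).trans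
        ((congrArg (fun y => P.act (.ofNat n) _ rfl y c) (map_zero (extendT g (.ofNat n)))).trans
          (P.act_zero (.ofNat n) _ rfl c)).symm
    · intro m t
      exact P.iterAct_powMul n 0 n _ (zero_add _) (zero_add _) rfl (g m) t c
    · intro s t hs ht
      have h1 : (tensorT N V).act (.ofNat n) _ rfl (s + t : N.tensor (tensorPow V n)) c =
        (tensorT N V).act (.ofNat n) _ rfl s c + (tensorT N V).act (.ofNat n) _ rfl t c :=
        TGMod.act_add _ _ _ _ _ _ _
      exact (((congrArg (extendT g _) h1).trans (map_add (extendT g (.ofNat n + 1)) _ _)).trans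
        (congrArg₂ (· + ·) hs ht)).trans
        ((congrArg (fun y => P.act (.ofNat n) _ rfl y c) (map_add (extendT g (.ofNat n)) s t)).trans
          (P.act_add (.ofNat n) _ rfl _ _ c)).symm

theorem restrictT_extendT (g : N →ₗ[Bᵐᵒᵖ] P.X 0) : restrictT (extendT (V := V) g) = g := by
  refine LinearMap.ext fun x => ?_
  have h : restrictT (extendT (V := V) g) x = g x <• (1 : B) := rfl
  rw [h, op_one, one_smul]

/-- A `T`-linear map out of `N ⊗_B T` is determined by its restriction to `N`. -/
theorem eq_zero_of_restrictT {f : ∀ i, tensorTX N V i →ₗ[Bᵐᵒᵖ] P.X i}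
    (hf : TGMod.IsTLinear (M := tensorT N V) f) (h0 : restrictT f = 0) : f = 0 := by
  have key : ∀ n : ℕ, f (.ofNat n) = 0 := by
    intro n
    induction n with
    | zero =>
      refine LinearMap.ext fun t => ?_
      refine DGMod.tensor_induction (M := N) (X := B.regBimod) t ?_ ?_ ?_
      · exact map_zero _
      · intro x (b : B)
        have h1 : DGMod.tmul B.regBimod x b = op b • DGMod.tmul B.regBimod x (regOne B) := by
          rw [DGMod.op_smul_tmul]
          exact congrArg (DGMod.tmul B.regBimod x) (one_mul b).symm
        have h2 : (f (.ofNat 0)) (DGMod.tmul B.regBimod x (regOne B)) = 0 :=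
          LinearMap.congr_fun h0 x
        rw [h1]
        exact (map_smul (f (.ofNat 0)) (op b) _).trans (by rw [h2, smul_zero]; rfl)
      · intro s t hs ht
        exact (map_add (f (.ofNat 0)) s t).trans ((congrArg₂ (· + ·) hs ht).trans (add_zero 0))
    | succ n ih =>
      refine LinearMap.ext fun t => ?_
      refine DGMod.tensor_induction (M := N) (X := tensorPow V (n + 1)) t ?_ ?_ ?_
      · exact map_zero _
      · intro x s
        refine DFunLike.congr_fun (powMul_ext n ((f (.ofNat (n + 1))).toAddMonoidHom.comp
          (DGMod.tmulHom N (tensorPow V (n + 1)) x)) fun t c => ?_) s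
        refine (hf (.ofNat n) (.ofNat (n + 1)) rfl (DGMod.tmul (tensorPow V n) x t) c).trans ?_
        rw [ih]
        exact TGMod.act_zero _ _ _ _ _
      · intro s t hs ht
        exact (map_add (f (.ofNat (n + 1))) s t).trans
          ((congrArg₂ (· + ·) hs ht).trans (add_zero 0))
  funext i
  match i with
  | .ofNat n => exact key n
  | .negSucc n => exact LinearMap.ext fun x => map_zero (f (.negSucc n))

/-- The difference of the two sides is T-linear and restricts to zero on N, so
`eq_zero_of_restrictT` applies. -/
theorem extendT_restrictT {f : ∀ i, tensorTX N V i →ₗ[Bᵐᵒᵖ] P.X i}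
    (hf : TGMod.IsTLinear (M := tensorT N V) f) : extendT (restrictT f) = f := by
  refine sub_eq_zero.1 (eq_zero_of_restrictT (f := extendT (restrictT f) - f) ?_ ?_)
  · intro i j h x c
    have h1 := isTLinear_extendT (V := V) (restrictT f) i j h x c
    have h2 := hf i j h x c
    have h3 : ∀ y z : P.X i, P.act i j h (y - z) c = P.act i j h y c - P.act i j h z c := by
      intro y z
      rw [sub_eq_add_neg, sub_eq_add_neg, TGMod.act_add, TGMod.act_neg]
    exact (congrArg₂ (· - ·) h1 h2).trans (h3 _ _).symm
  · have h : restrictT (extendT (restrictT f) - f) =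
      restrictT (extendT (V := V) (restrictT f)) - restrictT f := rfl
    rw [h, restrictT_extendT, sub_self]

theorem extendT_mem_DGHom {g : N →ₗ[Bᵐᵒᵖ] P.X 0} (hg : g ∈ DGHom N (P.X 0)) :
    ∀ i, extendT g i ∈ DGHom (tensorTX N V i) (P.X i)
  | .ofNat n => (DGHom.comp (P.iterAct n 0 n (zero_add _))
      (DGHom.rTensor ⟨g, hg⟩ (tensorPow V n))).2
  | .negSucc _ => zero_mem _

theorem isNullHomotopy_extendT {g h : N →ₗ[Bᵐᵒᵖ] P.X 0} (H : IsNullHomotopy g h) :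
    ∀ i, IsNullHomotopy (M := tensorTX N V i) (extendT g i) (extendT h i)
  | .negSucc _ => .zero
  | .ofNat n => by
    have h1 := isNullHomotopy_linRTensor H (tensorPow V n)
    let q := P.iterAct n 0 n (zero_add _)
    have key : ∀ x : N.tensor (tensorPow V n), q.1 (linRTensor g (tensorPow V n) x) =
        (P.X n).d (q.1 (linRTensor h (tensorPow V n) x)) +
          q.1 (linRTensor h (tensorPow V n) ((N.tensor (tensorPow V n)).d x)) := fun x => by
      rw [h1.eq, map_add, q.2.2]
    exact ⟨fun i x hx => q.2.1 _ _ (h1.map_mem i x hx), key⟩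

/-- The `T`-linear extension of a homomorphism `N → P^0` of DG modules. -/
def extendHom (g : DGHom N (P.X 0)) : TGHom (tensorT N V) P :=
  ⟨extendT g.1, extendT_mem_DGHom g.2, isTLinear_extendT g.1⟩

theorem restrictT_mem_DGHom (F : TGHom (tensorT N V) P) : restrictT F.1 ∈ DGHom N (P.X 0) :=
  (DGHom.comp (M := N) (N := N.tensor B.regBimod) (P := P.X 0) ⟨F.1 0, F.2.1 0⟩ (DGHom.ridInv N)).2

/-- Restricting a T-linear homotopy to N gives one direction. Conversely, a homotopy on N extends
T-linearly to a homotopy of `extendT (restrictT F.1)`, which is F. This is the adjunction on the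
level of homotopy categories. -/
theorem mem_tgNullHtp_iff (F : TGHom (tensorT N V) P) :
    F ∈ tgNullHtp (tensorT N V) P ↔ ∃ h, IsNullHomotopy (restrictT F.1) h := by
  constructor
  · rintro ⟨h, H, -⟩
    refine ⟨restrictT h, fun i x hx => ?_, fun x => ?_⟩
    · exact (H 0).map_mem i _ ((DGHom.ridInv N).2.1 i x hx)
    · have h1 := (H 0).eq ((DGHom.ridInv N).1 x)
      have h2 := (DGHom.ridInv N).2.2 x
      refine h1.trans ?_
      exact congrArg (fun y => (P.X 0).d (h 0 ((DGHom.ridInv N).1 x)) + h 0 y) h2.symm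
  · rintro ⟨h, H⟩
    refine ⟨extendT h, fun i => ?_, isTLinear_extendT h⟩
    have h1 := isNullHomotopy_extendT (V := V) H i
    rwa [extendT_restrictT F.2.2] at h1

end Free

/-! ### Composition with `ω_N` -/

section OmegaComp

variable {A : DGAlg.{u, v} R} {B : DGAlg.{u, v'} R} (φ : DGAlgHom A B)
  {N : DGMod.{u, v', w} B} (E : SemifreeBasis N) {S : DGMod.{u, v', w'} B}

/-- In tensor degree 0 the source and target of ω_N[n] have indices 0 + n and 0 + (n + 1), but ω_N
itself ends at (0 + n) + 1. With variables for these indices the casts disappear by substitution,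
and the claim becomes `Splitting.exists_lift` with X = T^n. -/
theorem exists_lift_extendX {n : ℕ} {k l j : ℤ} (hk : k = n) (hl : k + 1 = l) (hj : l = j) {m : ℤ}
    (H : Vanishes S (resTensor φ N (tensorPow (suspDiag φ) n)) (m + 1))
    {g : S →ₗ[Bᵐᵒᵖ] (diagT φ N).X j} (hg : IsChain m g) :
    ∃ f : S →ₗ[Bᵐᵒᵖ] (diagT φ N).X k, IsChain m f ∧ ∃ h, IsNull m
      (g - (hj ▸ LinearMap.id : (diagT φ N).X l →ₗ[Bᵐᵒᵖ] (diagT φ N).X j) ∘ₗ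
        ((hl ▸ (extendX (atiyah φ E) k).1 : (diagT φ N).X k →ₗ[Bᵐᵒᵖ] (diagT φ N).X l)) ∘ₗ f) h := by
  subst hk hl hj
  exact (atiyahSplitting φ (tensorPow (suspDiag φ) n) E).exists_lift H hg

theorem exists_null_extendX {n : ℕ} {k l j : ℤ} (hk : k = n) (hl : k + 1 = l) (hj : l = j) {m : ℤ}
    (H : Vanishes S (resTensor φ N (tensorPow (suspDiag φ) n)) m)
    {f : S →ₗ[Bᵐᵒᵖ] (diagT φ N).X k} (hf : IsChain m f)
    {h : S →ₗ[Bᵐᵒᵖ] (diagT φ N).X j} (hh : IsNull m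
      ((hj ▸ LinearMap.id : (diagT φ N).X l →ₗ[Bᵐᵒᵖ] (diagT φ N).X j) ∘ₗ
        ((hl ▸ (extendX (atiyah φ E) k).1 : (diagT φ N).X k →ₗ[Bᵐᵒᵖ] (diagT φ N).X l)) ∘ₗ f) h) :
    ∃ h', IsNull m f h' := by
  subst hk hl hj
  exact (atiyahSplitting φ (tensorPow (suspDiag φ) n) E).exists_null H hf hh

/-- A representative of `Σ^m(ω_N[n])`. -/
def omegaHom (m n : ℤ) : TGHom (((diagT φ N).tshift n).shift m)
    (((diagT φ N).tshift (n + 1)).shift m) :=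
  TGHom.shift m (TGHom.comp (TGHom.tshiftAdd (diagT φ N) n 1)
    (TGHom.tshift n (extend (atiyah φ E))))

theorem omegaComp_cls (m n : ℤ) (F : TGHom (diagT φ N) (((diagT φ N).tshift n).shift m)) :
    omegaComp φ E m n (TGHom.cls F) = TGHom.cls (TGHom.comp (omegaHom φ E m n) F) := rfl

/-- By adjunction this is composition with the Atiyah map tensored with T^n, so exactness at N ⊗_B
ΣJ ⊗_B T^n requires vanishing one shift higher, at m + 1. -/
theorem omegaComp_surjective {m : ℤ} {n : ℕ}
    (H : Vanishes N (resTensor φ N (tensorPow (suspDiag φ) n)) (m + 1)) :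
    Function.Surjective (omegaComp φ E m n) := by
  intro y
  obtain ⟨G, rfl⟩ := QuotientAddGroup.mk_surjective y
  obtain ⟨h1, h2⟩ := restrictT_mem_DGHom G
  obtain ⟨f, hf, h, hh⟩ := exists_lift_extendX φ E (n := n) (k := 0 + n) (zero_add _) rfl
    (add_assoc 0 (n : ℤ) 1) H (g := restrictT G.1) ⟨h1, h2⟩
  let f' : DGHom N ((((diagT φ N).tshift n).shift m).X 0) := ⟨f, hf.map_mem, hf.map_d⟩
  refine ⟨TGHom.cls (extendHom f'), ?_⟩
  rw [omegaComp_cls]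
  refine Eq.symm ((QuotientAddGroup.eq_iff_sub_mem
    (N := tgNullHtp (diagT φ N) (((diagT φ N).tshift (n + 1)).shift m))).2
      ((mem_tgNullHtp_iff _).2 ⟨h, ?_⟩))
  have e : restrictT (G - TGHom.comp (omegaHom φ E m n) (extendHom f')).1 =
      restrictT G.1 - ((omegaHom φ E m n).1 0) ∘ₗ restrictT (extendHom f').1 := rfl
  rw [e]
  have e2 : restrictT (extendHom f').1 = f := restrictT_extendT f'.1
  rw [e2]
  exact ⟨hh.map_mem, hh.eq⟩

/-- By adjunction and exactness at N ⊗_B T^n; here the vanishing is needed in the shift m itself. -/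
theorem omegaComp_injective {m : ℤ} {n : ℕ}
    (H : Vanishes N (resTensor φ N (tensorPow (suspDiag φ) n)) m) :
    Function.Injective (omegaComp φ E m n) := by
  rw [injective_iff_map_eq_zero]
  intro y hy
  obtain ⟨F, rfl⟩ := QuotientAddGroup.mk_surjective y
  obtain ⟨h, hh⟩ := (mem_tgNullHtp_iff _).1 ((QuotientAddGroup.eq_zero_iff _).1
    ((omegaComp_cls φ E m n F).symm.trans hy))
  obtain ⟨h1, h2⟩ := restrictT_mem_DGHom F
  obtain ⟨h', hh'⟩ := exists_null_extendX φ E (n := n) (k := 0 + n) (zero_add _) rfl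
    (add_assoc 0 (n : ℤ) 1) H (f := restrictT F.1) ⟨h1, h2⟩ (h := h) ⟨hh.map_mem, hh.eq⟩
  exact (QuotientAddGroup.eq_zero_iff _).2 ((mem_tgNullHtp_iff _).2 ⟨h', hh'.map_mem, hh'.eq⟩)

theorem tensorTX_eq_zero (V : DGBimod.{u, v', v', v'} B B) {i : ℤ} (hi : i < 0)
    (x : tensorTX N V i) : x = 0 := by
  match i with
  | .negSucc _ => rfl

/-- By adjunction such a class comes from a map from N to the component of N ⊗_B T in tensor degree
n < 0, which is zero. -/
theorem TGHomK_eq_zero {m n : ℤ} (hn : n < 0)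
    (y : TGHomK (diagT φ N) (((diagT φ N).tshift n).shift m)) : y = 0 := by
  obtain ⟨F, rfl⟩ := QuotientAddGroup.mk_surjective y
  refine (QuotientAddGroup.eq_zero_iff _).2 ((mem_tgNullHtp_iff _).2 ⟨0, ?_⟩)
  have h : restrictT F.1 = 0 :=
    LinearMap.ext fun x => tensorTX_eq_zero (N := N) (suspDiag φ) (i := 0 + n) (by omega) _
  rw [h]
  exact .zero

end OmegaComp

end DG

end

/-- `A`, `B` are DG `R`-algebras, `φ : A → B` satisfies the standing assumptions, and `N` is a DG
`B`-module with semifree basis `E` that satisfies condition `(AR1)`. -/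
theorem theorem4p2 {R : Type*} [CommRing R]
    {A : DG.DGAlg R} {B : DG.DGAlg R} (φ : DG.DGAlgHom A B)
    (hφ : DG.IsSetting φ) (N : DG.DGMod B) (E : DG.SemifreeBasis N)
    (hN : DG.AR1 φ N) :
    (∀ m n : ℕ, Function.Surjective (DG.omegaComp φ E m n)) ∧
    (∀ m n : ℕ, (1 ≤ m ∨ 1 ≤ n) → Function.Bijective (DG.omegaComp φ E m n)) ∧
    (∀ (m : ℕ) (y : DG.StarHom φ N m), y 0 = 0 →
      ∃ x : DG.StarHom φ N m, DG.omegaAct φ E m x = y) := by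
  -- Surjectivity uses vanishing in shift m + 1 ≥ 1, available for every n. Injectivity uses it in
  -- shift m, whence the condition that m ≥ 1 or n ≥ 1.
  have hs : ∀ m n : ℕ, Function.Surjective (DG.omegaComp φ E m n) := fun m n =>
    DG.omegaComp_surjective φ E (DG.vanishes_resTensor φ hφ hN n (by omega))
  refine ⟨hs, fun m n h => ⟨?_, hs m n⟩, fun m y hy => ?_⟩
  · exact DG.omegaComp_injective φ E (DG.vanishes_resTensor φ hφ hN n (by omega))
  · classical
    rw [← DirectSum.sum_support_of y]
    change _ ∈ (DG.omegaAct φ E m).range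
    refine sum_mem fun n _ => ?_
    -- Components with n < 0 lie in zero groups, the component at n = 0 is zero by hypothesis, and
    -- the one at n = k + 1 is reached from k ≥ 0 by surjectivity.
    rcases lt_trichotomy n 0 with hn | rfl | hn
    · rw [DG.TGHomK_eq_zero φ hn (y n), map_zero]
      exact zero_mem _
    · rw [hy, map_zero]
      exact zero_mem _
    · obtain ⟨k, rfl⟩ : ∃ k : ℕ, n = k + 1 := ⟨(n - 1).toNat, by omega⟩
      obtain ⟨z, hz⟩ := hs m k (y (k + 1))
      refine ⟨DirectSum.of (fun n : ℤ => DG.TGHomK (DG.diagT φ N)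
        (((DG.diagT φ N).tshift n).shift m)) k z, ?_⟩
      unfold DG.omegaAct
      rw [DirectSum.toAddMonoid_of, AddMonoidHom.comp_apply, hz]
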